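/- \textbf{Conventions.} All algebras are associative, not necessarily unital, over $\mathbb{C}$. $M(A)$ denotes the multiplier algebra of $A$: pairs $m=(\lambda,\rho)\in \mathrm{End}(A)\oplus\mathrm{End}(A)^{\mathrm{op}}$, written $ma=\lambda(a)$, $am=\rho(a)$, with $a(mb)=(am)b$ for all $a,b\in A$. For subspaces, $V\cdot W$ is the linear span of all products. Let $J$ be a set. A $J$-partial algebra is an algebra with a vector space decomposition $A=\bigoplus_{j,k\in J}A(j,k)$ such that $A(j,k)A(k',l)=0$ for $k\ne k'$ and $A(j,k)A(k,l)\subseteq A(j,l)$. It is non-degenerate if for each $k$ the column algebra $C_k=\bigoplus_jA(j,k)$ satisfies ($a\in C_k$, $aC_k=0\Rightarrow a=0$) and for each $j$ the row algebra $R_j=\bigoplus_kA(j,k)$ satisfies ($a\in R_j$, $R_ja=0\Rightarrow a=0$); it is idempotent if $C_kC_k=C_k$ and $R_jR_j=R_j$ for all $j,k$. The base unit $\mathbf 1(j)\in M(A)$ is given by $\mathbf 1(j)a=\delta_{j,j'}a$ and $a\mathbf 1(j)=\delta_{j,k'}a$ for $a\in A(j',k')$. Let $I$ be a set and $A$ an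 $I^2$-partial algebra. Write ${}^r_tA^s_u=A((r,t),(s,u))$, and let an omitted index mean the direct sum over that index, so that e.g. $A_u=\bigoplus_{r,s,t}{}^r_tA^s_u$. Put $\mathbf 1^r=\sum_t\mathbf 1(r,t)$ and $\mathbf 1_t=\sum_r\mathbf 1(r,t)$ in $M(A)$ (strictly convergent sums), and $E=\sum_t\mathbf 1_t\otimes\mathbf 1^t\in M(A\otimes A)$. Let $A\otimes^IA=E(A\otimes A)E=\bigoplus {}^r_tA^s_u\otimes{}^t_vA^u_w$, an $I^2$-partial algebra with components ${}^r_v(A\otimes^IA)^s_w=\bigoplus_{t,u}{}^r_tA^s_u\otimes{}^t_vA^u_w$. For $A$ non-degenerate and idempotent, restriction of multipliers identifies $EM(A\otimes A)E$ with $M(A\otimes^IA)$. A regular $I$-partial multiplier bialgebra $(A,\Delta)$ consists of a non-degenerate, idempotent $I^2$-partial algebra $A$ and an algebra homomorphism $\Delta:A\to M(A\otimes^IA)=EM(A\otimes A)E$ such that (a) $\Delta$ is a morphism of $I^2$-partial algebras: with $B=A\otimes^I A$, one has, for all $r,t\in I$, $B^r_t\,\Delta(A^r_t)=B^r_t$ and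 $\Delta({}^r_tA)\,{}^r_tB={}^r_tB$; (b) for all $a,b\in A$, the multipliers $\Delta(a)(b\otimes1)$, $\Delta(a)(1\otimes b)$, $(b\otimes1)\Delta(a)$, $(1\otimes b)\Delta(a)$ lie in $A\otimes A$; (c) $(\Delta\otimes\mathrm{id})\Delta=(\mathrm{id}\otimes\Delta)\Delta$, where $\Delta\otimes\mathrm{id}$ and $\mathrm{id}\otimes\Delta$ denote the unique extensions of $A\otimes^IA\to M(A\otimes^IA\otimes^IA)$ to $M(A\otimes^IA)$; and for which there is a linear functional $\varepsilon:A\to\mathbb{C}$ (the counit, which is then unique) with $\varepsilon({}^r_tA^s_u)=0$ whenever $r\neq t$ or $s\neq u$; $\varepsilon(A_r)\ne0\ne\varepsilon({}_rA)$ for all $r\in I$; $\varepsilon(ab)=\varepsilon(a)\varepsilon(b)$ for all $s,t\in I$, $a\in A^s_t$, $b\in{}^s_tA$; and $(\mathrm{id}\otimes\varepsilon)\Delta(a)=(\varepsilon\otimes\mathrm{id})\Delta(a)=a$ for all $a\in A$. Write $\Delta(a)=a_{(1)}\otimes a_{(2)}$ and $\Delta^{\mathrm{op}}$ for $\Delta$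 followed by the flip. $(A,\Delta)$ is a regular $I$-partial multiplier Hopf algebra if the following four maps are bijective: $$\bigoplus_r A_r\otimes{}_rA\to\bigoplus_r{}_rA\otimes{}^rA,\quad a\otimes b\mapsto\Delta(a)(1\otimes b),\qquad \bigoplus_r A^r\otimes{}^rA\to\bigoplus_r A_r\otimes A^r,\quad a\otimes b\mapsto(a\otimes1)\Delta(b),$$ $$\bigoplus_r A^r\otimes{}^rA\to\bigoplus_r{}^rA\otimes{}_rA,\quad a\otimes b\mapsto\Delta^{\mathrm{op}}(a)(1\otimes b),\qquad \bigoplus_r A_r\otimes{}_rA\to\bigoplus_r A^r\otimes A_r,\quad a\otimes b\mapsto(a\otimes1)\Delta^{\mathrm{op}}(b).$$ \textbf{Proposition.} Let $(A,\Delta)$ be a regular $I$-partial multiplier bialgebra with counit $\varepsilon$. Then $(A,\Delta)$ is a regular $I$-partial multiplier Hopf algebra if and only if there exists a bijective (linear) anti-homomorphism $S:A\to A$ such that, extending $S$ to $M(A)$, one has $S(\mathbf 1_r)=\mathbf 1^r$ and $S(\mathbf 1^r)=\mathbf 1_r$ for all $r\in I$, and $$S(a_{(1)})a_{(2)}b=\varepsilon(a)\mathbf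 1_sb\quad\text{for all } s\in I,\ a\in A_s,\ b\in A,$$ $$ba_{(1)}S(a_{(2)})=\varepsilon(a)b\mathbf 1^r\quad\text{for all } r\in I,\ a\in{}^rA,\ b\in A.$$ (Here the left-hand sides are the images of $\Delta(a)(1\otimes b)\in A\otimes A$ under $x\otimes y\mapsto S(x)y$ and of $(b\otimes1)\Delta(a)\in A\otimes A$ under $x\otimes y\mapsto xS(y)$.) Moreover, such a map $S$ is unique, and it satisfies $$S(a)_{(1)}\otimes S(a)_{(2)}=S(a_{(2)})\otimes S(a_{(1)})\quad(a\in A),\qquad \varepsilon\circ S=\varepsilon,$$ where the right-hand side of the first identity is the value at $\Delta(a)$ of the extension to $M(A\otimes A)$ of the anti-automorphism $x\otimes y\mapsto S(y)\otimes S(x)$. -/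

import Mathlib

open scoped TensorProduct

noncomputable section

namespace PartialHopf

universe u v w

/-! ### Multiplier algebras -/

section Multipliers

variable (A : Type u) [NonUnitalRing A] [Module ℂ A] [IsScalarTower ℂ A A] [SMulCommClass ℂ A A]
variable (B : Type v) [NonUnitalRing B] [Module ℂ B] [IsScalarTower ℂ B B] [SMulCommClass ℂ B B]

/-- The multiplier algebra `M(A)` of a (not necessarily unital) complex algebra `A`: all pairs
`(l, r)` in `End(A) ⊕ End(A)ᵒᵖ` with `a * l b = r a * b` for all `a, b`. -/
def multiplierAlgebra : Subalgebra ℂ (Module.End ℂ A × (Module.End ℂ A)ᵐᵒᵖ) where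
  carrier := {m | ∀ a b : A, a * m.1 b = m.2.unop a * b}
  mul_mem' := by
    intro m n hm hn a b
    simp only [Prod.fst_mul, Prod.snd_mul, MulOpposite.unop_mul, Module.End.mul_apply]
    rw [hm, hn]
  add_mem' := by
    intro m n hm hn a b
    simp only [Prod.fst_add, Prod.snd_add, MulOpposite.unop_add, LinearMap.add_apply, mul_add,
      add_mul]
    rw [hm, hn]
  algebraMap_mem' := by
    intro c a b
    simp [Prod.algebraMap_apply, MulOpposite.algebraMap_apply, Module.algebraMap_end_apply,
      mul_smul_comm, smul_mul_assoc]

/-- The type of multipliers of `A`. -/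
abbrev Multiplier : Type u := multiplierAlgebra A

variable {A B}

/-- `m.left a` is the product `m a`. -/
def Multiplier.left (m : Multiplier A) : A →ₗ[ℂ] A := m.1.1

/-- `m.right a` is the product `a m`. -/
def Multiplier.right (m : Multiplier A) : A →ₗ[ℂ] A := m.1.2.unop

variable (A) in
/-- The canonical map `A → M(A)` (injective if `A` is non-degenerate). -/
def Multiplier.incl : A →ₗ[ℂ] Multiplier A where
  toFun a := ⟨(LinearMap.mulLeft ℂ a, MulOpposite.op (LinearMap.mulRight ℂ a)), by
    intro x y
    simp [mul_assoc]⟩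
  map_add' a b := by
    apply Subtype.ext
    apply Prod.ext
    · ext x; simp [add_mul]
    · apply MulOpposite.unop_injective
      ext x; simp [mul_add]
  map_smul' c a := by
    apply Subtype.ext
    apply Prod.ext
    · ext x; simp [smul_mul_assoc]
    · apply MulOpposite.unop_injective
      ext x; simp [mul_smul_comm]

variable (A B) in
/-- The canonical bilinear map `M(A) × M(B) → M(A ⊗ B)`, `(m, n) ↦ m ⊗ n`. -/
def Multiplier.tmul : Multiplier A →ₗ[ℂ] Multiplier B →ₗ[ℂ] Multiplier (A ⊗[ℂ] B) :=
  LinearMap.mk₂ ℂ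
    (fun m n => ⟨(TensorProduct.map m.left n.left,
        MulOpposite.op (TensorProduct.map m.right n.right)), by
      intro x y
      change x * TensorProduct.map m.left n.left y = TensorProduct.map m.right n.right x * y
      induction x using TensorProduct.induction_on with
      | zero => simp
      | add x₁ x₂ h₁ h₂ => simp only [add_mul, map_add, h₁, h₂]
      | tmul a b =>
        induction y using TensorProduct.induction_on with
        | zero => simp
        | add y₁ y₂ h₁ h₂ => simp only [mul_add, map_add, h₁, h₂]
        | tmul c d =>
          simp only [TensorProduct.map_tmul, Algebra.TensorProduct.tmul_mul_tmul]
          exact congrArg₂ _ (m.2 a c) (n.2 b d)⟩)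
    (fun m₁ m₂ n => by
      apply Subtype.ext
      apply Prod.ext
      · exact TensorProduct.map_add_left _ _ _
      · exact congrArg MulOpposite.op (TensorProduct.map_add_left _ _ _))
    (fun c m n => by
      apply Subtype.ext
      apply Prod.ext
      · exact TensorProduct.map_smul_left _ _ _
      · exact congrArg MulOpposite.op (TensorProduct.map_smul_left _ _ _))
    (fun m n₁ n₂ => by
      apply Subtype.ext
      apply Prod.ext
      · exact TensorProduct.map_add_right _ _ _
      · exact congrArg MulOpposite.op (TensorProduct.map_add_right _ _ _))
    (fun c m n => by
      apply Subtype.ext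
      apply Prod.ext
      · exact TensorProduct.map_smul_right _ _ _
      · exact congrArg MulOpposite.op (TensorProduct.map_smul_right _ _ _))

/-- Transport of multipliers along an isomorphism of algebras. -/
def Multiplier.transport (e : A ≃ₗ[ℂ] B) (he : ∀ x y, e (x * y) = e x * e y) :
    Multiplier A →ₗ[ℂ] Multiplier B where
  toFun m := ⟨(e.toLinearMap ∘ₗ m.left ∘ₗ e.symm.toLinearMap,
      MulOpposite.op (e.toLinearMap ∘ₗ m.right ∘ₗ e.symm.toLinearMap)), by
    intro x y
    change x * e (m.left (e.symm y)) = e (m.right (e.symm x)) * y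
    have h := congrArg e (m.2 (e.symm x) (e.symm y))
    rw [he, he, e.apply_symm_apply, e.apply_symm_apply] at h
    exact h⟩
  map_add' m n := by
    apply Subtype.ext
    apply Prod.ext
    · ext x; exact map_add e _ _
    · apply MulOpposite.unop_injective
      ext x; exact map_add e _ _
  map_smul' c m := by
    apply Subtype.ext
    apply Prod.ext
    · ext x; exact map_smul e _ _
    · apply MulOpposite.unop_injective
      ext x; exact map_smul e _ _

variable (A) in
/-- The flip `A ⊗ A → A ⊗ A` on the level of multipliers: `M(A ⊗ A) → M(A ⊗ A)`. -/
def Multiplier.flip : Multiplier (A ⊗[ℂ] A) →ₗ[ℂ] Multiplier (A ⊗[ℂ] A) :=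
  Multiplier.transport (TensorProduct.comm ℂ A A) (by
    intro x y
    induction x using TensorProduct.induction_on with
    | zero => simp
    | add x₁ x₂ h₁ h₂ => simp only [add_mul, map_add, h₁, h₂]
    | tmul a b =>
      induction y using TensorProduct.induction_on with
      | zero => simp
      | add y₁ y₂ h₁ h₂ => simp only [mul_add, map_add, h₁, h₂]
      | tmul c d => simp)

variable (A) in
/-- The identification `M(A ⊗ (A ⊗ A)) = M((A ⊗ A) ⊗ A)`. -/
def Multiplier.assocSymm :
    Multiplier (A ⊗[ℂ] (A ⊗[ℂ] A)) →ₗ[ℂ] Multiplier ((A ⊗[ℂ] A) ⊗[ℂ] A) :=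
  Multiplier.transport (TensorProduct.assoc ℂ A A A).symm (by
    intro x y
    induction x using TensorProduct.induction_on with
    | zero => simp
    | add x₁ x₂ h₁ h₂ => simp only [add_mul, map_add, h₁, h₂]
    | tmul a z =>
      induction z using TensorProduct.induction_on with
      | zero => simp
      | add x₁ x₂ h₁ h₂ => simp only [TensorProduct.tmul_add, add_mul, map_add, h₁, h₂]
      | tmul b c =>
        induction y using TensorProduct.induction_on with
        | zero => simp
        | add y₁ y₂ h₁ h₂ => simp only [mul_add, map_add, h₁, h₂]
        | tmul a' z' =>
          induction z' using TensorProduct.induction_on with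
          | zero => simp
          | add y₁ y₂ h₁ h₂ => simp only [TensorProduct.tmul_add, mul_add, map_add, h₁, h₂]
          | tmul b' c' => simp)

/-- For a bijective anti-homomorphism `S : A → A`, the statement that the extension of `S` to
multipliers maps `m` to `n`: `S(a m) = n S(a)` and `S(m a) = S(a) n` for all `a`. -/
def AntiExtends (S : A →ₗ[ℂ] A) (m n : Multiplier A) : Prop :=
  ∀ a, S (m.right a) = n.left (S a) ∧ S (m.left a) = n.right (S a)

/-- `m = (id ⊗ ω)(x)`, that is, `m a = (id ⊗ ω)(x (a ⊗ 1))` and `a m = (id ⊗ ω)((a ⊗ 1) x)`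
for all `a`. -/
def IsSliceSnd (ω : B →ₗ[ℂ] ℂ) (x : Multiplier (A ⊗[ℂ] B)) (m : Multiplier A) : Prop :=
  ∀ (a : A) (z : A ⊗[ℂ] B),
    (Multiplier.incl _ z = x * Multiplier.tmul A B (Multiplier.incl A a) 1 →
      m.left a = TensorProduct.rid ℂ A (TensorProduct.map LinearMap.id ω z)) ∧
    (Multiplier.incl _ z = Multiplier.tmul A B (Multiplier.incl A a) 1 * x →
      m.right a = TensorProduct.rid ℂ A (TensorProduct.map LinearMap.id ω z))

/-- `m = (ω ⊗ id)(x)`, that is, `m b = (ω ⊗ id)(x (1 ⊗ b))` and `b m = (ω ⊗ id)((1 ⊗ b) x)`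
for all `b`. -/
def IsSliceFst (ω : A →ₗ[ℂ] ℂ) (x : Multiplier (A ⊗[ℂ] B)) (m : Multiplier B) : Prop :=
  ∀ (b : B) (z : A ⊗[ℂ] B),
    (Multiplier.incl _ z = x * Multiplier.tmul A B 1 (Multiplier.incl B b) →
      m.left b = TensorProduct.lid ℂ B (TensorProduct.map ω LinearMap.id z)) ∧
    (Multiplier.incl _ z = Multiplier.tmul A B 1 (Multiplier.incl B b) * x →
      m.right b = TensorProduct.lid ℂ B (TensorProduct.map ω LinearMap.id z))

/-- `x` is a restricted multiplier: `x(a ⊗ 1)`, `x(1 ⊗ b)`, `(a ⊗ 1)x` and `(1 ⊗ b)x` all lie in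
`A ⊗ B` (more precisely, in its image in `M(A ⊗ B)`). -/
def IsRestricted (x : Multiplier (A ⊗[ℂ] B)) : Prop :=
  (∀ a : A, x * Multiplier.tmul A B (Multiplier.incl A a) 1 ∈
    LinearMap.range (Multiplier.incl (A ⊗[ℂ] B))) ∧
  (∀ b : B, x * Multiplier.tmul A B 1 (Multiplier.incl B b) ∈
    LinearMap.range (Multiplier.incl (A ⊗[ℂ] B))) ∧
  (∀ a : A, Multiplier.tmul A B (Multiplier.incl A a) 1 * x ∈
    LinearMap.range (Multiplier.incl (A ⊗[ℂ] B))) ∧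
  (∀ b : B, Multiplier.tmul A B 1 (Multiplier.incl B b) * x ∈
    LinearMap.range (Multiplier.incl (A ⊗[ℂ] B)))

end Multipliers

/-! ### Gradings -/

section Gradings

variable {J : Type w} {A : Type u} [NonUnitalRing A] [Module ℂ A]

/-- `⊕_r G r s`. -/
def colPart (G : J → J → Submodule ℂ A) (s : J) : Submodule ℂ A := ⨆ r, G r s

/-- `⊕_s G r s`. -/
def rowPart (G : J → J → Submodule ℂ A) (r : J) : Submodule ℂ A := ⨆ s, G r s

/-- The linear span `V · W` of all products. -/
def mulSpan (V W : Submodule ℂ A) : Submodule ℂ A :=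
  Submodule.span ℂ {x | ∃ a ∈ V, ∃ b ∈ W, x = a * b}

variable (J A) in
/-- A `J`-partial algebra structure on the algebra `A`. -/
structure PartialAlgebra where
  /-- the component of index `(r, s)` -/
  grade : J → J → Submodule ℂ A
  independent : iSupIndep fun p : J × J => grade p.1 p.2
  iSup_eq_top : ⨆ p : J × J, grade p.1 p.2 = ⊤
  mul_eq_zero : ∀ {r s s' t : J}, s ≠ s' → ∀ a ∈ grade r s, ∀ b ∈ grade s' t, a * b = 0
  mul_mem : ∀ {r s t : J}, ∀ a ∈ grade r s, ∀ b ∈ grade s t, a * b ∈ grade r t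

namespace PartialAlgebra

variable (G : PartialAlgebra J A)

/-- Every column algebra `A_s` is left non-degenerate, every row algebra `_rA` is right
non-degenerate. -/
def Nondegenerate : Prop :=
  (∀ s, ∀ a ∈ colPart G.grade s, (∀ b ∈ colPart G.grade s, a * b = 0) → a = 0) ∧
  (∀ r, ∀ a ∈ rowPart G.grade r, (∀ b ∈ rowPart G.grade r, b * a = 0) → a = 0)

/-- All column algebras `A_s` and row algebras `_rA` are idempotent. -/
def Idempotent : Prop :=
  (∀ s, mulSpan (colPart G.grade s) (colPart G.grade s) = colPart G.grade s) ∧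
  (∀ r, mulSpan (rowPart G.grade r) (rowPart G.grade r) = rowPart G.grade r)

theorem coe_bijective [DecidableEq (J × J)] :
    Function.Bijective (DirectSum.coeLinearMap fun p : J × J => G.grade p.1 p.2) :=
  (DirectSum.isInternal_submodule_iff_iSupIndep_and_iSup_eq_top _).2
    ⟨G.independent, G.iSup_eq_top⟩

open scoped Classical in
/-- The projection of `A` onto the sum of the components with index in `P`. -/
def proj (P : Set (J × J)) : A →ₗ[ℂ] A :=
  DirectSum.toModule ℂ (J × J) A
      (fun p => if p ∈ P then (G.grade p.1 p.2).subtype else 0) ∘ₗ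
    (LinearEquiv.ofBijective
      (DirectSum.coeLinearMap fun p : J × J => G.grade p.1 p.2) G.coe_bijective).symm.toLinearMap

open scoped Classical in
theorem proj_of_mem (P : Set (J × J)) {r s : J} {a : A} (ha : a ∈ G.grade r s) :
    G.proj P a = if (r, s) ∈ P then a else 0 := by
  have h : (LinearEquiv.ofBijective
      (DirectSum.coeLinearMap fun p : J × J => G.grade p.1 p.2) G.coe_bijective).symm a =
      DirectSum.lof ℂ (J × J) (fun p => G.grade p.1 p.2) (r, s) ⟨a, ha⟩ := by
    rw [LinearEquiv.symm_apply_eq, LinearEquiv.ofBijective_apply, DirectSum.coeLinearMap_lof]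
  simp only [proj, LinearMap.comp_apply, LinearEquiv.coe_coe, h, DirectSum.toModule_lof]
  split_ifs <;> simp

theorem induction {motive : A → Prop} (zero : motive 0)
    (add : ∀ a b, motive a → motive b → motive (a + b))
    (hom : ∀ r s, ∀ a ∈ G.grade r s, motive a) (a : A) : motive a := by
  have ha : a ∈ ⨆ p : J × J, G.grade p.1 p.2 := by rw [G.iSup_eq_top]; trivial
  exact Submodule.iSup_induction _ (motive := motive) ha (fun p x hx => hom p.1 p.2 x hx) zero add

variable [IsScalarTower ℂ A A] [SMulCommClass ℂ A A]

/-- The multiplier `∑_{j ∈ P} 1(j)` of `A`, a strictly convergent sum of base units: on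
`a ∈ G r s` it acts by `1_P a = a` if `r ∈ P`, `1_P a = 0` otherwise, and `a 1_P = a` if `s ∈ P`,
`a 1_P = 0` otherwise. -/
def unit (P : Set J) : Multiplier A :=
  ⟨(G.proj {p | p.1 ∈ P}, MulOpposite.op (G.proj {p | p.2 ∈ P})), by
    intro x y
    change x * G.proj {p | p.1 ∈ P} y = G.proj {p | p.2 ∈ P} x * y
    classical
    induction x using G.induction with
    | zero => simp
    | add x₁ x₂ h₁ h₂ => simp only [add_mul, map_add, h₁, h₂]
    | hom r s x hx =>
      induction y using G.induction with
      | zero => simp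
      | add y₁ y₂ h₁ h₂ => simp only [mul_add, map_add, h₁, h₂]
      | hom r' s' y hy =>
        rw [G.proj_of_mem _ hx, G.proj_of_mem _ hy]
        by_cases h : s = r'
        · subst h
          simp only [Set.mem_ofPred_eq]
          split_ifs <;> simp
        · have h0 := G.mul_eq_zero h x hx y hy
          split_ifs <;> simp [h0]⟩

end PartialAlgebra

end Gradings

section TensorGrading

variable {J : Type w} {A : Type u} [NonUnitalRing A] [Module ℂ A]
variable {K : Type*} {B : Type v} [NonUnitalRing B] [Module ℂ B]

/-- The subspace `V ⊗ W` of `A ⊗ B`. -/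
def tensorSub (V : Submodule ℂ A) (W : Submodule ℂ B) : Submodule ℂ (A ⊗[ℂ] B) :=
  LinearMap.range (TensorProduct.mapIncl V W)

theorem tensorSub_induction {V : Submodule ℂ A} {W : Submodule ℂ B} {motive : A ⊗[ℂ] B → Prop}
    (zero : motive 0) (add : ∀ x y, motive x → motive y → motive (x + y))
    (tmul : ∀ a ∈ V, ∀ b ∈ W, motive (a ⊗ₜ b)) {x : A ⊗[ℂ] B} (hx : x ∈ tensorSub V W) :
    motive x := by
  obtain ⟨y, rfl⟩ := hx
  induction y using TensorProduct.induction_on with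
  | zero => simpa using zero
  | add y₁ y₂ h₁ h₂ => rw [map_add]; exact add _ _ h₁ h₂
  | tmul a b => simpa using tmul a a.2 b b.2

theorem tmul_mem_tensorSub {V : Submodule ℂ A} {W : Submodule ℂ B} {a : A} {b : B}
    (ha : a ∈ V) (hb : b ∈ W) : a ⊗ₜ[ℂ] b ∈ tensorSub V W :=
  ⟨⟨a, ha⟩ ⊗ₜ ⟨b, hb⟩, by simp⟩

variable [IsScalarTower ℂ A A] [SMulCommClass ℂ A A]
variable [IsScalarTower ℂ B B] [SMulCommClass ℂ B B]

/-- The full tensor product `A ⊗ B` of a `J`- and a `K`-partial algebra, as a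
`J × K`-partial algebra. -/
def PartialAlgebra.tensor (G : PartialAlgebra J A) (H : PartialAlgebra K B) :
    PartialAlgebra (J × K) (A ⊗[ℂ] B) where
  grade p q := tensorSub (G.grade p.1 q.1) (H.grade p.2 q.2)
  independent := by
    classical
    rw [iSupIndep_def]
    rintro ⟨⟨r, r'⟩, ⟨s, s'⟩⟩
    rw [Submodule.disjoint_def]
    intro x hx hx'
    let π := TensorProduct.map (G.proj {(r, s)}) (H.proj {(r', s')})
    have h1 : π x = x := by
      refine tensorSub_induction (motive := fun x => π x = x) (map_zero _)
        (fun x y hx hy => by rw [map_add, hx, hy]) (fun a ha b hb => ?_) hx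
      simp [π, G.proj_of_mem _ ha, H.proj_of_mem _ hb]
    have h2 : π x = 0 := by
      refine Submodule.iSup_induction _ (motive := fun x => π x = 0) hx' ?_ (map_zero _)
        (fun x y hx hy => by rw [map_add, hx, hy, add_zero])
      rintro ⟨⟨t, t'⟩, ⟨u, u'⟩⟩ y hy
      by_cases hne : ((t, t'), (u, u')) ≠ ((r, r'), (s, s'))
      · simp only [ne_eq, hne, not_false_eq_true, iSup_pos] at hy
        refine tensorSub_induction (motive := fun x => π x = 0) (map_zero _)
          (fun x y hx hy => by rw [map_add, hx, hy, add_zero]) (fun a ha b hb => ?_) hy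
        simp only [π, TensorProduct.map_tmul, G.proj_of_mem _ ha, H.proj_of_mem _ hb]
        simp only [Set.mem_singleton_iff]
        split_ifs with h₁ h₂
        · exfalso
          apply hne
          simp only [Prod.mk.injEq] at h₁ h₂ ⊢
          tauto
        all_goals simp
      · simp only [hne, iSup_neg, not_false_eq_true, Submodule.mem_bot] at hy
        rw [hy, map_zero]
    rw [← h1, h2]
  iSup_eq_top := by
    refine (Submodule.eq_top_iff'.2 fun x => ?_)
    induction x using TensorProduct.induction_on with
    | zero => exact Submodule.zero_mem _
    | add x y hx hy => exact Submodule.add_mem _ hx hy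
    | tmul a b =>
      induction a using G.induction with
      | zero => rw [TensorProduct.zero_tmul]; exact Submodule.zero_mem _
      | add x y hx hy => rw [TensorProduct.add_tmul]; exact Submodule.add_mem _ hx hy
      | hom r s a ha =>
        induction b using H.induction with
        | zero => rw [TensorProduct.tmul_zero]; exact Submodule.zero_mem _
        | add x y hx hy => rw [TensorProduct.tmul_add]; exact Submodule.add_mem _ hx hy
        | hom r' s' b hb =>
          exact Submodule.mem_iSup_of_mem ((r, r'), (s, s')) (tmul_mem_tensorSub ha hb)
  mul_eq_zero := by
    rintro ⟨r, r'⟩ ⟨s, s'⟩ ⟨t, t'⟩ ⟨u, u'⟩ hne x hx y hy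
    refine tensorSub_induction (motive := fun x => x * y = 0) (zero_mul _)
      (fun x₁ x₂ h₁ h₂ => by rw [add_mul, h₁, h₂, add_zero]) (fun a ha b hb => ?_) hx
    refine tensorSub_induction (motive := fun y => (a ⊗ₜ[ℂ] b) * y = 0) (mul_zero _)
      (fun y₁ y₂ h₁ h₂ => by rw [mul_add, h₁, h₂, add_zero]) (fun c hc d hd => ?_) hy
    rw [Algebra.TensorProduct.tmul_mul_tmul]
    by_cases h : s = t
    · have h' : s' ≠ t' := fun h' => hne (by rw [h, h'])
      rw [H.mul_eq_zero h' b hb d hd, TensorProduct.tmul_zero]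
    · rw [G.mul_eq_zero h a ha c hc, TensorProduct.zero_tmul]
  mul_mem := by
    rintro ⟨r, r'⟩ ⟨s, s'⟩ ⟨t, t'⟩ x hx y hy
    refine tensorSub_induction
      (motive := fun x => x * y ∈ tensorSub (G.grade r t) (H.grade r' t'))
      (by rw [zero_mul]; exact Submodule.zero_mem _)
      (fun x₁ x₂ h₁ h₂ => by rw [add_mul]; exact Submodule.add_mem _ h₁ h₂)
      (fun a ha b hb => ?_) hx
    refine tensorSub_induction
      (motive := fun y => (a ⊗ₜ[ℂ] b) * y ∈ tensorSub (G.grade r t) (H.grade r' t'))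
      (by rw [mul_zero]; exact Submodule.zero_mem _)
      (fun y₁ y₂ h₁ h₂ => by rw [mul_add]; exact Submodule.add_mem _ h₁ h₂)
      (fun c hc d hd => ?_) hy
    rw [Algebra.TensorProduct.tmul_mul_tmul]
    exact tmul_mem_tensorSub (G.mul_mem a ha c hc) (H.mul_mem b hb d hd)

end TensorGrading

/-! ### `I²`-partial algebras

An index `(r, t) : I × I` stands for the column with upper entry `r` and lower entry `t`. -/

namespace PartialAlgebra

variable {I : Type w} {A : Type u} [NonUnitalRing A] [Module ℂ A]
variable [IsScalarTower ℂ A A] [SMulCommClass ℂ A A]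
variable (G : PartialAlgebra (I × I) A)

/-- `1^r = ∑_t 1(r, t)`. -/
def unitUp (r : I) : Multiplier A := G.unit {j | j.1 = r}

/-- `1_t = ∑_r 1(r, t)`. -/
def unitLow (t : I) : Multiplier A := G.unit {j | j.2 = t}

/-- The subspace `^rA` (upper left index `r`). -/
def upLeft (r : I) : Submodule ℂ A := ⨆ (t : I) (k : I × I), G.grade (r, t) k

/-- The subspace `_tA` (lower left index `t`). -/
def lowLeft (t : I) : Submodule ℂ A := ⨆ (r : I) (k : I × I), G.grade (r, t) k

/-- The subspace `A^s` (upper right index `s`). -/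
def upRight (s : I) : Submodule ℂ A := ⨆ (j : I × I) (u : I), G.grade j (s, u)

/-- The subspace `A_u` (lower right index `u`). -/
def lowRight (u : I) : Submodule ℂ A := ⨆ (j : I × I) (s : I), G.grade j (s, u)

/-- The idempotent `E = ∑_t 1_t ⊗ 1^t` in `M(A ⊗ A)`, that is, the sum of all `1(r, t) ⊗ 1(t, v)`. -/
def E : Multiplier (A ⊗[ℂ] A) := (G.tensor G).unit {p | p.1.2 = p.2.1}

/-- The idempotent `∑_{s, t} 1_s ⊗ 1^s 1_t ⊗ 1^t` in `M(A ⊗ A ⊗ A)`. -/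
def E₃ : Multiplier ((A ⊗[ℂ] A) ⊗[ℂ] A) :=
  ((G.tensor G).tensor G).unit {p | p.1.1.2 = p.1.2.1 ∧ p.1.2.2 = p.2.1}

/-- The components of `A ⊗^I A`, as subspaces of `A ⊗ A`: the component with left index `(r, v)`
and right index `(s, w)` is `⊕_{t, u} A((r, t), (s, u)) ⊗ A((t, v), (u, w))`. -/
def tensorIGrade (j k : I × I) : Submodule ℂ (A ⊗[ℂ] A) :=
  ⨆ (t : I) (u : I), tensorSub (G.grade (j.1, t) (k.1, u)) (G.grade (t, j.2) (u, k.2))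

/-- The underlying space of `A ⊗^I A = E (A ⊗ A) E`. -/
def tensorI : Submodule ℂ (A ⊗[ℂ] A) := ⨆ (j : I × I) (k : I × I), G.tensorIGrade j k

end PartialAlgebra

/-! ### Regular comultiplications -/

section Comultiplication

variable {I : Type w} {A : Type u} [NonUnitalRing A] [Module ℂ A]
variable [IsScalarTower ℂ A A] [SMulCommClass ℂ A A]

/-- The space `W · f(V)`, spanned by all products `w f(a)`. -/
def mulImage {B : Type v} [NonUnitalRing B] [Module ℂ B] [IsScalarTower ℂ B B]
    [SMulCommClass ℂ B B] (W : Submodule ℂ B) (f : A →ₙₐ[ℂ] Multiplier B) (V : Submodule ℂ A) :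
    Submodule ℂ B :=
  Submodule.span ℂ {x | ∃ w ∈ W, ∃ a ∈ V, x = (f a).right w}

/-- The space `f(V) · W`, spanned by all products `f(a) w`. -/
def imageMul {B : Type v} [NonUnitalRing B] [Module ℂ B] [IsScalarTower ℂ B B]
    [SMulCommClass ℂ B B] (f : A →ₙₐ[ℂ] Multiplier B) (V : Submodule ℂ A) (W : Submodule ℂ B) :
    Submodule ℂ B :=
  Submodule.span ℂ {x | ∃ a ∈ V, ∃ w ∈ W, x = (f a).left w}

/-- `Δ ⊗ id : A ⊗ A → M(A ⊗ A) ⊗ M(A) → M((A ⊗ A) ⊗ A)`. -/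
def comulId (Δ : A →ₙₐ[ℂ] Multiplier (A ⊗[ℂ] A)) :
    A ⊗[ℂ] A →ₗ[ℂ] Multiplier ((A ⊗[ℂ] A) ⊗[ℂ] A) :=
  TensorProduct.lift ((Multiplier.tmul (A ⊗[ℂ] A) A).compl₁₂ (Δ : A →ₗ[ℂ] _) (Multiplier.incl A))

/-- `id ⊗ Δ : A ⊗ A → M(A) ⊗ M(A ⊗ A) → M(A ⊗ (A ⊗ A)) = M((A ⊗ A) ⊗ A)`. -/
def idComul (Δ : A →ₙₐ[ℂ] Multiplier (A ⊗[ℂ] A)) :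
    A ⊗[ℂ] A →ₗ[ℂ] Multiplier ((A ⊗[ℂ] A) ⊗[ℂ] A) :=
  Multiplier.assocSymm A ∘ₗ
    TensorProduct.lift ((Multiplier.tmul A (A ⊗[ℂ] A)).compl₁₂ (Multiplier.incl A) (Δ : A →ₗ[ℂ] _))

/-- For `F = Δ ⊗ id` or `F = id ⊗ Δ`, a morphism from `A ⊗^I A` to `A ⊗^I A ⊗^I A`, the statement
that the (unique) extension of `F` to `M(A ⊗^I A) = E M(A ⊗ A) E` maps `m` to the multiplier `n` in
`M(A ⊗^I A ⊗^I A) = E₃ M(A ⊗ A ⊗ A) E₃`. -/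
def ExtensionMapsTo (G : PartialAlgebra (I × I) A)
    (F : A ⊗[ℂ] A →ₗ[ℂ] Multiplier ((A ⊗[ℂ] A) ⊗[ℂ] A))
    (m : Multiplier (A ⊗[ℂ] A)) (n : Multiplier ((A ⊗[ℂ] A) ⊗[ℂ] A)) : Prop :=
  G.E₃ * n * G.E₃ = n ∧
    ∀ z ∈ G.tensorI, n * F z = F (m.left z) ∧ F z * n = F (m.right z)

/-- A (coassociative) regular comultiplication on the `I²`-partial algebra `A`. Multipliers of
`A ⊗^I A` are identified with the elements of the corner `E M(A ⊗ A) E`. -/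
structure IsRegularComultiplication (G : PartialAlgebra (I × I) A)
    (Δ : A →ₙₐ[ℂ] Multiplier (A ⊗[ℂ] A)) : Prop where
  /-- `Δ` takes values in `M(A ⊗^I A) = E M(A ⊗ A) E` -/
  corner : ∀ a, G.E * Δ a * G.E = Δ a
  /-- `Δ` is a morphism of `I²`-partial algebras from `A` to `A ⊗^I A` -/
  morphism_right : ∀ k : I × I,
    mulImage (colPart G.tensorIGrade k) Δ (colPart G.grade k) = colPart G.tensorIGrade k
  morphism_left : ∀ j : I × I,
    imageMul Δ (rowPart G.grade j) (rowPart G.tensorIGrade j) = rowPart G.tensorIGrade j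
  /-- `Δ(A)` consists of restricted multipliers -/
  restricted : ∀ a, IsRestricted (Δ a)
  /-- `(Δ ⊗ id)(Δ(a)) = (id ⊗ Δ)(Δ(a))` -/
  coassoc : ∀ a, ∃ n : Multiplier ((A ⊗[ℂ] A) ⊗[ℂ] A),
    ExtensionMapsTo G (comulId Δ) (Δ a) n ∧ ExtensionMapsTo G (idComul Δ) (Δ a) n

end Comultiplication

/-! ### Regular partial multiplier bialgebras and Hopf algebras -/

section Bialgebra

/-- A regular `I`-partial multiplier bialgebra `(A, Δ, ε)` with underlying algebra `A`. -/
structure RegularPartialMultiplierBialgebra (I : Type w) (A : Type u) [NonUnitalRing A]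
    [Module ℂ A] [IsScalarTower ℂ A A] [SMulCommClass ℂ A A] where
  /-- the `I²`-grading of `A` -/
  G : PartialAlgebra (I × I) A
  /-- the comultiplication -/
  Δ : A →ₙₐ[ℂ] Multiplier (A ⊗[ℂ] A)
  /-- the counit -/
  ε : A →ₗ[ℂ] ℂ
  nondegenerate : G.Nondegenerate
  idempotent : G.Idempotent
  comul : IsRegularComultiplication G Δ
  counit_eq_zero : ∀ r s t u : I, r ≠ t ∨ s ≠ u → ∀ a ∈ G.grade (r, t) (s, u), ε a = 0
  counit_ne_zero : ∀ r : I, (∃ a ∈ G.lowRight r, ε a ≠ 0) ∧ ∃ a ∈ G.lowLeft r, ε a ≠ 0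
  counit_mul : ∀ s t : I, ∀ a ∈ colPart G.grade (s, t), ∀ b ∈ rowPart G.grade (s, t),
    ε (a * b) = ε a * ε b
  counit_snd : ∀ a, IsSliceSnd ε (Δ a) (Multiplier.incl A a)
  counit_fst : ∀ a, IsSliceFst ε (Δ a) (Multiplier.incl A a)

namespace RegularPartialMultiplierBialgebra

variable {I : Type w} {A : Type u} [NonUnitalRing A] [Module ℂ A]
variable [IsScalarTower ℂ A A] [SMulCommClass ℂ A A]
variable (H : RegularPartialMultiplierBialgebra I A)

/-- `Δ^op`, the comultiplication followed by the flip. -/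
def comulOp : A →ₗ[ℂ] Multiplier (A ⊗[ℂ] A) := Multiplier.flip A ∘ₗ (H.Δ : A →ₗ[ℂ] _)

/-- The linear map `a ⊗ b ↦ D(a)(1 ⊗ b)`. -/
def mulSnd (D : A →ₗ[ℂ] Multiplier (A ⊗[ℂ] A)) : A ⊗[ℂ] A →ₗ[ℂ] Multiplier (A ⊗[ℂ] A) :=
  TensorProduct.lift ((LinearMap.mul ℂ (Multiplier (A ⊗[ℂ] A))).compl₁₂ D
    (Multiplier.tmul A A 1 ∘ₗ Multiplier.incl A))

/-- The linear map `a ⊗ b ↦ (a ⊗ 1)D(b)`. -/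
def fstMul (D : A →ₗ[ℂ] Multiplier (A ⊗[ℂ] A)) : A ⊗[ℂ] A →ₗ[ℂ] Multiplier (A ⊗[ℂ] A) :=
  TensorProduct.lift ((LinearMap.mul ℂ (Multiplier (A ⊗[ℂ] A))).compl₁₂
    ((Multiplier.tmul A A).flip 1 ∘ₗ Multiplier.incl A) D)

/-- `f` restricts to a bijection from `V` onto `W`, where `W ⊆ A ⊗ A` is viewed inside
`M(A ⊗ A)`. -/
def BijFromTo (f : A ⊗[ℂ] A →ₗ[ℂ] Multiplier (A ⊗[ℂ] A)) (V W : Submodule ℂ (A ⊗[ℂ] A)) : Prop :=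
  Set.BijOn f V (Multiplier.incl (A ⊗[ℂ] A) '' W)

/-- `(A, Δ)` is a regular `I`-partial multiplier Hopf algebra: the four canonical maps
`a ⊗ b ↦ Δ(a)(1 ⊗ b)`, `a ⊗ b ↦ (a ⊗ 1)Δ(b)`, `a ⊗ b ↦ Δ^op(a)(1 ⊗ b)`,
`a ⊗ b ↦ (a ⊗ 1)Δ^op(b)` are bijective between the indicated spaces. -/
structure IsRegularPartialMultiplierHopfAlgebra : Prop where
  can_r : BijFromTo (mulSnd (H.Δ : A →ₗ[ℂ] _))
    (⨆ r, tensorSub (H.G.lowRight r) (H.G.lowLeft r))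
    (⨆ r, tensorSub (H.G.lowLeft r) (H.G.upLeft r))
  can_l : BijFromTo (fstMul (H.Δ : A →ₗ[ℂ] _))
    (⨆ r, tensorSub (H.G.upRight r) (H.G.upLeft r))
    (⨆ r, tensorSub (H.G.lowRight r) (H.G.upRight r))
  can_r_c : BijFromTo (mulSnd H.comulOp)
    (⨆ r, tensorSub (H.G.upRight r) (H.G.upLeft r))
    (⨆ r, tensorSub (H.G.upLeft r) (H.G.lowLeft r))
  can_l_c : BijFromTo (fstMul H.comulOp)
    (⨆ r, tensorSub (H.G.lowRight r) (H.G.lowLeft r))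
    (⨆ r, tensorSub (H.G.upRight r) (H.G.lowRight r))

/-- `S` is a bijective anti-homomorphism with `S(1_r) = 1^r`, `S(1^r) = 1_r`,
`S(a₁) a₂ b = ε(a) 1_s b` for `a ∈ A_s` and `b a₁ S(a₂) = ε(a) b 1^r` for `a ∈ ^rA`. Here
`S(a₁) a₂ b` is the image of `z = Δ(a)(1 ⊗ b) ∈ A ⊗ A` under `x ⊗ y ↦ S(x) y`, and `b a₁ S(a₂)` is
the image of `z = (b ⊗ 1)Δ(a) ∈ A ⊗ A` under `x ⊗ y ↦ x S(y)`. -/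
structure IsAntipode (S : A →ₗ[ℂ] A) : Prop where
  bijective : Function.Bijective S
  map_mul : ∀ a b, S (a * b) = S b * S a
  map_unitLow : ∀ r, AntiExtends S (H.G.unitLow r) (H.G.unitUp r)
  map_unitUp : ∀ r, AntiExtends S (H.G.unitUp r) (H.G.unitLow r)
  left_antipode : ∀ s, ∀ a ∈ H.G.lowRight s, ∀ b : A, ∀ z : A ⊗[ℂ] A,
    Multiplier.incl _ z = H.Δ a * Multiplier.tmul A A 1 (Multiplier.incl A b) →
    LinearMap.mul' ℂ A (TensorProduct.map S LinearMap.id z) = H.ε a • (H.G.unitLow s).left b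
  right_antipode : ∀ r, ∀ a ∈ H.G.upLeft r, ∀ b : A, ∀ z : A ⊗[ℂ] A,
    Multiplier.incl _ z = Multiplier.tmul A A (Multiplier.incl A b) 1 * H.Δ a →
    LinearMap.mul' ℂ A (TensorProduct.map LinearMap.id S z) = H.ε a • (H.G.unitUp r).right b

/-- The anti-automorphism `x ⊗ y ↦ S(y) ⊗ S(x)` of `A ⊗ A`. -/
def flipTensor (S : A →ₗ[ℂ] A) : A ⊗[ℂ] A →ₗ[ℂ] A ⊗[ℂ] A :=
  TensorProduct.map S S ∘ₗ (TensorProduct.comm ℂ A A).toLinearMap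

/-- `S(a)₁ ⊗ S(a)₂ = S(a₂) ⊗ S(a₁)`: the extension to `M(A ⊗ A)` of `x ⊗ y ↦ S(y) ⊗ S(x)`
maps `Δ(a)` to `Δ(S(a))`, for all `a`. -/
def IsAntiComultiplicative (S : A →ₗ[ℂ] A) : Prop :=
  ∀ a, AntiExtends (flipTensor S) (H.Δ a) (H.Δ (S a))

end RegularPartialMultiplierBialgebra

end Bialgebra

end PartialHopf

end

/-! As for Hopf algebras, an antipode and inverses of the canonical maps determine each other. Write
`T1 (a ⊗ b) = Δ(a)(1 ⊗ b)`. Since `Δ(a) = EΔ(a)E`, the map `T1` factors through a projection `F1` of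
`A ⊗ A` and takes values in the range of a projection `E1`. Bijectivity between the prescribed
subspaces therefore means that there is a generalized inverse `Q` with `Q T1 = F1` and `T1 Q = E1`
(`bijFromTo_range_iff`). The other three canonical maps are, up to flips, the map `T1` of the
coopposite, of the opposite-coopposite, and of the composite of both, so each argument is needed for
`T1` only.

From an antipode one obtains `Q(a ⊗ b) = a₁ ⊗ S(a₂)b` (`IsAntipode.exists_isInv`). The inverse of
`S` is an antipode for the coopposite (`IsAntipode.cop`), and `S` itself is one for the
opposite-coopposite, so all four canonical maps are invertible.

Conversely, a generalized inverse `Q` gives left multiplication by the would-be `S(a)` as `S(a)b =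
(ε ⊗ id)Q(a ⊗ b)`. The inverse of `T2` gives right multiplication, and coassociativity shows that
the two form a multiplier (`antimul_compat`). The identity `S(p₁b)p₂q = S(b)S(p₁)p₂q` yields
anti-multiplicativity (`antimul_m`). It also shows that `S(q)` lies in `A`: up to a nonzero scalar,
`S(1^r q)` is `S(p₁q)p₂` for any `p` in `A_r` with `ε(p) ≠ 0` (`exists_antimul_eq`). The coopposite
maps produce in the same way a candidate for the inverse of `S`, which is a two-sided inverse by
`IsPreAntipode.leftInverse`.

Uniqueness holds because `S(a)b` is recovered from `Q`. For anti-comultiplicativity, `a ↦ Δ(S(a))`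
and `a ↦ S(a₂) ⊗ S(a₁)` are both convolution inverses of `Δ`, hence equal (`IsAntipode.flipS_DR`).
Invariance of `ε` follows by applying `ε` to `ba₁S(a₂)`.

All of this is carried out for maps on `A` and `A ⊗ A` only (`BialgebraData`). The remaining work
extracts these data from the multiplier formulation. Idempotence and the morphism axiom determine
how `Δ` interacts with the units `1^r`, `1_r`, and the extension form of coassociativity is reduced
to an identity in `A ⊗ A ⊗ A` (`RegularPartialMultiplierBialgebra.coassoc`). -/

noncomputable section

namespace PartialHopf

/-! ### Tensor products of linear maps -/

section TensorKit

local infix:70 " ⊠ " => TensorProduct.map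

variable {A B C D X : Type*} [AddCommGroup A] [Module ℂ A] [AddCommGroup B] [Module ℂ B]
  [AddCommGroup C] [Module ℂ C] [AddCommGroup D] [Module ℂ D] [AddCommGroup X] [Module ℂ X]

/-- The slice map `φ ⊗ id`. -/
def fstSlice (φ : A →ₗ[ℂ] ℂ) : A ⊗[ℂ] B →ₗ[ℂ] B :=
  (TensorProduct.lid ℂ B).toLinearMap ∘ₗ (φ ⊠ LinearMap.id)

/-- The slice map `id ⊗ φ`. -/
def sndSlice (φ : B →ₗ[ℂ] ℂ) : A ⊗[ℂ] B →ₗ[ℂ] A :=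
  (TensorProduct.rid ℂ A).toLinearMap ∘ₗ (LinearMap.id ⊠ φ)

@[simp] theorem fstSlice_tmul (φ : A →ₗ[ℂ] ℂ) (a : A) (b : B) :
    fstSlice φ (a ⊗ₜ b) = φ a • b := by simp [fstSlice]

@[simp] theorem sndSlice_tmul (φ : B →ₗ[ℂ] ℂ) (a : A) (b : B) :
    sndSlice φ (a ⊗ₜ b) = φ b • a := by simp [sndSlice]

theorem fstSlice_map (φ : C →ₗ[ℂ] ℂ) (f : A →ₗ[ℂ] C) (g : B →ₗ[ℂ] D) (z : A ⊗[ℂ] B) :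
    fstSlice φ ((f ⊠ g) z) = g (fstSlice (φ ∘ₗ f) z) := by
  induction z using TensorProduct.induction_on with
  | zero => simp
  | add x y hx hy => simp only [map_add, hx, hy]
  | tmul a b => simp

theorem sndSlice_map (φ : D →ₗ[ℂ] ℂ) (f : A →ₗ[ℂ] C) (g : B →ₗ[ℂ] D) (z : A ⊗[ℂ] B) :
    sndSlice φ ((f ⊠ g) z) = f (sndSlice (φ ∘ₗ g) z) := by
  induction z using TensorProduct.induction_on with
  | zero => simp
  | add x y hx hy => simp only [map_add, hx, hy]
  | tmul a b => simp

theorem fstSlice_comm (φ : B →ₗ[ℂ] ℂ) (z : A ⊗[ℂ] B) :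
    fstSlice φ (TensorProduct.comm ℂ A B z) = sndSlice φ z := by
  induction z using TensorProduct.induction_on with
  | zero => simp
  | add x y hx hy => simp only [map_add, hx, hy]
  | tmul a b => simp

theorem sndSlice_comm (φ : A →ₗ[ℂ] ℂ) (z : A ⊗[ℂ] B) :
    sndSlice φ (TensorProduct.comm ℂ A B z) = fstSlice φ z := by
  induction z using TensorProduct.induction_on with
  | zero => simp
  | add x y hx hy => simp only [map_add, hx, hy]
  | tmul a b => simp

theorem fstSlice_smul (c : ℂ) (φ : A →ₗ[ℂ] ℂ) (z : A ⊗[ℂ] B) :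
    fstSlice (c • φ) z = c • fstSlice φ z := by
  induction z using TensorProduct.induction_on with
  | zero => simp
  | add x y hx hy => simp only [map_add, hx, hy, smul_add]
  | tmul a b => simp [mul_smul]

theorem sndSlice_smul (c : ℂ) (φ : B →ₗ[ℂ] ℂ) (z : A ⊗[ℂ] B) :
    sndSlice (c • φ) z = c • sndSlice φ z := by
  induction z using TensorProduct.induction_on with
  | zero => simp
  | add x y hx hy => simp only [map_add, hx, hy, smul_add]
  | tmul a b => simp [mul_smul]

theorem map_id_smulRight (φ : B →ₗ[ℂ] ℂ) (f : A →ₗ[ℂ] C) (v : D) (z : A ⊗[ℂ] B) :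
    (f ⊠ φ.smulRight v) z = f (sndSlice φ z) ⊗ₜ v := by
  induction z using TensorProduct.induction_on with
  | zero => simp
  | add x y hx hy => simp only [map_add, hx, hy, TensorProduct.add_tmul]
  | tmul a b => simp [TensorProduct.smul_tmul]

theorem map_congr_apply {f f' : A →ₗ[ℂ] C} {g g' : B →ₗ[ℂ] D} (hf : ∀ x, f x = f' x)
    (hg : ∀ x, g x = g' x) (z : A ⊗[ℂ] B) : (f ⊠ g) z = (f' ⊠ g') z := by
  rw [LinearMap.ext hf, LinearMap.ext hg]

/-- A jointly injective family stays jointly injective after tensoring with `B`: expand the second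
leg in a basis of `B` and test each coefficient. This is how non-degeneracy of `A` is used on single
legs of a tensor. -/
theorem eq_zero_of_fst {ι : Type*} (f : ι → A →ₗ[ℂ] C) (hf : ∀ x, (∀ i, f i x = 0) → x = 0)
    (z : A ⊗[ℂ] B) (h : ∀ i, (f i ⊠ (LinearMap.id : B →ₗ[ℂ] B)) z = 0) : z = 0 := by
  classical
  let b := Module.Basis.ofVectorSpace ℂ B
  apply (TensorProduct.equivFinsuppOfBasisRight (M := A) b).injective
  rw [map_zero]
  ext j
  rw [TensorProduct.equivFinsuppOfBasisRight_apply]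
  apply hf
  intro i
  have h1 := congrArg (sndSlice (b.coord j)) (h i)
  rw [sndSlice_map, map_zero] at h1
  exact h1

theorem eq_of_fst {ι : Type*} (f : ι → A →ₗ[ℂ] C) (hf : ∀ x, (∀ i, f i x = 0) → x = 0)
    {z w : A ⊗[ℂ] B} (h : ∀ i, (f i ⊠ (LinearMap.id : B →ₗ[ℂ] B)) z = (f i ⊠ LinearMap.id) w) :
    z = w := by
  rw [← sub_eq_zero]
  apply eq_zero_of_fst f hf
  intro i
  rw [map_sub, h, sub_self]

theorem eq_of_snd {ι : Type*} (f : ι → B →ₗ[ℂ] C) (hf : ∀ x, (∀ i, f i x = 0) → x = 0)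
    {z w : A ⊗[ℂ] B} (h : ∀ i, ((LinearMap.id : A →ₗ[ℂ] A) ⊠ f i) z = (LinearMap.id ⊠ f i) w) :
    z = w := by
  apply (TensorProduct.comm ℂ A B).injective
  apply eq_of_fst f hf
  intro i
  rw [TensorProduct.map_comm, TensorProduct.map_comm, h]

/-- The map `T(p ⊗ ·)`. -/
def fixFst (T : A ⊗[ℂ] B →ₗ[ℂ] X) (p : A) : B →ₗ[ℂ] X := T ∘ₗ TensorProduct.mk ℂ A B p

/-- The map `T(· ⊗ c)`. -/
def fixSnd (T : A ⊗[ℂ] B →ₗ[ℂ] X) (c : B) : A →ₗ[ℂ] X := T ∘ₗ (TensorProduct.mk ℂ A B).flip c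

@[simp] theorem fixFst_apply (T : A ⊗[ℂ] B →ₗ[ℂ] X) (p : A) (b : B) :
    fixFst T p b = T (p ⊗ₜ b) := rfl

@[simp] theorem fixSnd_apply (T : A ⊗[ℂ] B →ₗ[ℂ] X) (a : A) (c : B) :
    fixSnd T c a = T (a ⊗ₜ c) := rfl

theorem assoc_map_map {A' B' C' : Type*} [AddCommGroup A'] [Module ℂ A'] [AddCommGroup B']
    [Module ℂ B'] [AddCommGroup C'] [Module ℂ C'] (f : A →ₗ[ℂ] A') (g : B →ₗ[ℂ] B')
    (h : C →ₗ[ℂ] C') (z : (A ⊗[ℂ] B) ⊗[ℂ] C) :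
    TensorProduct.assoc ℂ A' B' C' (((f ⊠ g) ⊠ h) z) =
      (f ⊠ (g ⊠ h)) (TensorProduct.assoc ℂ A B C z) := by
  have h1 : (TensorProduct.assoc ℂ A' B' C').toLinearMap ∘ₗ ((f ⊠ g) ⊠ h) =
      (f ⊠ (g ⊠ h)) ∘ₗ (TensorProduct.assoc ℂ A B C).toLinearMap := by
    apply TensorProduct.ext_threefold
    intro a b c
    simp
  exact LinearMap.congr_fun h1 z

/-- Coassociativity-type identities are invariant under reversal of the tensor factors. -/
theorem assoc_reverse {f g : A →ₗ[ℂ] A ⊗[ℂ] A} {z w : A ⊗[ℂ] A}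
    (h : TensorProduct.assoc ℂ A A A ((f ⊠ LinearMap.id) z) = (LinearMap.id ⊠ g) w) :
    TensorProduct.assoc ℂ A A A
        ((((TensorProduct.comm ℂ A A).toLinearMap ∘ₗ g) ⊠ LinearMap.id)
          (TensorProduct.comm ℂ A A w)) =
      (LinearMap.id ⊠ ((TensorProduct.comm ℂ A A).toLinearMap ∘ₗ f))
        (TensorProduct.comm ℂ A A z) := by
  -- `Rv` is the reversal `x ⊗ y ⊗ z ↦ z ⊗ y ⊗ x`. The two sides of the goal are the images under
  -- `Rv` of the two sides of `h`, in exchanged order.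
  let Rv : A ⊗[ℂ] (A ⊗[ℂ] A) →ₗ[ℂ] A ⊗[ℂ] (A ⊗[ℂ] A) :=
    (TensorProduct.assoc ℂ A A A).toLinearMap ∘ₗ
      ((TensorProduct.comm ℂ A A).toLinearMap ⊠ LinearMap.id) ∘ₗ
      (TensorProduct.comm ℂ A (A ⊗[ℂ] A)).toLinearMap
  have h1 : TensorProduct.assoc ℂ A A A
        ((((TensorProduct.comm ℂ A A).toLinearMap ∘ₗ g) ⊠ LinearMap.id)
          (TensorProduct.comm ℂ A A w)) = Rv ((LinearMap.id ⊠ g) w) := by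
    clear h
    induction w using TensorProduct.induction_on with
    | zero => simp
    | add x y hx hy => simp only [map_add, hx, hy]
    | tmul a b =>
      simp only [TensorProduct.comm_tmul, TensorProduct.map_tmul, LinearMap.id_apply,
        LinearMap.comp_apply, LinearEquiv.coe_coe]
      induction g b using TensorProduct.induction_on with
      | zero => simp
      | add x y hx hy => simp only [map_add, TensorProduct.tmul_add, TensorProduct.add_tmul, hx, hy]
      | tmul c d => simp [Rv]
  have h2 : (LinearMap.id ⊠ ((TensorProduct.comm ℂ A A).toLinearMap ∘ₗ f))
        (TensorProduct.comm ℂ A A z) =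
      Rv (TensorProduct.assoc ℂ A A A ((f ⊠ LinearMap.id) z)) := by
    clear h h1
    induction z using TensorProduct.induction_on with
    | zero => simp
    | add x y hx hy => simp only [map_add, hx, hy]
    | tmul a b =>
      simp only [TensorProduct.comm_tmul, TensorProduct.map_tmul, LinearMap.id_apply,
        LinearMap.comp_apply, LinearEquiv.coe_coe]
      induction f a using TensorProduct.induction_on with
      | zero => simp
      | add x y hx hy => simp only [map_add, TensorProduct.tmul_add, TensorProduct.add_tmul, hx, hy]
      | tmul c d => simp [Rv]
  rw [h1, h2, h]

end TensorKit

/-! ### Locally finite families of projections -/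

section Partitions

local infix:70 " ⊠ " => TensorProduct.map

variable {I A B X : Type*} [AddCommGroup A] [Module ℂ A] [AddCommGroup B] [Module ℂ B]
  [AddCommGroup X] [Module ℂ X]

/-- A family of mutually orthogonal projections whose ranges span `A`. -/
structure Partition (P : I → A →ₗ[ℂ] A) : Prop where
  idem : ∀ s a, P s (P s a) = P s a
  orth : ∀ s t, s ≠ t → ∀ a, P s (P t a) = 0
  span : ∀ p : A → Prop, p 0 → (∀ a b, p a → p b → p (a + b)) → (∀ s a, p (P s a)) → ∀ a, p a

namespace Partition

variable {P : I → A →ₗ[ℂ] A} (hP : Partition P) {Q : I → B →ₗ[ℂ] B}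
include hP

theorem ext_apply {f g : A →ₗ[ℂ] X} (h : ∀ s a, f (P s a) = g (P s a)) (a : A) : f a = g a :=
  hP.span (fun a => f a = g a) (by simp) (fun a b ha hb => by rw [map_add, map_add, ha, hb]) h a

theorem ext_fst {f g : A ⊗[ℂ] B →ₗ[ℂ] X} (h : ∀ s a b, f (P s a ⊗ₜ b) = g (P s a ⊗ₜ b))
    (z : A ⊗[ℂ] B) : f z = g z := by
  induction z using TensorProduct.induction_on with
  | zero => simp
  | add x y hx hy => simp only [map_add, hx, hy]
  | tmul a b =>
    exact hP.ext_apply (f := fixSnd f b) (g := fixSnd g b) (fun s a => h s a b) a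

theorem ext_snd {f g : B ⊗[ℂ] A →ₗ[ℂ] X} (h : ∀ s a b, f (b ⊗ₜ P s a) = g (b ⊗ₜ P s a))
    (z : B ⊗[ℂ] A) : f z = g z := by
  induction z using TensorProduct.induction_on with
  | zero => simp
  | add x y hx hy => simp only [map_add, hx, hy]
  | tmul b a =>
    exact hP.ext_apply (f := fixFst f b) (g := fixFst g b) (fun s a => h s a b) a

/-- Only finitely many `P s` are nonzero on a given vector. Without this the `finsum` in `diag`
could take its default value 0 and fail to be additive. -/
theorem finite_support (Q : I → B →ₗ[ℂ] X) (z : A ⊗[ℂ] B) :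
    {s | (P s ⊠ Q s) z ≠ 0}.Finite := by
  induction z using TensorProduct.induction_on with
  | zero => simp
  | add x y hx hy =>
    refine (hx.union hy).subset fun s hs => ?_
    by_contra h
    simp only [Set.mem_union, Set.mem_ofPred_eq, not_or, not_not] at h
    exact hs (by rw [map_add, h.1, h.2, add_zero])
  | tmul a b =>
    refine hP.span (fun a => {s | (P s ⊠ Q s) (a ⊗ₜ b) ≠ 0}.Finite) (by simp) ?_ ?_ a
    · intro x y hx hy
      refine (hx.union hy).subset fun s hs => ?_
      by_contra h
      simp only [Set.mem_union, Set.mem_ofPred_eq, not_or, not_not] at h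
      exact hs (by rw [TensorProduct.add_tmul, map_add, h.1, h.2, add_zero])
    · intro t a
      refine (Set.finite_singleton t).subset fun s hs => ?_
      by_contra h
      exact hs (by rw [TensorProduct.map_tmul, hP.orth s t h, TensorProduct.zero_tmul])

/-- The locally finite sum `∑ₛ P s ⊗ Q s`. -/
def diag (Q : I → B →ₗ[ℂ] B) : A ⊗[ℂ] B →ₗ[ℂ] A ⊗[ℂ] B where
  toFun z := ∑ᶠ s, (P s ⊠ Q s) z
  map_add' x y := by
    simp only [map_add]
    exact finsum_add_distrib (hP.finite_support Q x) (hP.finite_support Q y)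
  map_smul' c x := by
    simp only [map_smul, RingHom.id_apply]
    exact (smul_finsum' c (hP.finite_support Q x)).symm

theorem diag_tmul (s : I) (a : A) (b : B) : hP.diag Q (P s a ⊗ₜ b) = P s a ⊗ₜ Q s b := by
  change ∑ᶠ t, (P t ⊠ Q t) (P s a ⊗ₜ b) = _
  rw [finsum_eq_single _ s]
  · rw [TensorProduct.map_tmul, hP.idem]
  · intro t ht
    rw [TensorProduct.map_tmul, hP.orth t s ht, TensorProduct.zero_tmul]

/-- If both families are partitions, the surviving index can be read off from either leg. -/
theorem diag_tmul_snd (hQ : Partition Q) (s : I) (a : A) (b : B) :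
    hP.diag Q (a ⊗ₜ Q s b) = P s a ⊗ₜ Q s b := by
  refine hP.ext_apply (f := fixSnd (hP.diag Q) (Q s b))
    (g := (TensorProduct.mk ℂ A B).flip (Q s b) ∘ₗ P s) ?_ a
  intro t a
  simp only [fixSnd_apply, diag_tmul, LinearMap.comp_apply, LinearMap.flip_apply,
    TensorProduct.mk_apply]
  by_cases h : t = s
  · rw [h, hQ.idem, hP.idem]
  · rw [hQ.orth t s h, hP.orth s t (Ne.symm h), TensorProduct.zero_tmul, TensorProduct.tmul_zero]

theorem diag_map (s : I) (z : A ⊗[ℂ] B) :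
    hP.diag Q ((P s ⊠ LinearMap.id) z) = (P s ⊠ Q s) z := by
  induction z using TensorProduct.induction_on with
  | zero => simp
  | add x y hx hy => simp only [map_add, hx, hy]
  | tmul a b => simp [diag_tmul]

theorem diag_map_snd (hQ : Partition Q) (s : I) (z : A ⊗[ℂ] B) :
    hP.diag Q ((LinearMap.id ⊠ Q s) z) = (P s ⊠ Q s) z := by
  induction z using TensorProduct.induction_on with
  | zero => simp
  | add x y hx hy => simp only [map_add, hx, hy]
  | tmul a b => simp [diag_tmul_snd, hQ]

theorem diag_idem (hQ : Partition Q) (z : A ⊗[ℂ] B) : hP.diag Q (hP.diag Q z) = hP.diag Q z := by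
  refine hP.ext_fst (f := hP.diag Q ∘ₗ hP.diag Q) (g := hP.diag Q) (fun s a b => ?_) z
  simp only [LinearMap.comp_apply, diag_tmul, hQ.idem]

/-- `∑ₛ P s ⊗ Q s` commutes with `f ⊗ g` if `f` commutes with `P` and `g` commutes with `Q`. -/
theorem diag_comm_map {f : A →ₗ[ℂ] A} {g : B →ₗ[ℂ] B} (hf : ∀ s a, f (P s a) = P s (f a))
    (hg : ∀ s b, g (Q s b) = Q s (g b)) (z : A ⊗[ℂ] B) :
    (f ⊠ g) (hP.diag Q z) = hP.diag Q ((f ⊠ g) z) := by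
  refine hP.ext_fst (f := (f ⊠ g) ∘ₗ hP.diag Q) (g := hP.diag Q ∘ₗ (f ⊠ g)) (fun s a b => ?_) z
  simp only [LinearMap.comp_apply, diag_tmul, TensorProduct.map_tmul, hf, hg]

theorem comm_diag (hQ : Partition Q) (z : A ⊗[ℂ] B) :
    TensorProduct.comm ℂ A B (hP.diag Q z) = hQ.diag P (TensorProduct.comm ℂ A B z) := by
  refine hP.ext_fst (f := (TensorProduct.comm ℂ A B).toLinearMap ∘ₗ hP.diag Q)
    (g := hQ.diag P ∘ₗ (TensorProduct.comm ℂ A B).toLinearMap) (fun s a b => ?_) z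
  simp [diag_tmul, diag_tmul_snd, hP]

end Partition

end Partitions

/-! ### Elementwise data of a partial multiplier bialgebra -/

section Data

local infix:70 " ⊠ " => TensorProduct.map

/-- The product of `A ⊗ A` induced by a bilinear product `m` on `A`. -/
abbrev mulTensor {A : Type*} [AddCommGroup A] [Module ℂ A] (m : A →ₗ[ℂ] A →ₗ[ℂ] A) :
    A ⊗[ℂ] A →ₗ[ℂ] A ⊗[ℂ] A →ₗ[ℂ] A ⊗[ℂ] A := TensorProduct.map₂ m m

/-- The data of a regular partial multiplier bialgebra, expressed through linear maps on `A` and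
`A ⊗ A` only. The product is `m`, the maps `lu r`, `ll r` are left multiplication by `1^r`, `1_r`,
and `ru r`, `rl r` are right multiplication by `1^r`, `1_r`. Moreover `DL a z = Δ(a) z`,
`DR a z = z Δ(a)`, `T1 (a ⊗ b) = Δ(a)(1 ⊗ b)`, `T2 (a ⊗ b) = (a ⊗ 1)Δ(b)`, and `U1`, `U2` are the
analogues of `T1`, `T2` for `Δ^op`. -/
structure BialgebraData (I A : Type*) [AddCommGroup A] [Module ℂ A] where
  m : A →ₗ[ℂ] A →ₗ[ℂ] A
  lu : I → A →ₗ[ℂ] A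
  ll : I → A →ₗ[ℂ] A
  ru : I → A →ₗ[ℂ] A
  rl : I → A →ₗ[ℂ] A
  ε : A →ₗ[ℂ] ℂ
  DL : A →ₗ[ℂ] A ⊗[ℂ] A →ₗ[ℂ] A ⊗[ℂ] A
  DR : A →ₗ[ℂ] A ⊗[ℂ] A →ₗ[ℂ] A ⊗[ℂ] A
  T1 : A ⊗[ℂ] A →ₗ[ℂ] A ⊗[ℂ] A
  T2 : A ⊗[ℂ] A →ₗ[ℂ] A ⊗[ℂ] A
  U1 : A ⊗[ℂ] A →ₗ[ℂ] A ⊗[ℂ] A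
  U2 : A ⊗[ℂ] A →ₗ[ℂ] A ⊗[ℂ] A
  assoc : ∀ a b c, m (m a b) c = m a (m b c)
  nondegL : ∀ a, (∀ b, m a b = 0) → a = 0
  nondegR : ∀ a, (∀ b, m b a = 0) → a = 0
  lu_m : ∀ r a b, m (lu r a) b = lu r (m a b)
  ll_m : ∀ r a b, m (ll r a) b = ll r (m a b)
  m_ru : ∀ r a b, m a (ru r b) = ru r (m a b)
  m_rl : ∀ r a b, m a (rl r b) = rl r (m a b)
  ru_m : ∀ r a b, m (ru r a) b = m a (lu r b)
  rl_m : ∀ r a b, m (rl r a) b = m a (ll r b)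
  plu : Partition lu
  pll : Partition ll
  pru : Partition ru
  prl : Partition rl
  lu_ll : ∀ r s a, lu r (ll s a) = ll s (lu r a)
  ru_rl : ∀ r s a, ru r (rl s a) = rl s (ru r a)
  lu_ru : ∀ r s a, lu r (ru s a) = ru s (lu r a)
  lu_rl : ∀ r s a, lu r (rl s a) = rl s (lu r a)
  ll_ru : ∀ r s a, ll r (ru s a) = ru s (ll r a)
  ll_rl : ∀ r s a, ll r (rl s a) = rl s (ll r a)
  ε_lu : ∀ r a, ε (lu r a) = ε (ll r a)
  ε_ru : ∀ r a, ε (ru r a) = ε (rl r a)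
  -- The counit is multiplicative only across a matching unit. This form and the next one are all
  -- that remains of `ε(ab) = ε(a)ε(b)`.
  ε_m_ll : ∀ r a b, ε (m a (ll r b)) = ε (rl r a) * ε (ll r b)
  ε_m_lu : ∀ r a b, ε (m a (lu r b)) = ε (ru r a) * ε (lu r b)
  ε_rl_ne : ∀ r, ∃ a, ε (rl r a) ≠ 0
  ε_ll_ne : ∀ r, ∃ a, ε (ll r a) ≠ 0
  DR_DL : ∀ a z w, mulTensor m (DR a z) w = mulTensor m z (DL a w)
  DL_m : ∀ a b z, DL (m a b) z = DL a (DL b z)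
  -- Together with `E_DL`, this is the componentwise form of `Δ(a)E = Δ(a) = EΔ(a)`.
  DL_E : ∀ a r z, DL a ((ll r ⊠ LinearMap.id) z) = DL a ((LinearMap.id ⊠ lu r) z)
  E_DL : ∀ a r z, (ll r ⊠ LinearMap.id) (DL a z) = (LinearMap.id ⊠ lu r) (DL a z)
  DL_lu : ∀ r a z, DL (lu r a) z = (lu r ⊠ LinearMap.id) (DL a z)
  DL_ll : ∀ r a z, DL (ll r a) z = (LinearMap.id ⊠ ll r) (DL a z)
  DL_ru : ∀ r a z, DL (ru r a) z = DL a ((lu r ⊠ LinearMap.id) z)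
  DL_rl : ∀ r a z, DL (rl r a) z = DL a ((LinearMap.id ⊠ ll r) z)
  T1_spec : ∀ a b c, (m.flip c ⊠ LinearMap.id) (T1 (a ⊗ₜ b)) = DL a (c ⊗ₜ b)
  U1_spec : ∀ a b c, (m.flip c ⊠ LinearMap.id) (U1 (a ⊗ₜ b)) =
    TensorProduct.comm ℂ A A (DL a (b ⊗ₜ c))
  T2_spec : ∀ a b c, (LinearMap.id ⊠ m c) (T2 (b ⊗ₜ a)) = DR a (b ⊗ₜ c)
  U2_spec : ∀ a b c, (LinearMap.id ⊠ m c) (U2 (b ⊗ₜ a)) =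
    TensorProduct.comm ℂ A A (DR a (c ⊗ₜ b))
  ε_T1 : ∀ a b, fstSlice ε (T1 (a ⊗ₜ b)) = m a b
  ε_U1 : ∀ a b, fstSlice ε (U1 (a ⊗ₜ b)) = m a b
  ε_T2 : ∀ a b, sndSlice ε (T2 (a ⊗ₜ b)) = m a b
  ε_U2 : ∀ a b, sndSlice ε (U2 (a ⊗ₜ b)) = m a b
  -- Coassociativity multiplied by `p` on the left of the first leg and by `c` on the right of the
  -- third. Both sides then lie in `A ⊗ A ⊗ A`, so that no extension to multipliers is involved.
  coassoc : ∀ a p c,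
    TensorProduct.assoc ℂ A A A ((fixFst T2 p ⊠ LinearMap.id) (fixSnd T1 c a)) =
      (LinearMap.id ⊠ fixSnd T1 c) (fixFst T2 p a)

namespace BialgebraData

variable {I A : Type*} [AddCommGroup A] [Module ℂ A] (R : BialgebraData I A)

/-- Right multiplication. -/
abbrev rm (c : A) : A →ₗ[ℂ] A := R.m.flip c

theorem eq_of_rm_fst {B : Type*} [AddCommGroup B] [Module ℂ B] {z w : A ⊗[ℂ] B}
    (h : ∀ c, (R.rm c ⊠ (LinearMap.id : B →ₗ[ℂ] B)) z = (R.rm c ⊠ LinearMap.id) w) : z = w :=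
  eq_of_fst R.rm (fun x hx => R.nondegL x hx) h

theorem eq_of_lm_fst {B : Type*} [AddCommGroup B] [Module ℂ B] {z w : A ⊗[ℂ] B}
    (h : ∀ c, (R.m c ⊠ (LinearMap.id : B →ₗ[ℂ] B)) z = (R.m c ⊠ LinearMap.id) w) : z = w :=
  eq_of_fst (fun c => R.m c) (fun x hx => R.nondegR x hx) h

theorem eq_of_rm_snd {B : Type*} [AddCommGroup B] [Module ℂ B] {z w : B ⊗[ℂ] A}
    (h : ∀ c, ((LinearMap.id : B →ₗ[ℂ] B) ⊠ R.rm c) z = (LinearMap.id ⊠ R.rm c) w) : z = w :=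
  eq_of_snd R.rm (fun x hx => R.nondegL x hx) h

theorem eq_of_lm_snd {B : Type*} [AddCommGroup B] [Module ℂ B] {z w : B ⊗[ℂ] A}
    (h : ∀ c, ((LinearMap.id : B →ₗ[ℂ] B) ⊠ R.m c) z = (LinearMap.id ⊠ R.m c) w) : z = w :=
  eq_of_snd (fun c => R.m c) (fun x hx => R.nondegR x hx) h

theorem mulTensor_tmul (c d : A) (z : A ⊗[ℂ] A) :
    mulTensor R.m (c ⊗ₜ d) z = (R.m c ⊠ R.m d) z := rfl

theorem mulTensor_tmul_right (c d : A) (z : A ⊗[ℂ] A) :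
    mulTensor R.m z (c ⊗ₜ d) = (R.rm c ⊠ R.rm d) z := by
  induction z using TensorProduct.induction_on with
  | zero => simp
  | add x y hx hy => simp only [map_add, LinearMap.add_apply, hx, hy]
  | tmul a b => simp

theorem eq_of_mulTensor_left {z w : A ⊗[ℂ] A}
    (h : ∀ x, mulTensor R.m x z = mulTensor R.m x w) : z = w := by
  apply R.eq_of_lm_fst
  intro c
  apply R.eq_of_lm_snd
  intro d
  simpa [TensorProduct.map_map, mulTensor_tmul] using h (c ⊗ₜ d)

theorem eq_of_mulTensor_right {z w : A ⊗[ℂ] A}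
    (h : ∀ x, mulTensor R.m z x = mulTensor R.m w x) : z = w := by
  apply R.eq_of_rm_fst
  intro c
  apply R.eq_of_rm_snd
  intro d
  simpa [TensorProduct.map_map, mulTensor_tmul_right] using h (c ⊗ₜ d)

theorem mulTensor_adjoint {f f' g g' : A →ₗ[ℂ] A} (hf : ∀ a b, R.m (f a) b = R.m a (f' b))
    (hg : ∀ a b, R.m (g a) b = R.m a (g' b)) (z w : A ⊗[ℂ] A) :
    mulTensor R.m ((f ⊠ g) z) w = mulTensor R.m z ((f' ⊠ g') w) := by
  induction z using TensorProduct.induction_on with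
  | zero => simp
  | add x y hx hy => simp only [map_add, LinearMap.add_apply, hx, hy]
  | tmul a b =>
    rw [TensorProduct.map_tmul, mulTensor_tmul, mulTensor_tmul, TensorProduct.map_map]
    exact map_congr_apply (hf a) (hg b) w

theorem mulTensor_comm (z w : A ⊗[ℂ] A) :
    mulTensor R.m (TensorProduct.comm ℂ A A z) (TensorProduct.comm ℂ A A w) =
      TensorProduct.comm ℂ A A (mulTensor R.m z w) := by
  induction z using TensorProduct.induction_on with
  | zero => simp
  | add x y hx hy => simp only [map_add, LinearMap.add_apply, hx, hy]
  | tmul a b =>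
    rw [TensorProduct.comm_tmul, mulTensor_tmul, mulTensor_tmul, TensorProduct.map_comm]

theorem mulTensor_flip (z w : A ⊗[ℂ] A) :
    mulTensor R.m.flip z w = mulTensor R.m w z := by
  induction z using TensorProduct.induction_on with
  | zero => simp
  | add x y hx hy => simp only [map_add, LinearMap.add_apply, hx, hy]
  | tmul a b => rw [mulTensor_tmul_right]; rfl

theorem rm_lu (r : I) (c a : A) : R.rm c (R.lu r a) = R.lu r (R.rm c a) := R.lu_m r a c
theorem rm_ll (r : I) (c a : A) : R.rm c (R.ll r a) = R.ll r (R.rm c a) := R.ll_m r a c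

theorem adj_id (a b : A) :
    R.m (LinearMap.id (R := ℂ) a) b = R.m a (LinearMap.id (R := ℂ) b) := rfl

/-- `DR` and `DL` are adjoint for the non-degenerate product of `A ⊗ A` by `DR_DL`, so every rule
for `DL` has a mirror image for `DR`. The rules below are all obtained in this way. -/
theorem DR_m (a b : A) (z : A ⊗[ℂ] A) : R.DR (R.m a b) z = R.DR b (R.DR a z) := by
  apply R.eq_of_mulTensor_right
  intro x
  simp only [R.DR_DL, R.DL_m]

theorem DR_lu (r : I) (a : A) (z : A ⊗[ℂ] A) :
    R.DR (R.lu r a) z = R.DR a ((R.ru r ⊠ LinearMap.id) z) := by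
  apply R.eq_of_mulTensor_right
  intro x
  rw [R.DR_DL, R.DR_DL, R.DL_lu, R.mulTensor_adjoint (R.ru_m r) R.adj_id]

theorem DR_ll (r : I) (a : A) (z : A ⊗[ℂ] A) :
    R.DR (R.ll r a) z = R.DR a ((LinearMap.id ⊠ R.rl r) z) := by
  apply R.eq_of_mulTensor_right
  intro x
  rw [R.DR_DL, R.DR_DL, R.DL_ll, R.mulTensor_adjoint R.adj_id (R.rl_m r)]

theorem DR_ru (r : I) (a : A) (z : A ⊗[ℂ] A) :
    R.DR (R.ru r a) z = (R.ru r ⊠ LinearMap.id) (R.DR a z) := by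
  apply R.eq_of_mulTensor_right
  intro x
  rw [R.DR_DL, R.mulTensor_adjoint (R.ru_m r) R.adj_id, R.DR_DL, R.DL_ru]

theorem DR_rl (r : I) (a : A) (z : A ⊗[ℂ] A) :
    R.DR (R.rl r a) z = (LinearMap.id ⊠ R.rl r) (R.DR a z) := by
  apply R.eq_of_mulTensor_right
  intro x
  rw [R.DR_DL, R.mulTensor_adjoint R.adj_id (R.rl_m r), R.DR_DL, R.DL_rl]

theorem DR_E (a : A) (r : I) (z : A ⊗[ℂ] A) :
    R.DR a ((R.rl r ⊠ LinearMap.id) z) = R.DR a ((LinearMap.id ⊠ R.ru r) z) := by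
  apply R.eq_of_mulTensor_right
  intro x
  rw [R.DR_DL, R.DR_DL, R.mulTensor_adjoint R.adj_id (R.ru_m r),
    R.mulTensor_adjoint (R.rl_m r) R.adj_id, R.E_DL]

theorem E_DR (a : A) (r : I) (z : A ⊗[ℂ] A) :
    (R.rl r ⊠ LinearMap.id) (R.DR a z) = (LinearMap.id ⊠ R.ru r) (R.DR a z) := by
  apply R.eq_of_mulTensor_right
  intro x
  rw [R.mulTensor_adjoint R.adj_id (R.ru_m r),
    R.mulTensor_adjoint (R.rl_m r) R.adj_id, R.DR_DL, R.DR_DL, R.DL_E]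

theorem mulTensor_map {f g : A →ₗ[ℂ] A} (hf : ∀ a b, R.m a (f b) = f (R.m a b))
    (hg : ∀ a b, R.m a (g b) = g (R.m a b)) (z w : A ⊗[ℂ] A) :
    mulTensor R.m z ((f ⊠ g) w) = (f ⊠ g) (mulTensor R.m z w) := by
  induction z using TensorProduct.induction_on with
  | zero => simp
  | add x y hx hy => simp only [map_add, LinearMap.add_apply, hx, hy]
  | tmul a b =>
    rw [mulTensor_tmul, mulTensor_tmul, TensorProduct.map_map, TensorProduct.map_map]
    exact map_congr_apply (hf a) (hg b) w

/-- `Δ(a)` commutes with right module maps. -/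
theorem DL_map {f g : A →ₗ[ℂ] A} (hf : ∀ a b, R.m a (f b) = f (R.m a b))
    (hg : ∀ a b, R.m a (g b) = g (R.m a b)) (a : A) (z : A ⊗[ℂ] A) :
    R.DL a ((f ⊠ g) z) = (f ⊠ g) (R.DL a z) := by
  apply R.eq_of_mulTensor_left
  intro x
  rw [← R.DR_DL, R.mulTensor_map hf hg, R.mulTensor_map hf hg, R.DR_DL]

theorem m_rm (c a b : A) : R.m a (R.rm c b) = R.rm c (R.m a b) := (R.assoc a b c).symm

theorem DL_rm_fst (a c : A) (z : A ⊗[ℂ] A) :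
    R.DL a ((R.rm c ⊠ LinearMap.id) z) = (R.rm c ⊠ LinearMap.id) (R.DL a z) :=
  R.DL_map (R.m_rm c) (fun _ _ => rfl) a z

theorem DL_rm_snd (a d : A) (z : A ⊗[ℂ] A) :
    R.DL a ((LinearMap.id ⊠ R.rm d) z) = (LinearMap.id ⊠ R.rm d) (R.DL a z) :=
  R.DL_map (fun _ _ => rfl) (R.m_rm d) a z

end BialgebraData

end Data

/-! ### Symmetries of the data -/

section Symmetries

local infix:70 " ⊠ " => TensorProduct.map

/-! ### Maps acting on separate legs of a tensor product. -/

section MapLemmas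

variable {A B C D : Type*} [AddCommGroup A] [Module ℂ A] [AddCommGroup B] [Module ℂ B]
  [AddCommGroup C] [Module ℂ C] [AddCommGroup D] [Module ℂ D]

theorem map_fst_snd (f : A →ₗ[ℂ] C) (g : B →ₗ[ℂ] D) (z : A ⊗[ℂ] B) :
    (f ⊠ LinearMap.id) ((LinearMap.id ⊠ g) z) = (LinearMap.id ⊠ g) ((f ⊠ LinearMap.id) z) := by
  simp only [TensorProduct.map_map, LinearMap.comp_id, LinearMap.id_comp]

theorem map_fst_fst {f f' : A →ₗ[ℂ] A} (h : ∀ x, f (f' x) = f' (f x)) (z : A ⊗[ℂ] B) :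
    (f ⊠ LinearMap.id) ((f' ⊠ (LinearMap.id : B →ₗ[ℂ] B)) z) =
      (f' ⊠ LinearMap.id) ((f ⊠ LinearMap.id) z) := by
  simp only [TensorProduct.map_map]
  exact map_congr_apply h (fun _ => rfl) z

theorem map_snd_snd {f f' : B →ₗ[ℂ] B} (h : ∀ x, f (f' x) = f' (f x)) (z : A ⊗[ℂ] B) :
    (LinearMap.id ⊠ f) (((LinearMap.id : A →ₗ[ℂ] A) ⊠ f') z) =
      (LinearMap.id ⊠ f') ((LinearMap.id ⊠ f) z) := by
  simp only [TensorProduct.map_map]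
  exact map_congr_apply (fun _ => rfl) h z

theorem map_eq_fst_snd (f : A →ₗ[ℂ] C) (g : B →ₗ[ℂ] D) (z : A ⊗[ℂ] B) :
    (f ⊠ g) z = (f ⊠ LinearMap.id) ((LinearMap.id ⊠ g) z) := by
  simp only [TensorProduct.map_map, LinearMap.comp_id, LinearMap.id_comp]

theorem map_eq_snd_fst (f : A →ₗ[ℂ] C) (g : B →ₗ[ℂ] D) (z : A ⊗[ℂ] B) :
    (f ⊠ g) z = (LinearMap.id ⊠ g) ((f ⊠ LinearMap.id) z) := by
  simp only [TensorProduct.map_map, LinearMap.comp_id, LinearMap.id_comp]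

theorem map_third_assoc (f : A →ₗ[ℂ] B ⊗[ℂ] C) (g : D →ₗ[ℂ] D) (z : A ⊗[ℂ] D) :
    (LinearMap.id ⊠ (LinearMap.id ⊠ g))
        (TensorProduct.assoc ℂ B C D ((f ⊠ LinearMap.id) z)) =
      TensorProduct.assoc ℂ B C D ((f ⊠ LinearMap.id) ((LinearMap.id ⊠ g) z)) := by
  rw [← assoc_map_map, TensorProduct.map_id, map_fst_snd]

theorem map_second_assoc (f : A →ₗ[ℂ] B ⊗[ℂ] C) (g : C →ₗ[ℂ] C) (z : A ⊗[ℂ] D) :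
    (LinearMap.id ⊠ (g ⊠ LinearMap.id))
        (TensorProduct.assoc ℂ B C D ((f ⊠ LinearMap.id) z)) =
      TensorProduct.assoc ℂ B C D ((((LinearMap.id ⊠ g) ∘ₗ f) ⊠ LinearMap.id) z) := by
  rw [← assoc_map_map, TensorProduct.map_map, LinearMap.id_comp]

theorem map_first_assoc (f : A →ₗ[ℂ] B ⊗[ℂ] C) (g : B →ₗ[ℂ] B) (z : A ⊗[ℂ] D) :
    (g ⊠ LinearMap.id)
        (TensorProduct.assoc ℂ B C D ((f ⊠ LinearMap.id) z)) =
      TensorProduct.assoc ℂ B C D ((((g ⊠ LinearMap.id) ∘ₗ f) ⊠ LinearMap.id) z) := by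
  rw [← TensorProduct.map_id, ← assoc_map_map, TensorProduct.map_map, LinearMap.id_comp]

theorem map_comm' (f : B →ₗ[ℂ] C) (g : A →ₗ[ℂ] D) (z : A ⊗[ℂ] B) :
    (f ⊠ g) (TensorProduct.comm ℂ A B z) = TensorProduct.comm ℂ D C ((g ⊠ f) z) :=
  TensorProduct.map_comm f g z

theorem comm_comm' (z : A ⊗[ℂ] B) :
    TensorProduct.comm ℂ B A (TensorProduct.comm ℂ A B z) = z := by
  induction z using TensorProduct.induction_on with
  | zero => simp
  | add x y hx hy => simp only [map_add, hx, hy]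
  | tmul a b => simp

end MapLemmas

/-! ### Intertwining rules for the canonical maps, and the coopposite and opposite data. -/

namespace BialgebraData

variable {I A : Type*} [AddCommGroup A] [Module ℂ A] (R : BialgebraData I A)

theorem m_lm_rm (c d a : A) : R.m c (R.rm d a) = R.rm d (R.m c a) := (R.assoc c a d).symm

/-- By non-degeneracy, `T1` is determined by its products with `c ⊗ 1` from the right, and these are
values of `DL`. Rules for `DL` thus transfer to `T1`. The same scheme proves the following lemmas,
and the other canonical maps inherit the rules by symmetry. -/
theorem T1_lu (r : I) (z : A ⊗[ℂ] A) :
    R.T1 ((R.lu r ⊠ LinearMap.id) z) = (R.lu r ⊠ LinearMap.id) (R.T1 z) := by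
  induction z using TensorProduct.induction_on with
  | zero => simp
  | add x y hx hy => simp only [map_add, hx, hy]
  | tmul a b =>
    apply R.eq_of_rm_fst
    intro c
    rw [TensorProduct.map_tmul, LinearMap.id_apply, map_fst_fst (R.rm_lu r c), R.T1_spec,
      R.T1_spec, R.DL_lu]

theorem T1_ll (r : I) (z : A ⊗[ℂ] A) :
    R.T1 ((R.ll r ⊠ LinearMap.id) z) = (LinearMap.id ⊠ R.ll r) (R.T1 z) := by
  induction z using TensorProduct.induction_on with
  | zero => simp
  | add x y hx hy => simp only [map_add, hx, hy]
  | tmul a b =>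
    apply R.eq_of_rm_fst
    intro c
    rw [TensorProduct.map_tmul, LinearMap.id_apply, map_fst_snd, R.T1_spec, R.T1_spec, R.DL_ll]

theorem T1_ru (r : I) (z : A ⊗[ℂ] A) :
    R.T1 ((R.ru r ⊠ LinearMap.id) z) = (R.ru r ⊠ LinearMap.id) (R.T1 z) := by
  induction z using TensorProduct.induction_on with
  | zero => simp
  | add x y hx hy => simp only [map_add, hx, hy]
  | tmul a b =>
    apply R.eq_of_rm_fst
    intro c
    rw [TensorProduct.map_tmul, LinearMap.id_apply, R.T1_spec, R.DL_ru, TensorProduct.map_tmul,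
      ← R.T1_spec, TensorProduct.map_map]
    exact map_congr_apply (fun x => (R.ru_m r x c).symm) (fun _ => rfl) _

theorem T1_rl (r : I) (z : A ⊗[ℂ] A) :
    R.T1 ((R.rl r ⊠ LinearMap.id) z) = R.T1 ((LinearMap.id ⊠ R.ll r) z) := by
  induction z using TensorProduct.induction_on with
  | zero => simp
  | add x y hx hy => simp only [map_add, hx, hy]
  | tmul a b =>
    apply R.eq_of_rm_fst
    intro c
    rw [TensorProduct.map_tmul, TensorProduct.map_tmul, LinearMap.id_apply, LinearMap.id_apply,
      R.T1_spec, R.T1_spec, R.DL_rl, TensorProduct.map_tmul, LinearMap.id_apply]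

theorem T1_lu_snd (r : I) (z : A ⊗[ℂ] A) :
    R.T1 ((LinearMap.id ⊠ R.lu r) z) = (R.rl r ⊠ LinearMap.id) (R.T1 z) := by
  induction z using TensorProduct.induction_on with
  | zero => simp
  | add x y hx hy => simp only [map_add, hx, hy]
  | tmul a b =>
    apply R.eq_of_rm_fst
    intro c
    have h := R.DL_E a r (c ⊗ₜ b)
    rw [TensorProduct.map_tmul, TensorProduct.map_tmul, LinearMap.id_apply, LinearMap.id_apply] at h
    rw [TensorProduct.map_tmul, LinearMap.id_apply, R.T1_spec, ← h, ← R.T1_spec,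
      TensorProduct.map_map]
    exact map_congr_apply (fun x => (R.rl_m r x c).symm) (fun _ => rfl) _

theorem E_T1 (r : I) (z : A ⊗[ℂ] A) :
    (R.ll r ⊠ LinearMap.id) (R.T1 z) = (LinearMap.id ⊠ R.lu r) (R.T1 z) := by
  induction z using TensorProduct.induction_on with
  | zero => simp
  | add x y hx hy => simp only [map_add, hx, hy]
  | tmul a b =>
    apply R.eq_of_rm_fst
    intro c
    rw [map_fst_fst (R.rm_ll r c), map_fst_snd, R.T1_spec, R.E_DL]

theorem T1_rm_snd (d : A) (z : A ⊗[ℂ] A) :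
    R.T1 ((LinearMap.id ⊠ R.rm d) z) = (LinearMap.id ⊠ R.rm d) (R.T1 z) := by
  induction z using TensorProduct.induction_on with
  | zero => simp
  | add x y hx hy => simp only [map_add, hx, hy]
  | tmul a b =>
    apply R.eq_of_rm_fst
    intro c
    rw [map_fst_snd, R.T1_spec, ← R.DL_rm_snd, TensorProduct.map_tmul, R.T1_spec,
      TensorProduct.map_tmul, LinearMap.id_apply, LinearMap.id_apply]

theorem DL_T1 (p : A) (z : A ⊗[ℂ] A) :
    R.DL p (R.T1 z) = R.T1 ((R.m p ⊠ LinearMap.id) z) := by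
  induction z using TensorProduct.induction_on with
  | zero => simp
  | add x y hx hy => simp only [map_add, hx, hy]
  | tmul a b =>
    apply R.eq_of_rm_fst
    intro c
    rw [← R.DL_rm_fst, TensorProduct.map_tmul, LinearMap.id_apply, R.T1_spec, R.T1_spec, R.DL_m]

/-- Both sides are `(c ⊗ 1)Δ(a)(1 ⊗ b)`. -/
theorem T1_T2 (a b c : A) :
    (R.m c ⊠ LinearMap.id) (R.T1 (a ⊗ₜ b)) = (LinearMap.id ⊠ R.rm b) (R.T2 (c ⊗ₜ a)) := by
  apply R.eq_of_rm_fst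
  intro e
  apply R.eq_of_lm_snd
  intro d
  rw [map_fst_fst (fun x => (R.m_lm_rm c e x).symm), R.T1_spec, ← map_eq_snd_fst,
    ← mulTensor_tmul, ← R.DR_DL, mulTensor_tmul_right, map_fst_snd, map_snd_snd (R.m_lm_rm d b),
    ← map_fst_snd, R.T2_spec, ← map_fst_snd, ← map_eq_fst_snd]

/-- Both sides are `Δ(p)(d ⊗ q)`. The companions below evaluate `(p ⊗ c)Δ(a)`, `(1 ⊗ c)Δ(a)(1 ⊗ b)`
and `(p ⊗ 1)Δ(a)(q ⊗ 1)` in two ways, which allows multiplications on a leg to be switched from one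
side to the other. -/
theorem T1_U1 (d p q : A) : (R.rm d ⊠ LinearMap.id) (R.T1 (p ⊗ₜ q)) =
    TensorProduct.comm ℂ A A ((R.rm q ⊠ LinearMap.id) (R.U1 (p ⊗ₜ d))) := by
  rw [R.T1_spec, R.U1_spec, comm_comm']

theorem T2_U2 (p a c : A) : (LinearMap.id ⊠ R.m c) (R.T2 (p ⊗ₜ a)) =
    TensorProduct.comm ℂ A A ((LinearMap.id ⊠ R.m p) (R.U2 (c ⊗ₜ a))) := by
  rw [R.T2_spec, R.U2_spec, comm_comm']

theorem T1_U2 (a b c : A) : (LinearMap.id ⊠ R.m c) (R.T1 (a ⊗ₜ b)) =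
    (LinearMap.id ⊠ R.rm b) (TensorProduct.comm ℂ A A (R.U2 (c ⊗ₜ a))) := by
  apply R.eq_of_rm_fst
  intro e
  apply R.eq_of_lm_fst
  intro d
  have h : R.DR a (d ⊗ₜ c) =
      (R.m d ⊠ LinearMap.id) (TensorProduct.comm ℂ A A (R.U2 (c ⊗ₜ a))) := by
    rw [map_comm', R.U2_spec, comm_comm']
  rw [map_fst_snd, R.T1_spec, ← map_eq_fst_snd, ← mulTensor_tmul, ← R.DR_DL,
    mulTensor_tmul_right, h, map_fst_fst (R.m_lm_rm d e), map_fst_snd (R.m d) (R.rm b),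
    ← map_eq_fst_snd]

theorem T2_U1 (a p q : A) : (R.m p ⊠ LinearMap.id) (TensorProduct.comm ℂ A A (R.U1 (a ⊗ₜ q))) =
    (R.rm q ⊠ LinearMap.id) (R.T2 (p ⊗ₜ a)) := by
  apply R.eq_of_rm_snd
  intro e
  apply R.eq_of_lm_snd
  intro d
  rw [← map_fst_snd, map_comm', R.U1_spec, comm_comm', ← map_eq_snd_fst, ← mulTensor_tmul,
    ← R.DR_DL, mulTensor_tmul_right, ← map_fst_snd, ← map_fst_snd, map_snd_snd (R.m_lm_rm d e),
    R.T2_spec, ← map_eq_fst_snd]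

/-- `(p ⊗ 1 ⊗ 1)(Δ ⊗ id)((1 ⊗ c)Δ(a)) = (1 ⊗ 1 ⊗ c)(id ⊗ Δ)((p ⊗ 1)Δ(a))`. -/
theorem coassoc_left (a p c : A) :
    TensorProduct.assoc ℂ A A A
        ((fixFst R.T2 p ⊠ LinearMap.id) (TensorProduct.comm ℂ A A (R.U2 (c ⊗ₜ a)))) =
      (LinearMap.id ⊠ ((TensorProduct.comm ℂ A A).toLinearMap ∘ₗ fixFst R.U2 c))
        (fixFst R.T2 p a) := by
  refine eq_of_snd (fun d : A => (LinearMap.id ⊠ R.rm d : A ⊗[ℂ] A →ₗ[ℂ] A ⊗[ℂ] A)) ?_ ?_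
  · intro x hx
    exact R.eq_of_rm_snd (fun d => by rw [hx d, map_zero])
  · intro d
    -- After a right multiplication by `d` on the third leg, the left factor `c` there can be
    -- exchanged for the right factor `d` of `coassoc`.
    rw [map_third_assoc, ← R.T1_U2, ← map_third_assoc]
    have h := R.coassoc a p d
    rw [fixSnd_apply] at h
    rw [h, TensorProduct.map_map, TensorProduct.map_map]
    exact map_congr_apply (fun _ => rfl) (fun x => R.T1_U2 x d c) _

/-- Starting from `coassoc_left`, the left factor on the first leg is now also exchanged for a right
factor. This is coassociativity with both outer factors on the opposite sides. -/
theorem coassoc_flip (a q c : A) :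
    TensorProduct.assoc ℂ A A A
        ((((TensorProduct.comm ℂ A A).toLinearMap ∘ₗ fixSnd R.U1 q) ⊠ LinearMap.id)
          (TensorProduct.comm ℂ A A (R.U2 (c ⊗ₜ a)))) =
      (LinearMap.id ⊠ ((TensorProduct.comm ℂ A A).toLinearMap ∘ₗ fixFst R.U2 c))
        (TensorProduct.comm ℂ A A (R.U1 (a ⊗ₜ q))) := by
  apply R.eq_of_lm_fst
  intro p
  have h := R.coassoc_left a p c
  rw [fixFst_apply] at h
  rw [map_first_assoc, map_fst_snd, R.T2_U1, ← map_fst_snd, ← h, map_first_assoc]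
  congr 1
  exact map_congr_apply (fun x => R.T2_U1 x p q) (fun _ => rfl) _

/-- Reversing the three legs in `coassoc_flip` moves the right factor to the third leg and the left
factor to the first, as required for `Δ^op`. -/
theorem coassoc_op (a p c : A) :
    TensorProduct.assoc ℂ A A A ((fixFst R.U2 p ⊠ LinearMap.id) (fixSnd R.U1 c a)) =
      (LinearMap.id ⊠ fixSnd R.U1 c) (fixFst R.U2 p a) := by
  have h := assoc_reverse (R.coassoc_flip a c p)
  have h1 : (TensorProduct.comm ℂ A A).toLinearMap ∘ₗ
      (TensorProduct.comm ℂ A A).toLinearMap ∘ₗ fixFst R.U2 p = fixFst R.U2 p :=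
    LinearMap.ext fun x => comm_comm' _
  have h2 : (TensorProduct.comm ℂ A A).toLinearMap ∘ₗ
      (TensorProduct.comm ℂ A A).toLinearMap ∘ₗ fixSnd R.U1 c = fixSnd R.U1 c :=
    LinearMap.ext fun x => comm_comm' _
  rw [h1, h2, comm_comm', comm_comm'] at h
  exact h

theorem coassoc_opcop (a p c : A) :
    TensorProduct.assoc ℂ A A A
        ((((TensorProduct.comm ℂ A A).toLinearMap ∘ₗ fixSnd R.T1 p) ⊠ LinearMap.id)
          (TensorProduct.comm ℂ A A (R.T2 (c ⊗ₜ a)))) =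
      (LinearMap.id ⊠ ((TensorProduct.comm ℂ A A).toLinearMap ∘ₗ fixFst R.T2 c))
        (TensorProduct.comm ℂ A A (R.T1 (a ⊗ₜ p))) :=
  assoc_reverse (R.coassoc a c p)

/-- The flip of `A ⊗ A`. -/
abbrev flipMap (A : Type*) [AddCommGroup A] [Module ℂ A] : A ⊗[ℂ] A →ₗ[ℂ] A ⊗[ℂ] A :=
  (TensorProduct.comm ℂ A A).toLinearMap

/-- Conjugation of endomorphisms of `A ⊗ A` by the flip. -/
def flipConj (A : Type*) [AddCommGroup A] [Module ℂ A] :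
    (A ⊗[ℂ] A →ₗ[ℂ] A ⊗[ℂ] A) →ₗ[ℂ] (A ⊗[ℂ] A →ₗ[ℂ] A ⊗[ℂ] A) :=
  LinearMap.llcomp ℂ _ _ _ (flipMap A) ∘ₗ LinearMap.lcomp ℂ _ (flipMap A)

@[simp] theorem flipConj_apply (f : A ⊗[ℂ] A →ₗ[ℂ] A ⊗[ℂ] A) (z : A ⊗[ℂ] A) :
    flipConj A f z = TensorProduct.comm ℂ A A (f (TensorProduct.comm ℂ A A z)) := rfl

/-- The data of `(A, Δ^op)`. -/
def cop : BialgebraData I A where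
  m := R.m
  -- Flipping `Δ` exchanges the roles of upper and lower indices; left and right stay in place.
  lu := R.ll
  ll := R.lu
  ru := R.rl
  rl := R.ru
  ε := R.ε
  DL := flipConj A ∘ₗ R.DL
  DR := flipConj A ∘ₗ R.DR
  T1 := R.U1
  T2 := R.U2
  U1 := R.T1
  U2 := R.T2
  assoc := R.assoc
  nondegL := R.nondegL
  nondegR := R.nondegR
  lu_m := R.ll_m
  ll_m := R.lu_m
  m_ru := R.m_rl
  m_rl := R.m_ru
  ru_m := R.rl_m
  rl_m := R.ru_m
  plu := R.pll
  pll := R.plu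
  pru := R.prl
  prl := R.pru
  lu_ll r s a := (R.lu_ll s r a).symm
  ru_rl r s a := (R.ru_rl s r a).symm
  lu_ru := R.ll_rl
  lu_rl := R.ll_ru
  ll_ru := R.lu_rl
  ll_rl := R.lu_ru
  ε_lu r a := (R.ε_lu r a).symm
  ε_ru r a := (R.ε_ru r a).symm
  ε_m_ll := R.ε_m_lu
  ε_m_lu := R.ε_m_ll
  ε_rl_ne r := by simpa only [R.ε_ru] using R.ε_rl_ne r
  ε_ll_ne r := by simpa only [R.ε_lu] using R.ε_ll_ne r
  DR_DL a z w := by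
    obtain ⟨z, rfl⟩ := (TensorProduct.comm ℂ A A).surjective z
    obtain ⟨w, rfl⟩ := (TensorProduct.comm ℂ A A).surjective w
    simp only [LinearMap.comp_apply, flipConj_apply, comm_comm', mulTensor_comm, R.DR_DL]
  DL_m a b z := by simp only [LinearMap.comp_apply, flipConj_apply, comm_comm', R.DL_m]
  DL_E a r z := by
    simp only [LinearMap.comp_apply, flipConj_apply, ← map_comm', R.DL_E]
  E_DL a r z := by
    simp only [LinearMap.comp_apply, flipConj_apply, map_comm', R.E_DL]
  DL_lu r a z := by
    simp only [LinearMap.comp_apply, flipConj_apply, map_comm', R.DL_ll]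
  DL_ll r a z := by
    simp only [LinearMap.comp_apply, flipConj_apply, map_comm', R.DL_lu]
  DL_ru r a z := by
    simp only [LinearMap.comp_apply, flipConj_apply, ← map_comm', R.DL_rl]
  DL_rl r a z := by
    simp only [LinearMap.comp_apply, flipConj_apply, ← map_comm', R.DL_ru]
  T1_spec a b c := by simpa using R.U1_spec a b c
  U1_spec a b c := by simpa [comm_comm'] using R.T1_spec a b c
  T2_spec a b c := by simpa using R.U2_spec a b c
  U2_spec a b c := by simpa [comm_comm'] using R.T2_spec a b c
  ε_T1 := R.ε_U1
  ε_U1 := R.ε_T1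
  ε_T2 := R.ε_U2
  ε_U2 := R.ε_T2
  coassoc := R.coassoc_op

/-- The data of `(A^op, Δ^op)`. -/
def opcop : BialgebraData I A where
  m := R.m.flip
  -- Here left and right are exchanged by the opposite product, and upper and lower by the flip of
  -- `Δ`.
  lu := R.rl
  ll := R.ru
  ru := R.ll
  rl := R.lu
  ε := R.ε
  DL := flipConj A ∘ₗ R.DR
  DR := flipConj A ∘ₗ R.DL
  T1 := flipConj A R.T2
  T2 := flipConj A R.T1
  U1 := flipConj A R.U2
  U2 := flipConj A R.U1
  assoc a b c := (R.assoc c b a).symm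
  nondegL := R.nondegR
  nondegR := R.nondegL
  lu_m r a b := R.m_rl r b a
  ll_m r a b := R.m_ru r b a
  m_ru r a b := R.ll_m r b a
  m_rl r a b := R.lu_m r b a
  ru_m r a b := (R.rl_m r b a).symm
  rl_m r a b := (R.ru_m r b a).symm
  plu := R.prl
  pll := R.pru
  pru := R.pll
  prl := R.plu
  lu_ll r s a := (R.ru_rl s r a).symm
  ru_rl r s a := (R.lu_ll s r a).symm
  lu_ru r s a := (R.ll_rl s r a).symm
  lu_rl r s a := (R.lu_rl s r a).symm
  ll_ru r s a := (R.ll_ru s r a).symm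
  ll_rl r s a := (R.lu_ru s r a).symm
  ε_lu r a := (R.ε_ru r a).symm
  ε_ru r a := (R.ε_lu r a).symm
  ε_m_ll r a b := by
    rw [LinearMap.flip_apply, R.ru_m, R.ε_m_lu, mul_comm]
  ε_m_lu r a b := by
    rw [LinearMap.flip_apply, R.rl_m, R.ε_m_ll, mul_comm]
  ε_rl_ne r := by simpa only [R.ε_lu] using R.ε_ll_ne r
  ε_ll_ne r := by simpa only [R.ε_ru] using R.ε_rl_ne r
  DR_DL a z w := by
    obtain ⟨z, rfl⟩ := (TensorProduct.comm ℂ A A).surjective z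
    obtain ⟨w, rfl⟩ := (TensorProduct.comm ℂ A A).surjective w
    simp only [LinearMap.comp_apply, flipConj_apply, comm_comm', mulTensor_flip, mulTensor_comm,
      R.DR_DL]
  DL_m a b z := by
    simp only [LinearMap.comp_apply, flipConj_apply, comm_comm', LinearMap.flip_apply, R.DR_m]
  DL_E a r z := by
    simp only [LinearMap.comp_apply, flipConj_apply, ← map_comm', R.DR_E]
  E_DL a r z := by
    simp only [LinearMap.comp_apply, flipConj_apply, map_comm', R.E_DR]
  DL_lu r a z := by
    simp only [LinearMap.comp_apply, flipConj_apply, map_comm', R.DR_rl]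
  DL_ll r a z := by
    simp only [LinearMap.comp_apply, flipConj_apply, map_comm', R.DR_ru]
  DL_ru r a z := by
    simp only [LinearMap.comp_apply, flipConj_apply, ← map_comm', R.DR_ll]
  DL_rl r a z := by
    simp only [LinearMap.comp_apply, flipConj_apply, ← map_comm', R.DR_lu]
  T1_spec a b c := by
    simp only [LinearMap.flip_flip, LinearMap.comp_apply, flipConj_apply, map_comm',
      TensorProduct.comm_tmul, R.T2_spec]
  U1_spec a b c := by
    simp only [LinearMap.flip_flip, LinearMap.comp_apply, flipConj_apply, map_comm',
      TensorProduct.comm_tmul, R.U2_spec]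
  T2_spec a b c := by
    simp only [LinearMap.comp_apply, flipConj_apply, map_comm',
      TensorProduct.comm_tmul, R.T1_spec]
  U2_spec a b c := by
    simp only [LinearMap.comp_apply, flipConj_apply, map_comm',
      TensorProduct.comm_tmul, R.U1_spec]
  ε_T1 a b := by
    simp only [flipConj_apply, TensorProduct.comm_tmul, fstSlice_comm, R.ε_T2,
      LinearMap.flip_apply]
  ε_U1 a b := by
    simp only [flipConj_apply, TensorProduct.comm_tmul, fstSlice_comm, R.ε_U2,
      LinearMap.flip_apply]
  ε_T2 a b := by
    simp only [flipConj_apply, TensorProduct.comm_tmul, sndSlice_comm, R.ε_T1,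
      LinearMap.flip_apply]
  ε_U2 a b := by
    simp only [flipConj_apply, TensorProduct.comm_tmul, sndSlice_comm, R.ε_U1,
      LinearMap.flip_apply]
  coassoc := R.coassoc_opcop

end BialgebraData

end Symmetries

/-! ### Antipodes and generalized inverses of the canonical maps -/

section Antipode

local infix:70 " ⊠ " => TensorProduct.map

/-- The hypothesis allows each `P s ⊗ Q s` to be replaced by `P s ⊗ id`, and these sum to the
identity. -/
theorem Partition.diag_eq_self {I A B : Type*} [AddCommGroup A] [Module ℂ A] [AddCommGroup B]
    [Module ℂ B] {P : I → A →ₗ[ℂ] A} (hP : Partition P) {Q : I → B →ₗ[ℂ] B} {z : A ⊗[ℂ] B}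
    (h : ∀ s, (P s ⊠ LinearMap.id) z = (LinearMap.id ⊠ Q s) z) : hP.diag Q z = z := by
  have h1 : hP.diag Q z = hP.diag (fun _ => LinearMap.id) z := by
    refine finsum_congr fun s => ?_
    rw [map_eq_fst_snd, ← h, TensorProduct.map_map]
    exact map_congr_apply (hP.idem s) (fun _ => rfl) z
  rw [h1]
  refine hP.ext_fst (f := hP.diag fun _ => LinearMap.id) (g := LinearMap.id) (fun s a b => ?_) z
  rw [hP.diag_tmul]
  rfl

namespace BialgebraData

variable {I A : Type*} [AddCommGroup A] [Module ℂ A] (R : BialgebraData I A)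

/-- `∑ₜ 1_t · ⊗ 1^t ·`, the projection onto the range of `T1`. -/
def E1 : A ⊗[ℂ] A →ₗ[ℂ] A ⊗[ℂ] A := R.pll.diag R.lu

/-- `∑ₜ · 1_t ⊗ 1_t ·`, the projection onto the support of `T1`. -/
def F1 : A ⊗[ℂ] A →ₗ[ℂ] A ⊗[ℂ] A := R.prl.diag R.ll

/-- `∑ₜ · 1_t ⊗ · 1^t`, the projection onto the range of `T2`. -/
def E2 : A ⊗[ℂ] A →ₗ[ℂ] A ⊗[ℂ] A := R.prl.diag R.ru

/-- `∑ₜ · 1^t ⊗ 1^t ·`, the projection onto the support of `T2`. -/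
def F2 : A ⊗[ℂ] A →ₗ[ℂ] A ⊗[ℂ] A := R.pru.diag R.lu

theorem opcop_F1 (z : A ⊗[ℂ] A) :
    R.opcop.F1 (TensorProduct.comm ℂ A A z) = TensorProduct.comm ℂ A A (R.F2 z) :=
  (R.pru.comm_diag R.plu z).symm

theorem opcop_E1 (z : A ⊗[ℂ] A) :
    R.opcop.E1 (TensorProduct.comm ℂ A A z) = TensorProduct.comm ℂ A A (R.E2 z) :=
  (R.prl.comm_diag R.pru z).symm

/-- This rests on `Δ(a1_s)(1 ⊗ b) = Δ(a)(1 ⊗ 1_s b)`: a unit can be moved from the first argument to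
the second. -/
theorem T1_F1 (z : A ⊗[ℂ] A) : R.T1 (R.F1 z) = R.T1 z := by
  refine R.prl.ext_fst (f := R.T1 ∘ₗ R.F1) (g := R.T1) (fun s a b => ?_) z
  have h := R.T1_rl s (R.rl s a ⊗ₜ b)
  simp only [TensorProduct.map_tmul, LinearMap.id_apply, R.prl.idem] at h
  rw [LinearMap.comp_apply, F1, R.prl.diag_tmul, ← h]

theorem E1_T1 (z : A ⊗[ℂ] A) : R.E1 (R.T1 z) = R.T1 z :=
  R.pll.diag_eq_self fun s => R.E_T1 s z

theorem E1_idem (z : A ⊗[ℂ] A) : R.E1 (R.E1 z) = R.E1 z := R.pll.diag_idem R.plu z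

theorem F1_idem (z : A ⊗[ℂ] A) : R.F1 (R.F1 z) = R.F1 z := R.prl.diag_idem R.pll z

theorem E2_T2 (z : A ⊗[ℂ] A) : R.E2 (R.T2 z) = R.T2 z := by
  have h := R.opcop.E1_T1 (TensorProduct.comm ℂ A A z)
  change R.opcop.E1 (TensorProduct.comm ℂ A A (R.T2 (TensorProduct.comm ℂ A A
    (TensorProduct.comm ℂ A A z)))) = TensorProduct.comm ℂ A A (R.T2 (TensorProduct.comm ℂ A A
    (TensorProduct.comm ℂ A A z))) at h
  rw [comm_comm', opcop_E1] at h
  exact (TensorProduct.comm ℂ A A).injective h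

theorem E1_DL (a : A) (z : A ⊗[ℂ] A) : R.E1 (R.DL a z) = R.DL a z :=
  R.pll.diag_eq_self fun s => R.E_DL a s z

theorem DL_E1 (a : A) (z : A ⊗[ℂ] A) : R.DL a (R.E1 z) = R.DL a z := by
  refine R.pll.ext_fst (f := R.DL a ∘ₗ R.E1) (g := R.DL a) (fun s x y => ?_) z
  have h := R.DL_E a s (R.ll s x ⊗ₜ y)
  simp only [TensorProduct.map_tmul, LinearMap.id_apply, R.pll.idem] at h
  rw [LinearMap.comp_apply, E1, R.pll.diag_tmul, ← h]

theorem ε_ru_rl_ne {r s : I} (h : r ≠ s) (a : A) : R.ε (R.ru r (R.rl s a)) = 0 := by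
  rw [R.ε_ru, R.prl.orth r s h, map_zero]

theorem fstSlice_F1_rl (s : I) (a b : A) :
    fstSlice R.ε (R.F1 (R.rl s a ⊗ₜ b)) = R.ε (R.rl s a) • R.ll s b := by
  rw [F1, R.prl.diag_tmul, fstSlice_tmul]

/-- `F1` sorts by lower right indices, but `ε` vanishes unless upper and lower right indices agree,
so sorting by upper right indices gives the same slice. -/
theorem fstSlice_F1_ru (s : I) (a b : A) :
    fstSlice R.ε (R.F1 (R.ru s a ⊗ₜ b)) = R.ε (R.ru s a) • R.ll s b := by
  refine R.prl.ext_apply (f := fixSnd (fstSlice R.ε ∘ₗ R.F1) b ∘ₗ R.ru s)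
    (g := (R.ε ∘ₗ R.ru s).smulRight (R.ll s b)) (fun t a => ?_) a
  simp only [LinearMap.comp_apply, fixSnd_apply, LinearMap.smulRight_apply]
  rw [R.ru_rl, fstSlice_F1_rl]
  by_cases h : t = s
  · rw [h]
  · rw [← R.ru_rl, R.ε_ru_rl_ne (Ne.symm h), zero_smul, zero_smul]

/-- The map `a ⊗ b ↦ S(a) b`. -/
def lmu (S : A →ₗ[ℂ] A) : A ⊗[ℂ] A →ₗ[ℂ] A := TensorProduct.lift (R.m ∘ₗ S)

/-- The map `a ⊗ b ↦ a S(b)`. -/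
def rmu (S : A →ₗ[ℂ] A) : A ⊗[ℂ] A →ₗ[ℂ] A := TensorProduct.lift (R.m.compl₂ S)

@[simp] theorem lmu_tmul (S : A →ₗ[ℂ] A) (a b : A) : R.lmu S (a ⊗ₜ b) = R.m (S a) b := rfl

@[simp] theorem rmu_tmul (S : A →ₗ[ℂ] A) (a b : A) : R.rmu S (a ⊗ₜ b) = R.m a (S b) := rfl

theorem opcop_lmu (S : A →ₗ[ℂ] A) (z : A ⊗[ℂ] A) :
    R.opcop.lmu S (TensorProduct.comm ℂ A A z) = R.rmu S z := by
  induction z using TensorProduct.induction_on with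
  | zero => simp
  | add x y hx hy => simp only [map_add, hx, hy]
  | tmul a b => rfl

theorem opcop_rmu (S : A →ₗ[ℂ] A) (z : A ⊗[ℂ] A) :
    R.opcop.rmu S (TensorProduct.comm ℂ A A z) = R.lmu S z := by
  induction z using TensorProduct.induction_on with
  | zero => simp
  | add x y hx hy => simp only [map_add, hx, hy]
  | tmul a b => rfl

/-- Antipodes of the bialgebra data, without bijectivity. -/
structure IsPreAntipode (S : A →ₗ[ℂ] A) : Prop where
  map_m : ∀ a b, S (R.m a b) = R.m (S b) (S a)
  map_lu : ∀ r a, S (R.lu r a) = R.rl r (S a)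
  map_ll : ∀ r a, S (R.ll r a) = R.ru r (S a)
  map_ru : ∀ r a, S (R.ru r a) = R.ll r (S a)
  map_rl : ∀ r a, S (R.rl r a) = R.lu r (S a)
  left : ∀ z, R.lmu S (R.T1 z) = fstSlice R.ε (R.F1 z)
  right : ∀ z, R.rmu S (R.T2 z) = sndSlice R.ε (R.F2 z)

/-- Antipodes of the bialgebra data. -/
structure IsAntipode (S : A →ₗ[ℂ] A) : Prop extends R.IsPreAntipode S where
  bijective : Function.Bijective S

/-- `Q` is a generalized inverse of `T1`. -/
structure IsInv (Q : A ⊗[ℂ] A →ₗ[ℂ] A ⊗[ℂ] A) : Prop where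
  QT : ∀ z, Q (R.T1 z) = R.F1 z
  TQ : ∀ z, R.T1 (Q z) = R.E1 z
  FQ : ∀ z, R.F1 (Q z) = Q z
  QE : ∀ z, Q (R.E1 z) = Q z

variable {R}

/-- Compressing a one-sided choice by the two projections normalizes it; only the values on the
range of `T1` and modulo the kernel of `T1` matter. -/
theorem IsInv.of_weak {Q : A ⊗[ℂ] A →ₗ[ℂ] A ⊗[ℂ] A} (h1 : ∀ z, Q (R.T1 z) = R.F1 z)
    (h2 : ∀ z, R.T1 (Q z) = R.E1 z) : R.IsInv (R.F1 ∘ₗ Q ∘ₗ R.E1) where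
  QT z := by simp only [LinearMap.comp_apply, E1_T1, h1, F1_idem]
  TQ z := by simp only [LinearMap.comp_apply, T1_F1, h2, E1_idem]
  FQ z := by simp only [LinearMap.comp_apply, F1_idem]
  QE z := by simp only [LinearMap.comp_apply, E1_idem]

/-- Intertwiners of `T1` that respect the projections `F1` and `E1` are also intertwiners of `Q`.
All covariance properties of the antipode built from `Q` come from this. -/
theorem IsInv.comm_of {Q f g : A ⊗[ℂ] A →ₗ[ℂ] A ⊗[ℂ] A} (hQ : R.IsInv Q)
    (h : ∀ z, R.T1 (f z) = g (R.T1 z)) (hf : ∀ z, f (R.F1 z) = R.F1 (f z))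
    (hg : ∀ z, g (R.E1 z) = R.E1 (g z)) (z : A ⊗[ℂ] A) : Q (g z) = f (Q z) := by
  rw [← hQ.QE, ← hg, ← hQ.TQ, ← h, hQ.QT, ← hf, hQ.FQ]

/-- Because `S(1_s a)b = S(a)1^s b`, the map `a ⊗ b ↦ S(a)b` only sees the part of `a ⊗ b` in the
range of `E1`. -/
theorem IsPreAntipode.lmu_E1 {S : A →ₗ[ℂ] A} (hS : R.IsPreAntipode S) (z : A ⊗[ℂ] A) :
    R.lmu S (R.E1 z) = R.lmu S z := by
  refine R.pll.ext_fst (f := R.lmu S ∘ₗ R.E1) (g := R.lmu S) (fun s a b => ?_) z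
  rw [LinearMap.comp_apply, E1, R.pll.diag_tmul, lmu_tmul, lmu_tmul, ← R.ru_m, ← hS.map_ll,
    R.pll.idem]

theorem IsAntipode.opcop {S : A →ₗ[ℂ] A} (hS : R.IsAntipode S) : R.opcop.IsAntipode S where
  bijective := hS.bijective
  map_m a b := hS.map_m b a
  map_lu := hS.map_rl
  map_ll := hS.map_ru
  map_ru := hS.map_ll
  map_rl := hS.map_lu
  left z := by
    obtain ⟨z, rfl⟩ := (TensorProduct.comm ℂ A A).surjective z
    change R.opcop.lmu S (TensorProduct.comm ℂ A A (R.T2 (TensorProduct.comm ℂ A A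
      (TensorProduct.comm ℂ A A z)))) = _
    rw [comm_comm', opcop_lmu, hS.right, opcop_F1, ← fstSlice_comm]
    rfl
  right z := by
    obtain ⟨z, rfl⟩ := (TensorProduct.comm ℂ A A).surjective z
    change R.opcop.rmu S (TensorProduct.comm ℂ A A (R.T1 (TensorProduct.comm ℂ A A
      (TensorProduct.comm ℂ A A z)))) = sndSlice R.ε (R.pll.diag R.rl _)
    rw [comm_comm', opcop_rmu, hS.left, F1, ← R.prl.comm_diag R.pll, sndSlice_comm]

/-- The identity `S⁻¹(a₂) a₁ b = ε(a) 1^s b` for `a ∈ A^s`, up to applying `S`. -/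
theorem IsPreAntipode.lmu_U1 {S : A →ₗ[ℂ] A} (hS : R.IsPreAntipode S) (z : A ⊗[ℂ] A) :
    R.lmu S (TensorProduct.comm ℂ A A (R.U1 z)) = S (fstSlice R.ε (R.cop.F1 z)) := by
  refine R.pru.ext_fst (f := R.lmu S ∘ₗ flipMap A ∘ₗ R.U1)
    (g := S ∘ₗ fstSlice R.ε ∘ₗ R.cop.F1) (fun s a b => ?_) z
  have h1 : R.cop.F1 (R.ru s a ⊗ₜ b) = R.ru s a ⊗ₜ R.lu s b := R.pru.diag_tmul s a b
  simp only [LinearMap.comp_apply, h1, fstSlice_tmul, map_smul, hS.map_lu]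
  rw [← sub_eq_zero]
  apply R.nondegL
  intro d
  have h2 : ∀ z, R.m (R.lmu S z) d = R.lmu S ((LinearMap.id ⊠ R.rm d) z) := by
    intro z
    induction z using TensorProduct.induction_on with
    | zero => simp
    | add x y hx hy => simp only [map_add, LinearMap.add_apply, hx, hy]
    | tmul a b => simp [R.assoc]
  have h3 : ∀ z, R.lmu S ((R.rm b ⊠ LinearMap.id) z) = R.m (S b) (R.lmu S z) := by
    intro z
    induction z using TensorProduct.induction_on with
    | zero => simp
    | add x y hx hy => simp only [map_add, hx, hy]
    | tmul a b => simp [R.assoc, hS.map_m]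
  -- With a right factor `d` the left side becomes `S(a₁b)a₂d = S(b)S(a₁)a₂d`, where the left
  -- antipode identity applies.
  rw [map_sub, LinearMap.sub_apply, sub_eq_zero, h2, LinearEquiv.coe_coe, map_comm', ← R.T1_U1, h3,
    hS.left, fstSlice_F1_ru, map_smul, map_smul, LinearMap.smul_apply, R.rl_m]

theorem IsAntipode.cop_left {S T : A →ₗ[ℂ] A} (hS : R.IsAntipode S)
    (hT' : ∀ a, S (T a) = a) (z : A ⊗[ℂ] A) :
    R.cop.lmu T (R.cop.T1 z) = fstSlice R.ε (R.cop.F1 z) := by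
  have h : ∀ z, S (R.lmu T z) = R.lmu S (TensorProduct.comm ℂ A A z) := by
    intro z
    induction z using TensorProduct.induction_on with
    | zero => simp
    | add x y hx hy => simp only [map_add, hx, hy]
    | tmul a b => simp [hS.map_m, hT']
  apply hS.bijective.1
  rw [← hS.lmu_U1]
  exact h _

/-- The inverse `T` of `S` satisfies `T(a₂)a₁b = ε(a)1^s b` for `a` in `A^s`: applying `S` turns the
left side into `S(b)S(a₁)a₂`. Hence `T` is an antipode for the coopposite. -/
theorem IsAntipode.cop {S T : A →ₗ[ℂ] A} (hS : R.IsAntipode S) (hT : ∀ a, T (S a) = a)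
    (hT' : ∀ a, S (T a) = a) : R.cop.IsAntipode T where
  bijective := ⟨fun a b h => by rw [← hT' a, h, hT'], fun a => ⟨S a, hT a⟩⟩
  map_m a b := hS.bijective.1 (by
    change S (T (R.m a b)) = S (R.m (T b) (T a))
    rw [hS.map_m, hT', hT', hT'])
  map_lu r a := hS.bijective.1 (by
    change S (T (R.ll r a)) = S (R.ru r (T a))
    rw [hS.map_ru, hT', hT'])
  map_ll r a := hS.bijective.1 (by
    change S (T (R.lu r a)) = S (R.rl r (T a))
    rw [hS.map_rl, hT', hT'])
  map_ru r a := hS.bijective.1 (by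
    change S (T (R.rl r a)) = S (R.lu r (T a))
    rw [hS.map_lu, hT', hT'])
  map_rl r a := hS.bijective.1 (by
    change S (T (R.ru r a)) = S (R.ll r (T a))
    rw [hS.map_ll, hT', hT'])
  left := hS.cop_left hT'
  right z := by
    -- The right identity is the left identity for the opposite-coopposite, read through the flip.
    have h := hS.opcop.cop_left hT' (TensorProduct.comm ℂ A A z)
    have h1 : R.opcop.cop.F1 (TensorProduct.comm ℂ A A z) =
        TensorProduct.comm ℂ A A (R.cop.F2 z) := (R.prl.comm_diag R.pll z).symm
    rw [h1] at h
    change R.opcop.lmu T (TensorProduct.comm ℂ A A (R.U2 (TensorProduct.comm ℂ A A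
      (TensorProduct.comm ℂ A A z)))) = _ at h
    rw [comm_comm', opcop_lmu, fstSlice_comm] at h
    exact h

end BialgebraData

end Antipode

/-! ### Inverses of the canonical maps from an antipode -/

section AntipodeToInverse

local infix:70 " ⊠ " => TensorProduct.map

namespace BialgebraData

variable {I A : Type*} [AddCommGroup A] [Module ℂ A] {R : BialgebraData I A}

theorem T2_rl (s : I) (p a : A) :
    R.T2 (p ⊗ₜ R.rl s a) = (LinearMap.id ⊠ R.rl s) (R.T2 (p ⊗ₜ a)) := by
  apply (TensorProduct.comm ℂ A A).injective
  rw [← map_comm']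
  exact R.opcop.T1_lu s (a ⊗ₜ p)

theorem T2_rl_fst (t : I) (p a : A) :
    R.T2 (R.rl t p ⊗ₜ a) = (LinearMap.id ⊠ R.lu t) (R.T2 (p ⊗ₜ a)) := by
  apply (TensorProduct.comm ℂ A A).injective
  rw [← map_comm']
  exact R.opcop.T1_lu_snd t (a ⊗ₜ p)

/-- Apply `T2(p ⊗ ·)` to the first leg of `Δ(a 1_s)(1 ⊗ b)`, then `x ⊗ y ↦ S(x) y` to the last two
legs and a linear map `f` to the first one. -/
theorem IsAntipode.map_lmu_coassoc {S : A →ₗ[ℂ] A} (hS : R.IsAntipode S) {f : A →ₗ[ℂ] A}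
    (s : I) (p a b : A) :
    (f ⊠ R.lmu S) (TensorProduct.assoc ℂ A A A
        ((fixFst R.T2 p ⊠ LinearMap.id) (R.T1 (R.rl s a ⊗ₜ b)))) =
      f (R.m p (R.rl s a)) ⊗ₜ R.ll s b := by
  have h := R.coassoc (R.rl s a) p b
  rw [fixSnd_apply] at h
  rw [h, fixFst_apply, T2_rl, TensorProduct.map_map, TensorProduct.map_map, LinearMap.comp_id,
    LinearMap.comp_id]
  have h1 : ∀ x, ((R.lmu S ∘ₗ fixSnd R.T1 b) ∘ₗ R.rl s) x =
      ((R.ε ∘ₗ R.rl s).smulRight (R.ll s b)) x := by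
    intro x
    simp only [LinearMap.comp_apply, fixSnd_apply, hS.left, fstSlice_F1_rl,
      LinearMap.smulRight_apply]
  rw [map_congr_apply (f := f) (f' := f) (fun _ => rfl) h1, map_id_smulRight]
  have h2 := sndSlice_map R.ε LinearMap.id (R.rl s) (R.T2 (p ⊗ₜ a))
  rw [LinearMap.id_apply] at h2
  rw [← h2, ← T2_rl, R.ε_T2]

/-- The generalized inverse is `a ⊗ b ↦ a₁ ⊗ S(a₂)b`, compressed by `IsInv.of_weak`. As `Δ(a)` is
only a multiplier, `b` is written as `S(c)` and `S(a₂)S(c) = S(ca₂)` is used, which makes sense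
because `(1 ⊗ c)Δ(a)` lies in `A ⊗ A`. This is where surjectivity of `S` enters. -/
theorem IsAntipode.exists_isInv {S : A →ₗ[ℂ] A} (hS : R.IsAntipode S) : ∃ Q, R.IsInv Q := by
  let e := LinearEquiv.ofBijective S hS.bijective
  have he : ∀ a, e.symm (S a) = a := fun a => e.symm_apply_apply a
  let Q : A ⊗[ℂ] A →ₗ[ℂ] A ⊗[ℂ] A := (LinearMap.id ⊠ S) ∘ₗ flipMap A ∘ₗ R.U2 ∘ₗ flipMap A ∘ₗ
    (LinearMap.id ⊠ e.symm.toLinearMap)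
  have hQ : ∀ a c, Q (a ⊗ₜ S c) =
      (LinearMap.id ⊠ S) (TensorProduct.comm ℂ A A (R.U2 (c ⊗ₜ a))) := by
    intro a c
    simp [Q, he]
  have hQ' : ∀ p z, (R.m p ⊠ LinearMap.id) (Q z) = (LinearMap.id ⊠ R.lmu S)
      (TensorProduct.assoc ℂ A A A ((fixFst R.T2 p ⊠ LinearMap.id) z)) := by
    intro p z
    induction z using TensorProduct.induction_on with
    | zero => simp
    | add x y hx hy => simp only [map_add, hx, hy]
    | tmul a b =>
      obtain ⟨c, rfl⟩ := hS.bijective.2 b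
      rw [hQ, map_fst_snd, map_comm', ← R.T2_U2, TensorProduct.map_map, TensorProduct.map_tmul,
        fixFst_apply]
      induction R.T2 (p ⊗ₜ a) using TensorProduct.induction_on with
      | zero => simp
      | add x y hx hy => simp only [map_add, TensorProduct.add_tmul, hx, hy]
      | tmul x y => simp [hS.map_m]
  refine ⟨_, IsInv.of_weak (Q := Q) ?_ ?_⟩
  -- `Q T1 = F1`: the image of `Δ(a)(1 ⊗ b)` is `a₁ ⊗ S(a₂)a₃b`, which collapses by the left
  -- antipode identity.
  · intro z
    refine R.prl.ext_fst (f := Q ∘ₗ R.T1) (g := R.F1) (fun s a b => ?_) z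
    apply R.eq_of_lm_fst
    intro p
    rw [LinearMap.comp_apply, hQ', hS.map_lmu_coassoc, F1, R.prl.diag_tmul, TensorProduct.map_tmul]
    rfl
  · intro z
    induction z using TensorProduct.induction_on with
    | zero => simp
    | add x y hx hy => simp only [map_add, hx, hy]
    | tmul a b =>
    obtain ⟨c, rfl⟩ := hS.bijective.2 b
    apply R.eq_of_lm_fst
    -- `T1 Q = E1`: here `a₁ ⊗ a₂S(a₃)b` has to be collapsed by the right antipode identity. Left
    -- factors `p` and `d` on the two legs keep everything inside `A ⊗ A`.
    intro p
    apply R.eq_of_lm_snd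
    intro d
    rw [← map_eq_snd_fst, ← map_eq_snd_fst, hQ]
    -- the map `u ⊗ y ↦ d u S(y)`
    have h1 : ∀ p z, (R.m p ⊠ R.m d) (R.T1 ((LinearMap.id ⊠ S) z)) =
        (LinearMap.id ⊠ (R.m d ∘ₗ R.rmu S))
          (TensorProduct.assoc ℂ A A A ((fixFst R.T2 p ⊠ LinearMap.id) z)) := by
      intro p z
      induction z using TensorProduct.induction_on with
      | zero => simp
      | add x y hx hy => simp only [map_add, hx, hy]
      | tmul x y =>
        rw [TensorProduct.map_tmul, LinearMap.id_apply, map_eq_snd_fst, R.T1_T2,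
          TensorProduct.map_map, TensorProduct.map_tmul, fixFst_apply]
        induction R.T2 (p ⊗ₜ x) using TensorProduct.induction_on with
        | zero => simp
        | add x y hx hy => simp only [map_add, TensorProduct.add_tmul, hx, hy]
        | tmul x y => simp
    have h2 : ∀ x, ((R.m d ∘ₗ R.rmu S) ∘ₗ flipMap A ∘ₗ fixFst R.U2 c) x =
        R.m (sndSlice R.ε (R.F2 (d ⊗ₜ x))) (S c) := by
      intro x
      have h3 : ∀ z, R.m d (R.rmu S z) = R.rmu S ((R.m d ⊠ LinearMap.id) z) := by
        intro z
        induction z using TensorProduct.induction_on with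
        | zero => simp
        | add x y hx hy => simp only [map_add, hx, hy]
        | tmul a b => simp [R.assoc]
      have h4 : ∀ z, R.rmu S ((LinearMap.id ⊠ R.m c) z) = R.m (R.rmu S z) (S c) := by
        intro z
        induction z using TensorProduct.induction_on with
        | zero => simp
        | add x y hx hy => simp only [map_add, LinearMap.add_apply, hx, hy]
        | tmul a b => simp [R.assoc, hS.map_m]
      simp only [LinearMap.comp_apply, fixFst_apply, LinearEquiv.coe_coe]
      rw [h3, map_comm', ← R.T2_U2, h4, hS.right]
    have h5 : ∀ p, (R.m p ⊠ R.m d) (R.T1 ((LinearMap.id ⊠ S)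
          (TensorProduct.comm ℂ A A (R.U2 (c ⊗ₜ a))))) =
        (LinearMap.id ⊠ ((R.m d ∘ₗ R.rmu S) ∘ₗ flipMap A ∘ₗ fixFst R.U2 c)) (R.T2 (p ⊗ₜ a)) := by
      intro p
      rw [h1, R.coassoc_left, TensorProduct.map_map]
      rfl
    -- Replacing `p` by `p1_t` selects the single summand of `E1` with index `t`, so that only `1^t`
    -- on the second leg survives. On the other side, `p1_t a₁ ⊗ a₂ = pa₁ ⊗ 1^t a₂`, and both sides
    -- can be compared termwise.
    refine R.prl.ext_apply
      (f := (mulTensor R.m).flip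
        (R.T1 ((LinearMap.id ⊠ S) (TensorProduct.comm ℂ A A (R.U2 (c ⊗ₜ a))))) ∘ₗ
          (TensorProduct.mk ℂ A A).flip d)
      (g := (mulTensor R.m).flip (R.E1 (a ⊗ₜ S c)) ∘ₗ (TensorProduct.mk ℂ A A).flip d)
      (fun t p => ?_) p
    change (R.m (R.rl t p) ⊠ R.m d) _ = (R.m (R.rl t p) ⊠ R.m d) _
    have h6 : ∀ z, (R.m (R.rl t p) ⊠ R.m d) (R.E1 z) =
        (R.m (R.rl t p) ⊠ (R.m d ∘ₗ R.lu t)) z := by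
      intro z
      have h7 : (R.m (R.rl t p) ⊠ R.m d) (R.E1 z) = (R.m (R.rl t p) ⊠ R.m d)
          ((R.ll t ⊠ LinearMap.id) (R.E1 z)) := by
        rw [TensorProduct.map_map]
        refine map_congr_apply (fun x => ?_) (fun _ => rfl) _
        rw [LinearMap.comp_apply, ← R.rl_m, R.prl.idem]
      have h8 := R.pll.diag_comm_map (Q := R.lu) (f := R.ll t) (g := LinearMap.id) ?_
        (fun _ _ => rfl) z
      · rw [h7, E1, h8, R.pll.diag_map, TensorProduct.map_map]
        refine map_congr_apply (fun x => ?_) (fun _ => rfl) _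
        rw [LinearMap.comp_apply, ← R.rl_m, R.prl.idem]
      · intro s x
        by_cases h : t = s
        · rw [h]
        · rw [R.pll.orth t s h, R.pll.orth s t (Ne.symm h)]
    rw [h5, h6, T2_rl_fst, TensorProduct.map_map, LinearMap.comp_id]
    have h9 : ∀ x, (((R.m d ∘ₗ R.rmu S) ∘ₗ flipMap A ∘ₗ fixFst R.U2 c) ∘ₗ R.lu t) x =
        ((R.ε ∘ₗ R.lu t).smulRight (R.m d (R.lu t (S c)))) x := by
      intro x
      rw [LinearMap.comp_apply, h2, F2, R.pru.diag_tmul_snd R.plu, sndSlice_tmul, map_smul,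
        LinearMap.smul_apply, R.ru_m]
      rfl
    rw [map_congr_apply (fun _ => rfl) h9, map_id_smulRight]
    have h10 := sndSlice_map R.ε LinearMap.id (R.lu t) (R.T2 (p ⊗ₜ a))
    rw [← h10, ← T2_rl_fst, R.ε_T2]
    rfl

end BialgebraData

end AntipodeToInverse

/-! ### The antipode is anti-comultiplicative and preserves the counit -/

section AntipodeProperties

local infix:70 " ⊠ " => TensorProduct.map

namespace BialgebraData

variable {I A : Type*} [AddCommGroup A] [Module ℂ A] {R : BialgebraData I A}

theorem U2_ru (u : I) (c a : A) :
    R.U2 (R.ru u c ⊗ₜ a) = (LinearMap.id ⊠ R.ll u) (R.U2 (c ⊗ₜ a)) := by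
  apply (TensorProduct.comm ℂ A A).injective
  rw [← map_comm']
  exact R.opcop.cop.T1_lu_snd u (a ⊗ₜ c)

/-- After a left factor `c`, partial multiplicativity gives `ε(b1_u a₁)ca₂ = ε(b1_u)ε(1_u a₁)ca₂`.
Moving `1_u` across `Δ(a)` and applying the counit axiom gives `ε(b1_u)c1^u a`. -/
theorem fstSlice_T2_rl (u : I) (b a : A) :
    fstSlice R.ε (R.T2 (R.rl u b ⊗ₜ a)) = R.ε (R.rl u b) • R.lu u a := by
  rw [← sub_eq_zero]
  apply R.nondegR
  intro c
  have h1 := fstSlice_map R.ε LinearMap.id (R.m c) (R.T2 (R.rl u b ⊗ₜ a))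
  rw [LinearMap.comp_id] at h1
  have h2 : ∀ x, (R.ε ∘ₗ R.m (R.rl u b)) x = (R.ε (R.rl u b) • (R.ε ∘ₗ R.ll u)) x := by
    intro x
    simp only [LinearMap.comp_apply, LinearMap.smul_apply, smul_eq_mul]
    rw [R.rl_m, R.ε_m_ll]
  have h3 := sndSlice_map R.ε LinearMap.id (R.ll u) (R.U2 (c ⊗ₜ a))
  rw [map_sub, sub_eq_zero, ← h1, R.T2_U2, fstSlice_comm, sndSlice_map, LinearMap.ext h2,
    sndSlice_smul, map_smul, ← h3, ← U2_ru, R.ε_U2, map_smul, R.ru_m]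

theorem sndSlice_F2_rl (u : I) (b a : A) :
    R.ε (sndSlice R.ε (R.F2 (R.rl u b ⊗ₜ a))) = R.ε (R.rl u b) * R.ε (R.lu u a) := by
  refine R.plu.ext_apply (f := R.ε ∘ₗ fixFst (sndSlice R.ε ∘ₗ R.F2) (R.rl u b))
    (g := R.ε (R.rl u b) • (R.ε ∘ₗ R.lu u)) (fun t a => ?_) a
  simp only [LinearMap.comp_apply, fixFst_apply, LinearMap.smul_apply, F2,
    R.pru.diag_tmul_snd R.plu, sndSlice_tmul, map_smul, smul_eq_mul]
  by_cases h : t = u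
  · subst h
    rw [R.plu.idem, R.ε_ru, R.prl.idem, mul_comm]
  · rw [R.ε_ru_rl_ne h, R.plu.orth u t (Ne.symm h), map_zero, mul_zero, mul_zero]

/-- On the range of `E2`, partial multiplicativity of `ε` gives `ε(xS(y)) = ε(x)ε(S(y))`. Evaluating
on `(b1_u ⊗ 1)Δ(a)`, the right antipode identity produces `ε(b1_u)ε(1^u a)` on one side and the
counit axiom `ε(b1_u)ε(S(1^u a))` on the other; `b` is chosen with `ε(b1_u) ≠ 0`. -/
theorem IsAntipode.ε_map {S : A →ₗ[ℂ] A} (hS : R.IsAntipode S) (a : A) : R.ε (S a) = R.ε a := by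
  have h1 : ∀ z, R.ε (R.rmu S (R.E2 z)) = R.ε (S (fstSlice R.ε (R.E2 z))) := by
    refine R.prl.ext_fst (f := R.ε ∘ₗ R.rmu S ∘ₗ R.E2) (g := R.ε ∘ₗ S ∘ₗ fstSlice R.ε ∘ₗ R.E2) ?_
    intro s x y
    simp only [LinearMap.comp_apply, E2, R.prl.diag_tmul, rmu_tmul, fstSlice_tmul, map_smul,
      smul_eq_mul]
    rw [hS.map_ru, R.ε_m_ll, R.prl.idem]
  refine R.plu.ext_apply (f := R.ε ∘ₗ S) (g := R.ε) (fun u a => ?_) a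
  obtain ⟨b, hb⟩ := R.ε_rl_ne u
  have h2 := h1 (R.T2 (R.rl u b ⊗ₜ a))
  rw [E2_T2, hS.right, sndSlice_F2_rl, fstSlice_T2_rl, map_smul, map_smul, smul_eq_mul] at h2
  exact (mul_left_cancel₀ hb h2).symm

/-- The anti-automorphism `x ⊗ y ↦ S(y) ⊗ S(x)`. -/
def flipS (S : A →ₗ[ℂ] A) : A ⊗[ℂ] A →ₗ[ℂ] A ⊗[ℂ] A := (S ⊠ S) ∘ₗ flipMap A

@[simp] theorem flipS_tmul (S : A →ₗ[ℂ] A) (a b : A) : flipS S (a ⊗ₜ b) = S b ⊗ₜ S a := by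
  simp [flipS]

/-- The map `c ⊗ y ↦ T1(x₁ ⊗ c) ⊗ x₂`, where `x₁ ⊗ x₂ = T1(p ⊗ y)`. -/
def T1T1 (R : BialgebraData I A) (p : A) : A ⊗[ℂ] A →ₗ[ℂ] A ⊗[ℂ] (A ⊗[ℂ] A) :=
  (TensorProduct.assoc ℂ A A A).toLinearMap ∘ₗ (R.T1 ⊠ LinearMap.id) ∘ₗ
    (flipMap A ⊠ LinearMap.id) ∘ₗ (TensorProduct.assoc ℂ A A A).symm.toLinearMap ∘ₗ
    (LinearMap.id ⊠ fixFst R.T1 p)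

theorem T1T1_tmul (p c d : A) : R.T1T1 p (c ⊗ₜ d) =
    TensorProduct.assoc ℂ A A A ((fixSnd R.T1 c ⊠ LinearMap.id) (R.T1 (p ⊗ₜ d))) := by
  simp only [T1T1, LinearMap.comp_apply, TensorProduct.map_tmul, LinearMap.id_apply,
    fixFst_apply, LinearEquiv.coe_coe]
  congr 1
  induction R.T1 (p ⊗ₜ d) using TensorProduct.induction_on with
  | zero => simp
  | add x y hx hy => simp only [map_add, TensorProduct.tmul_add, hx, hy]
  | tmul x y => simp

/-- Both sides are `p₁ ⊗ Δ(p₂)Δ(q)w`; on the left, `Δ` has been applied to the second leg of `Δ(p)(1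
⊗ q)`. A left factor on the first leg reduces the identity to coassociativity. -/
theorem map_DL_T1 (p q : A) (w : A ⊗[ℂ] A) :
    (LinearMap.id ⊠ R.DL.flip w) (R.T1 (p ⊗ₜ q)) = R.T1T1 p (R.DL q w) := by
  apply R.eq_of_lm_fst
  intro e
  have h1 : (R.m e ⊠ LinearMap.id) ((LinearMap.id ⊠ R.DL.flip w) (R.T1 (p ⊗ₜ q))) =
      (LinearMap.id ⊠ R.DL.flip (R.DL q w)) (R.T2 (e ⊗ₜ p)) := by
    rw [map_fst_snd, R.T1_T2, TensorProduct.map_map]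
    exact map_congr_apply (fun _ => rfl) (fun x => R.DL_m x q w) _
  rw [h1]
  generalize R.DL q w = w'
  induction w' using TensorProduct.induction_on with
  | zero => simp [TensorProduct.map_zero_right]
  | add x y hx hy => simp only [map_add, TensorProduct.map_add_right, LinearMap.add_apply, hx, hy]
  | tmul c d =>
    have h2 : (LinearMap.id ⊠ R.DL.flip (c ⊗ₜ d)) (R.T2 (e ⊗ₜ p)) =
        (LinearMap.id ⊠ (R.rm c ⊠ LinearMap.id)) ((LinearMap.id ⊠ fixSnd R.T1 d)
          (R.T2 (e ⊗ₜ p))) := by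
      rw [TensorProduct.map_map]
      exact map_congr_apply (fun _ => rfl) (fun x => (R.T1_spec x d c).symm) _
    have h3 := R.coassoc p e d
    rw [fixSnd_apply, fixFst_apply] at h3
    rw [h2, ← h3, map_second_assoc, T1T1_tmul, map_first_assoc]
    congr 1
    exact map_congr_apply (fun x => (R.T1_T2 x c e).symm) (fun _ => rfl) _

/-- The convolution argument: with `X(a) = S(a₂) ⊗ S(a₁)`, the products `X(p₁)Δ(p₂)` and
`Δ(S(p₁))Δ(p₂)` agree. Since the elements `Δ(p)(1 ⊗ q)` fill the range of `E1`, the factor `Δ(p₂)`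
can be cancelled, and `X(a) = Δ(S(a))`. -/
theorem IsAntipode.flipS_DR {S : A →ₗ[ℂ] A} (hS : R.IsAntipode S) (a : A) (z : A ⊗[ℂ] A) :
    flipS S (R.DR a z) = R.DL (S a) (flipS S z) := by
  obtain ⟨Q, hQ⟩ := hS.exists_isInv
  let e := LinearEquiv.ofBijective S hS.bijective
  have he : ∀ a, e.symm (S a) = a := fun a => e.symm_apply_apply a
  have he' : ∀ a, S (e.symm a) = a := fun a => e.apply_symm_apply a
  -- `X a w` is the value at `w` of the image of `Δ(a)` under the extension of `flipS S`
  let X : A →ₗ[ℂ] A ⊗[ℂ] A →ₗ[ℂ] A ⊗[ℂ] A :=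
    (LinearMap.llcomp ℂ _ _ _ (flipS S) ∘ₗ LinearMap.lcomp ℂ _ (flipS e.symm.toLinearMap)) ∘ₗ R.DR
  have hX : ∀ a z, X a (flipS S z) = flipS S (R.DR a z) := by
    intro a z
    change flipS S (R.DR a (flipS e.symm.toLinearMap (flipS S z))) = _
    congr 2
    induction z using TensorProduct.induction_on with
    | zero => simp
    | add x y hx hy => simp only [map_add, hx, hy]
    | tmul x y => simp [he]
  have hX1 : ∀ a u y, X a (u ⊗ₜ S y) =
      TensorProduct.comm ℂ A A ((S ⊠ (R.rm u ∘ₗ S)) (R.T2 (y ⊗ₜ a))) := by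
    intro a u y
    obtain ⟨x, rfl⟩ := hS.bijective.2 u
    rw [← flipS_tmul, hX, ← R.T2_spec, flipS, LinearMap.comp_apply, LinearEquiv.coe_coe, map_comm',
      TensorProduct.map_map]
    congr 1
    exact map_congr_apply (fun _ => rfl) (fun b => hS.map_m x b) _
  let Ξ : A ⊗[ℂ] (A ⊗[ℂ] A) →ₗ[ℂ] A ⊗[ℂ] A := TensorProduct.lift X
  -- `X(p₁)(p₂c ⊗ v) = S(p₂)p₃c ⊗ S(p₁)v`, where the inner antipode identity collapses the first
  -- leg.
  have hΞ : ∀ s p c v, Ξ (TensorProduct.assoc ℂ A A A (R.T1 (R.rl s p ⊗ₜ c) ⊗ₜ v)) =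
      R.ll s c ⊗ₜ R.m (S (R.rl s p)) v := by
    intro s p c v
    obtain ⟨y, rfl⟩ := hS.bijective.2 v
    have h1 : ∀ w, Ξ (TensorProduct.assoc ℂ A A A (w ⊗ₜ S y)) = TensorProduct.comm ℂ A A
        ((S ⊠ R.lmu S) (TensorProduct.assoc ℂ A A A ((fixFst R.T2 y ⊠ LinearMap.id) w))) := by
      intro w
      induction w using TensorProduct.induction_on with
      | zero => simp
      | add x y hx hy => simp only [map_add, TensorProduct.add_tmul, hx, hy]
      | tmul a u =>
        rw [TensorProduct.assoc_tmul]
        change X a (u ⊗ₜ S y) = _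
        rw [hX1, TensorProduct.map_tmul, fixFst_apply, LinearMap.id_apply]
        congr 1
        induction R.T2 (y ⊗ₜ a) using TensorProduct.induction_on with
        | zero => simp
        | add x y hx hy => simp only [map_add, TensorProduct.add_tmul, hx, hy]
        | tmul x y => simp
    rw [h1, hS.map_lmu_coassoc, TensorProduct.comm_tmul, hS.map_m]
  -- `X(p₁)Δ(p₂)` acts as `ε(p)E(1 ⊗ 1_u)` for `p` in `A_u`: after `hΞ`, what remains on the second
  -- leg is `S(p₁)p₂d`.
  have hΩ : ∀ u p w, Ξ (R.T1T1 (R.rl u p) w) =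
      R.ε (R.rl u p) • R.E1 ((LinearMap.id ⊠ R.ll u) w) := by
    intro u p w
    refine R.pll.ext_fst (f := Ξ ∘ₗ R.T1T1 (R.rl u p))
      (g := R.ε (R.rl u p) • (R.E1 ∘ₗ (LinearMap.id ⊠ R.ll u))) (fun s c d => ?_) w
    have h1 : ∀ w, Ξ (TensorProduct.assoc ℂ A A A
        ((fixSnd R.T1 (R.ll s c) ⊠ LinearMap.id) w)) = R.ll s c ⊗ₜ R.lu s (R.lmu S w) := by
      intro w
      induction w using TensorProduct.induction_on with
      | zero => simp
      | add x y hx hy => simp only [map_add, TensorProduct.tmul_add, hx, hy]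
      | tmul x y =>
        have h2 := R.T1_rl s (x ⊗ₜ c)
        simp only [TensorProduct.map_tmul, LinearMap.id_apply] at h2
        rw [TensorProduct.map_tmul, fixSnd_apply, ← h2, LinearMap.id_apply, hΞ, lmu_tmul,
          hS.map_rl, R.lu_m]
    rw [LinearMap.comp_apply, T1T1_tmul, h1, hS.left, fstSlice_F1_rl]
    simp [E1, R.pll.diag_tmul]
  -- Hence `X(p₁)Δ(p₂q)w = Δ(S(p₁)p₂q)w`, both being `ε(p)Δ(1_u q)w` for `p` in `A_u`.
  have hK : ∀ w z, Ξ ((LinearMap.id ⊠ R.DL.flip w) (R.T1 z)) = R.DL (R.lmu S (R.T1 z)) w := by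
    intro w z
    refine R.prl.ext_fst (f := Ξ ∘ₗ (LinearMap.id ⊠ R.DL.flip w) ∘ₗ R.T1)
      (g := R.DL.flip w ∘ₗ R.lmu S ∘ₗ R.T1) (fun u p q => ?_) z
    simp only [LinearMap.comp_apply]
    rw [map_DL_T1, hΩ, hS.left, fstSlice_F1_rl, map_smul, ← R.DL_ll, E1_DL]
    rfl
  have hXll : ∀ t a u v, X (R.ll t a) (u ⊗ₜ v) = X a (R.lu t u ⊗ₜ v) := by
    intro t a u v
    obtain ⟨x, rfl⟩ := hS.bijective.2 u
    obtain ⟨y, rfl⟩ := hS.bijective.2 v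
    rw [← hS.map_rl, ← flipS_tmul, ← flipS_tmul, hX, hX, R.DR_ll, TensorProduct.map_tmul]
    rfl
  have hXll' : ∀ t a w, X (R.ll t a) w = X a ((R.lu t ⊠ LinearMap.id) w) := by
    intro t a w
    induction w using TensorProduct.induction_on with
    | zero => simp
    | add x y hx hy => simp only [map_add, hx, hy]
    | tmul x y => rw [hXll]; rfl
  have hKE : ∀ w z, Ξ ((LinearMap.id ⊠ R.DL.flip w) (R.E1 z)) =
      Ξ ((LinearMap.id ⊠ R.DL.flip w) z) := by
    intro w z
    refine R.pll.ext_fst (f := Ξ ∘ₗ (LinearMap.id ⊠ R.DL.flip w) ∘ₗ R.E1)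
      (g := Ξ ∘ₗ (LinearMap.id ⊠ R.DL.flip w)) (fun t a b => ?_) z
    simp only [LinearMap.comp_apply, E1, R.pll.diag_tmul, TensorProduct.map_tmul,
      LinearMap.id_apply]
    change X (R.ll t a) (R.DL (R.lu t b) w) = X (R.ll t a) (R.DL b w)
    rw [R.DL_lu, ← hXll', R.pll.idem]
  -- Choosing a preimage of `a ⊗ b` modulo `E1` through `Q` frees the two legs in `hK`.
  have hXDL : ∀ a b w, X a (R.DL b w) = R.DL (S a) (R.DL b w) := by
    intro a b w
    have h1 := hK w (Q (a ⊗ₜ b))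
    rw [hQ.TQ, hS.lmu_E1, hKE, lmu_tmul, R.DL_m] at h1
    exact h1
  have hXrm : ∀ a c w, (R.rm c ⊠ LinearMap.id) (X a w) = X a ((R.rm c ⊠ LinearMap.id) w) := by
    intro a c w
    induction w using TensorProduct.induction_on with
    | zero => simp
    | add x y hx hy => simp only [map_add, hx, hy]
    | tmul u v =>
      obtain ⟨y, rfl⟩ := hS.bijective.2 v
      rw [TensorProduct.map_tmul, LinearMap.id_apply, hX1, hX1, map_comm', TensorProduct.map_map]
      congr 1
      exact map_congr_apply (fun _ => rfl) (fun b => R.assoc (S b) u c) _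
  -- Passage from `Δ(b)w` to `Δ(b)(1 ⊗ d)`: multiply by `c` on the right of the first leg, which
  -- commutes with both actions, and cancel.
  have hXT : ∀ a z, X a (R.T1 z) = R.DL (S a) (R.T1 z) := by
    intro a z
    induction z using TensorProduct.induction_on with
    | zero => simp
    | add x y hx hy => simp only [map_add, hx, hy]
    | tmul b d =>
      apply R.eq_of_rm_fst
      intro c
      rw [hXrm, ← R.DL_rm_fst, R.T1_spec, hXDL]
  have hXE : ∀ a w, X a (R.E1 w) = X a w := by
    intro a w
    refine R.pll.ext_fst (f := X a ∘ₗ R.E1) (g := X a) (fun t u v => ?_) w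
    rw [LinearMap.comp_apply, E1, R.pll.diag_tmul]
    obtain ⟨x, rfl⟩ := hS.bijective.2 u
    obtain ⟨y, rfl⟩ := hS.bijective.2 v
    rw [← hS.map_ru, ← hS.map_rl, ← flipS_tmul, ← flipS_tmul, hX, hX]
    have h1 := R.DR_E a t (y ⊗ₜ R.ru t x)
    simp only [TensorProduct.map_tmul, LinearMap.id_apply, R.pru.idem] at h1
    rw [h1]
  rw [← hX, ← hXE, ← hQ.TQ, hXT, hQ.TQ, DL_E1]

theorem IsAntipode.flipS_DL {S : A →ₗ[ℂ] A} (hS : R.IsAntipode S) (a : A) (z : A ⊗[ℂ] A) :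
    flipS S (R.DL a z) = R.DR (S a) (flipS S z) := by
  have h := hS.opcop.flipS_DR a (TensorProduct.comm ℂ A A z)
  change flipS S (TensorProduct.comm ℂ A A (R.DL a (TensorProduct.comm ℂ A A
    (TensorProduct.comm ℂ A A z)))) = TensorProduct.comm ℂ A A (R.DR (S a)
      (TensorProduct.comm ℂ A A (flipS S (TensorProduct.comm ℂ A A z)))) at h
  have h1 : ∀ z, flipS S (TensorProduct.comm ℂ A A z) =
      TensorProduct.comm ℂ A A (flipS S z) := fun z => by
    simp only [flipS, LinearMap.comp_apply, LinearEquiv.coe_coe, map_comm']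
  rw [comm_comm', h1, h1, comm_comm'] at h
  exact (TensorProduct.comm ℂ A A).injective h

end BialgebraData

end AntipodeProperties

/-! ### The multiplier `S(a)` obtained from an inverse of a canonical map -/

section InverseToAntipode

local infix:70 " ⊠ " => TensorProduct.map

namespace BialgebraData

variable {I A : Type*} [AddCommGroup A] [Module ℂ A] {R : BialgebraData I A}

/-- The map `a ⊗ b ↦ S(a) b` determined by a generalized inverse `Q` of `T1`. -/
def antimul (R : BialgebraData I A) (Q : A ⊗[ℂ] A →ₗ[ℂ] A ⊗[ℂ] A) : A ⊗[ℂ] A →ₗ[ℂ] A :=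
  fstSlice R.ε ∘ₗ Q

namespace IsInv

variable {Q : A ⊗[ℂ] A →ₗ[ℂ] A ⊗[ℂ] A} (hQ : R.IsInv Q)
include hQ

theorem antimul_T1 (z : A ⊗[ℂ] A) : R.antimul Q (R.T1 z) = fstSlice R.ε (R.F1 z) := by
  rw [antimul, LinearMap.comp_apply, hQ.QT]

theorem antimul_E1 (z : A ⊗[ℂ] A) : R.antimul Q (R.E1 z) = R.antimul Q z := by
  rw [antimul, LinearMap.comp_apply, hQ.QE, LinearMap.comp_apply]

theorem antimul_ll (t : I) (z : A ⊗[ℂ] A) :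
    R.antimul Q ((R.ll t ⊠ LinearMap.id) z) = R.antimul Q ((LinearMap.id ⊠ R.lu t) z) := by
  rw [← hQ.antimul_E1, ← hQ.antimul_E1 ((LinearMap.id ⊠ R.lu t) z), E1, R.pll.diag_map,
    R.pll.diag_map_snd R.plu]

theorem antimul_rm (c : A) (z : A ⊗[ℂ] A) :
    R.antimul Q ((LinearMap.id ⊠ R.rm c) z) = R.m (R.antimul Q z) c := by
  have h := hQ.comm_of (f := LinearMap.id ⊠ R.rm c) (g := LinearMap.id ⊠ R.rm c) (R.T1_rm_snd c)
    (R.prl.diag_comm_map (fun _ _ => rfl) (fun s b => R.rm_ll s c b))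
    (R.pll.diag_comm_map (fun _ _ => rfl) (fun s b => R.rm_lu s c b)) z
  rw [antimul, LinearMap.comp_apply, h, fstSlice_map]
  rfl

theorem antimul_rl (r : I) (z : A ⊗[ℂ] A) :
    R.antimul Q ((R.rl r ⊠ LinearMap.id) z) = R.lu r (R.antimul Q z) := by
  have h := hQ.comm_of (f := LinearMap.id ⊠ R.lu r) (g := R.rl r ⊠ LinearMap.id) (R.T1_lu_snd r)
    (R.prl.diag_comm_map (fun _ _ => rfl) (fun s b => R.lu_ll r s b))
    (R.pll.diag_comm_map (fun s b => (R.ll_rl s r b).symm) (fun _ _ => rfl)) z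
  rw [antimul, LinearMap.comp_apply, h, fstSlice_map]
  rfl

/-- On the range of `F1` the second leg starts with the unit of the lower right index of the first.
As `ε` forces upper and lower right indices to agree, `1^r` on the first leg can be traded for `1_r`
on the second. -/
theorem antimul_ru (r : I) (z : A ⊗[ℂ] A) :
    R.antimul Q ((R.ru r ⊠ LinearMap.id) z) = R.ll r (R.antimul Q z) := by
  have h := hQ.comm_of (f := R.ru r ⊠ LinearMap.id) (g := R.ru r ⊠ LinearMap.id) (R.T1_ru r)
    (R.prl.diag_comm_map (fun s b => R.ru_rl r s b) (fun _ _ => rfl))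
    (R.pll.diag_comm_map (fun s b => (R.ll_ru s r b).symm) (fun _ _ => rfl)) z
  have h1 : ∀ w, fstSlice R.ε ((R.ru r ⊠ LinearMap.id) (R.F1 w)) =
      R.ll r (fstSlice R.ε (R.F1 w)) := by
    refine R.prl.ext_fst (f := fstSlice R.ε ∘ₗ (R.ru r ⊠ LinearMap.id) ∘ₗ R.F1)
      (g := R.ll r ∘ₗ fstSlice R.ε ∘ₗ R.F1) (fun s a b => ?_)
    simp only [LinearMap.comp_apply, F1, R.prl.diag_tmul, TensorProduct.map_tmul, fstSlice_tmul,
      LinearMap.id_apply, map_smul]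
    by_cases hrs : r = s
    · rw [hrs, R.ε_ru, R.prl.idem, R.pll.idem]
    · rw [R.ε_ru_rl_ne hrs, R.pll.orth r s hrs, zero_smul, smul_zero]
  rw [antimul, LinearMap.comp_apply, h, ← hQ.FQ, h1, hQ.FQ]
  rfl

theorem antimul_lu (r : I) (z : A ⊗[ℂ] A) :
    R.antimul Q ((R.lu r ⊠ LinearMap.id) z) = R.antimul Q ((LinearMap.id ⊠ R.ll r) z) := by
  have h := hQ.comm_of (f := R.lu r ⊠ LinearMap.id) (g := R.lu r ⊠ LinearMap.id) (R.T1_lu r)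
    (R.prl.diag_comm_map (fun s b => R.lu_rl r s b) (fun _ _ => rfl))
    (R.pll.diag_comm_map (fun s b => R.lu_ll r s b) (fun _ _ => rfl)) z
  have h' := hQ.comm_of (f := R.ll r ⊠ LinearMap.id) (g := LinearMap.id ⊠ R.ll r) (R.T1_ll r)
    (R.prl.diag_comm_map (fun s b => R.ll_rl r s b) (fun _ _ => rfl))
    (R.pll.diag_comm_map (fun _ _ => rfl) (fun s b => (R.lu_ll s r b).symm)) z
  rw [antimul, LinearMap.comp_apply, LinearMap.comp_apply, h, h', fstSlice_map, fstSlice_map,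
    LinearMap.ext (f := R.ε ∘ₗ R.lu r) (g := R.ε ∘ₗ R.ll r) (R.ε_lu r)]

/-- `c (S(a) b) = (c S(a)) b`, where `c S(a)` is determined by a generalized inverse of `T2`. -/
theorem antimul_compat {Q' : A ⊗[ℂ] A →ₗ[ℂ] A ⊗[ℂ] A} (hQ' : R.opcop.IsInv Q') (a b c : A) :
    R.m c (R.antimul Q (a ⊗ₜ b)) = R.m (R.opcop.antimul Q' (a ⊗ₜ c)) b := by
  -- `Φ₁(c ⊗ a ⊗ b) = c(S(a)b)` and `Φ₂(c ⊗ a ⊗ b) = (cS(a))b`, each computed from its own inverse.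
  -- The plan is to show that they agree on the elements `pq₁ ⊗ q₂ ⊗ q₃y`, and that these cover
  -- enough of the triple tensor product.
  let Φ₁ : A ⊗[ℂ] (A ⊗[ℂ] A) →ₗ[ℂ] A := TensorProduct.lift (R.m.compl₂ (R.antimul Q))
  let Φ₂ : A ⊗[ℂ] (A ⊗[ℂ] A) →ₗ[ℂ] A :=
    TensorProduct.lift (R.m ∘ₗ R.opcop.antimul Q' ∘ₗ flipMap A) ∘ₗ
      (TensorProduct.assoc ℂ A A A).symm.toLinearMap
  have hΦ₁ : ∀ c z, Φ₁ (c ⊗ₜ z) = R.m c (R.antimul Q z) := fun _ _ => rfl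
  have hΦ₂ : ∀ c a b, Φ₂ (c ⊗ₜ (a ⊗ₜ b)) = R.m (R.opcop.antimul Q' (a ⊗ₜ c)) b := fun _ _ _ => rfl
  -- `Φ₁` collapses `pq₁S(q₂)q₃y` on the right, from `S(q₂)q₃`.
  have hW₁ : ∀ p q y, Φ₁ ((LinearMap.id ⊠ fixSnd R.T1 y) (fixFst R.T2 p q)) =
      R.m p (R.m q y) := by
    intro p q y
    refine R.prl.ext_apply (f := Φ₁ ∘ₗ (LinearMap.id ⊠ fixSnd R.T1 y) ∘ₗ fixFst R.T2 p)
      (g := R.m p ∘ₗ R.rm y) (fun s q => ?_) q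
    simp only [LinearMap.comp_apply, fixFst_apply]
    have h1 : ∀ w, Φ₁ ((LinearMap.id ⊠ fixSnd R.T1 y) ((LinearMap.id ⊠ R.rl s) w)) =
        R.m (sndSlice R.ε ((LinearMap.id ⊠ R.rl s) w)) (R.ll s y) := by
      intro w
      induction w using TensorProduct.induction_on with
      | zero => simp
      | add x y hx hy => simp only [map_add, LinearMap.add_apply, hx, hy]
      | tmul u v =>
        simp only [TensorProduct.map_tmul, LinearMap.id_apply, fixSnd_apply, hΦ₁, hQ.antimul_T1,
          fstSlice_F1_rl, sndSlice_tmul, map_smul, LinearMap.smul_apply]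
    rw [T2_rl, h1, ← T2_rl, R.ε_T2, R.assoc, ← R.rl_m, R.prl.idem]
    rfl
  -- `Φ₂` collapses the same expression on the left, from `q₁S(q₂)`; coassociativity identifies the
  -- two expressions.
  have hW₂ : ∀ p q y, Φ₂ (TensorProduct.assoc ℂ A A A
      ((fixFst R.T2 p ⊠ LinearMap.id) (fixSnd R.T1 y q))) = R.m p (R.m q y) := by
    intro p q y
    refine R.plu.ext_apply (f := Φ₂ ∘ₗ (TensorProduct.assoc ℂ A A A).toLinearMap ∘ₗ
      (fixFst R.T2 p ⊠ LinearMap.id) ∘ₗ fixSnd R.T1 y) (g := R.m p ∘ₗ R.rm y) (fun s q => ?_) q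
    simp only [LinearMap.comp_apply, fixSnd_apply, LinearEquiv.coe_coe]
    have h0 : ∀ w v, Φ₂ (TensorProduct.assoc ℂ A A A (w ⊗ₜ v)) =
        R.m (R.opcop.antimul Q' (TensorProduct.comm ℂ A A w)) v := by
      intro w v
      induction w using TensorProduct.induction_on with
      | zero => simp
      | add x y hx hy => simp only [map_add, TensorProduct.add_tmul, LinearMap.add_apply, hx, hy]
      | tmul a b => rfl
    have h1 : ∀ w, Φ₂ (TensorProduct.assoc ℂ A A A
          ((fixFst R.T2 p ⊠ LinearMap.id) ((R.lu s ⊠ LinearMap.id) w))) =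
        R.m (R.ru s p) (fstSlice R.ε ((R.lu s ⊠ LinearMap.id) w)) := by
      intro w
      induction w using TensorProduct.induction_on with
      | zero => simp
      | add x y hx hy => simp only [map_add, hx, hy]
      | tmul u v =>
        have h2 : TensorProduct.comm ℂ A A (R.T2 (p ⊗ₜ R.lu s u)) =
            R.opcop.T1 (R.opcop.rl s u ⊗ₜ p) := rfl
        simp only [TensorProduct.map_tmul, LinearMap.id_apply, fixFst_apply, h0]
        rw [h2, hQ'.antimul_T1, fstSlice_F1_rl, fstSlice_tmul, map_smul, map_smul]
        rfl
    have h3 := R.T1_lu s (q ⊗ₜ y)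
    rw [TensorProduct.map_tmul, LinearMap.id_apply] at h3
    rw [h3, h1, ← h3, R.ε_T1, R.ru_m, R.lu_m, R.plu.idem, ← R.lu_m]
    rfl
  let W : (A ⊗[ℂ] A) ⊗[ℂ] A →ₗ[ℂ] A ⊗[ℂ] (A ⊗[ℂ] A) :=
    (LinearMap.id ⊠ R.T1) ∘ₗ (TensorProduct.assoc ℂ A A A).toLinearMap ∘ₗ (R.T2 ⊠ LinearMap.id)
  have hW : ∀ w, Φ₁ (W w) = Φ₂ (W w) := by
    have h1 : Φ₁ ∘ₗ W = Φ₂ ∘ₗ W := by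
      apply TensorProduct.ext_threefold
      intro p q y
      have h2 : W (p ⊗ₜ q ⊗ₜ y) = (LinearMap.id ⊠ fixSnd R.T1 y) (fixFst R.T2 p q) := by
        simp only [W, LinearMap.comp_apply, TensorProduct.map_tmul, LinearMap.id_apply,
          fixFst_apply, LinearEquiv.coe_coe]
        induction R.T2 (p ⊗ₜ q) using TensorProduct.induction_on with
        | zero => simp
        | add x y hx hy => simp only [map_add, TensorProduct.add_tmul, hx, hy]
        | tmul x y => simp
      change Φ₁ (W _) = Φ₂ (W _)
      rw [h2, hW₁, ← R.coassoc, hW₂]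
    exact LinearMap.congr_fun h1
  refine R.prl.ext_apply (f := R.rm (R.antimul Q (a ⊗ₜ b)))
    (g := R.rm b ∘ₗ fixFst (R.opcop.antimul Q') a) (fun s c => ?_) c
  change R.m (R.rl s c) (R.antimul Q (a ⊗ₜ b)) =
    R.m (R.opcop.antimul Q' (a ⊗ₜ R.rl s c)) b
  -- the preimage of `c ⊗ E1 z` under `W`
  let V : A ⊗[ℂ] A →ₗ[ℂ] (A ⊗[ℂ] A) ⊗[ℂ] A :=
    ((flipMap A ∘ₗ Q' ∘ₗ flipMap A) ⊠ LinearMap.id) ∘ₗ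
      (TensorProduct.assoc ℂ A A A).symm.toLinearMap ∘ₗ TensorProduct.mk ℂ A (A ⊗[ℂ] A) (R.rl s c)
      ∘ₗ Q
  have hV : ∀ z, W (V z) = R.rl s c ⊗ₜ (R.ru s ⊠ LinearMap.id) (R.E1 z) := by
    intro z
    have h1 : ∀ w, W (((flipMap A ∘ₗ Q' ∘ₗ flipMap A) ⊠ LinearMap.id)
        ((TensorProduct.assoc ℂ A A A).symm (R.rl s c ⊗ₜ w))) =
        R.rl s c ⊗ₜ R.T1 ((R.ru s ⊠ LinearMap.id) w) := by
      intro w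
      have h3 : ∀ u, R.T2 (TensorProduct.comm ℂ A A (Q' u)) =
          TensorProduct.comm ℂ A A (R.opcop.E1 u) := by
        intro u
        rw [← hQ'.TQ]
        exact (comm_comm' _).symm
      induction w using TensorProduct.induction_on with
      | zero => simp
      | add x y hx hy => simp only [map_add, TensorProduct.tmul_add, hx, hy]
      | tmul u v =>
        simp only [W, LinearMap.comp_apply, TensorProduct.map_tmul, LinearMap.id_apply,
          LinearEquiv.coe_coe, TensorProduct.assoc_symm_tmul]
        rw [h3, opcop_E1, comm_comm', E2, R.prl.diag_tmul, TensorProduct.assoc_tmul,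
          TensorProduct.map_tmul, LinearMap.id_apply]
    change W (((flipMap A ∘ₗ Q' ∘ₗ flipMap A) ⊠ LinearMap.id)
        ((TensorProduct.assoc ℂ A A A).symm (R.rl s c ⊗ₜ Q z))) = _
    rw [h1, R.T1_ru, hQ.TQ]
  -- The `E1` and `1^s` left over in `hV` are absorbed: `Φ₁` turns `1^s` on the right of `a` into
  -- `1_s` on the left, next to `c1_s`. The rest checks the same for `Φ₂`.
  have h1 := hW (V (a ⊗ₜ b))
  rw [hV, hΦ₁, hQ.antimul_ru, hQ.antimul_E1, ← R.rl_m, R.prl.idem] at h1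
  rw [h1]
  refine R.pll.ext_fst (f := Φ₂ ∘ₗ TensorProduct.mk ℂ A (A ⊗[ℂ] A) (R.rl s c) ∘ₗ
      (R.ru s ⊠ LinearMap.id) ∘ₗ R.E1)
    (g := TensorProduct.lift (R.m ∘ₗ fixSnd (R.opcop.antimul Q') (R.rl s c))) (fun t a b => ?_)
    (a ⊗ₜ b)
  simp only [LinearMap.comp_apply, E1, R.pll.diag_tmul, TensorProduct.map_tmul,
    LinearMap.id_apply, TensorProduct.mk_apply, hΦ₂, TensorProduct.lift.tmul, fixSnd_apply]
  have h2 := hQ'.antimul_ll s (R.ll t a ⊗ₜ R.rl s c)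
  have h3 := hQ'.antimul_ru t (R.ll t a ⊗ₜ R.rl s c)
  simp only [TensorProduct.map_tmul, LinearMap.id_apply] at h2 h3
  change R.opcop.antimul Q' (R.ru s (R.ll t a) ⊗ₜ R.rl s c) =
    R.opcop.antimul Q' (R.ll t a ⊗ₜ R.rl s (R.rl s c)) at h2
  change R.opcop.antimul Q' (R.ll t (R.ll t a) ⊗ₜ R.rl s c) =
    R.ru t (R.opcop.antimul Q' (R.ll t a ⊗ₜ R.rl s c)) at h3
  rw [h2, R.prl.idem, ← R.ru_m, ← h3, R.pll.idem]

/-- This is `S(p₁b)p₂q = S(b)S(p₁)p₂q` for `p` in `A_u`. The left argument is `Δ(p)(b ⊗ q) =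
Δ(p)T1(Q(b ⊗ q)) = T1((p ⊗ 1)Q(b ⊗ q))`. Applying `S(x)y` leaves the slice of `(p ⊗ 1)Q(b ⊗ q)` by
`ε`, and `ε(px) = ε(p)ε(1_u x)`. -/
theorem antimul_rm_T1 (u : I) (p q b : A) :
    R.antimul Q ((R.rm b ⊠ LinearMap.id) (R.T1 (R.rl u p ⊗ₜ q))) =
      R.antimul Q (b ⊗ₜ R.antimul Q (R.T1 (R.rl u p ⊗ₜ q))) := by
  have h1 : Q (b ⊗ₜ R.ll u q) = (R.ll u ⊠ LinearMap.id) (Q (b ⊗ₜ q)) :=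
    hQ.comm_of (f := R.ll u ⊠ LinearMap.id) (g := LinearMap.id ⊠ R.ll u) (R.T1_ll u)
      (R.prl.diag_comm_map (fun s b => R.ll_rl u s b) (fun _ _ => rfl))
      (R.pll.diag_comm_map (fun _ _ => rfl) (fun s b => (R.lu_ll s u b).symm)) (b ⊗ₜ q)
  have h2 : R.ε ∘ₗ R.m (R.rl u p) = R.ε (R.rl u p) • (R.ε ∘ₗ R.ll u) := by
    ext x
    simp only [LinearMap.comp_apply, LinearMap.smul_apply, smul_eq_mul]
    rw [R.rl_m, R.ε_m_ll]
  have h3 : (R.m (R.rl u p) ⊠ LinearMap.id) (R.F1 (Q (b ⊗ₜ q))) =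
      R.F1 ((R.m (R.rl u p) ⊠ LinearMap.id) (Q (b ⊗ₜ q))) :=
    R.prl.diag_comm_map (Q := R.ll) (f := R.m (R.rl u p)) (g := LinearMap.id)
      (fun s x => R.m_rl s _ x) (fun _ _ => rfl) _
  have h4 : R.antimul Q (b ⊗ₜ R.ll u q) = fstSlice (R.ε ∘ₗ R.ll u) (Q (b ⊗ₜ q)) := by
    rw [antimul, LinearMap.comp_apply, h1, fstSlice_map, LinearMap.id_apply]
  rw [R.T1_spec, ← DL_E1, ← hQ.TQ, DL_T1, hQ.antimul_T1, hQ.antimul_T1, ← h3, hQ.FQ,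
    fstSlice_F1_rl, fstSlice_map, h2, fstSlice_smul, LinearMap.id_apply,
    TensorProduct.tmul_smul, map_smul, h4]

/-- `S(a b) c = S(b) (S(a) c)`. -/
theorem antimul_m (a b c : A) :
    R.antimul Q (R.m a b ⊗ₜ c) = R.antimul Q (b ⊗ₜ R.antimul Q (a ⊗ₜ c)) := by
  -- The elements `T1(Q(a ⊗ c)) = E1(a ⊗ c)` represent `a ⊗ c` as far as `S(a)c` is concerned, so
  -- `antimul_rm_T1` extends from the range of `T1` to arbitrary arguments.
  have h1 : R.antimul Q ((R.rm b ⊠ LinearMap.id) (R.T1 (Q (a ⊗ₜ c)))) =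
      R.antimul Q (b ⊗ₜ R.antimul Q (R.T1 (Q (a ⊗ₜ c)))) :=
    R.prl.ext_fst (f := R.antimul Q ∘ₗ (R.rm b ⊠ LinearMap.id) ∘ₗ R.T1)
      (g := fixFst (R.antimul Q) b ∘ₗ R.antimul Q ∘ₗ R.T1)
      (fun u p q => hQ.antimul_rm_T1 u p q b) _
  have h2 : (R.rm b ⊠ LinearMap.id) (R.E1 (a ⊗ₜ c)) =
      R.E1 ((R.rm b ⊠ LinearMap.id) (a ⊗ₜ c)) :=
    R.pll.diag_comm_map (Q := R.lu) (f := R.rm b) (g := LinearMap.id)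
      (fun s x => R.rm_ll s b x) (fun _ _ => rfl) (a ⊗ₜ c)
  rw [hQ.TQ, h2, hQ.antimul_E1, hQ.antimul_E1] at h1
  exact h1

end IsInv

end BialgebraData

end InverseToAntipode

/-! ### The antipode from inverses of the canonical maps -/

section AntipodeExists

local infix:70 " ⊠ " => TensorProduct.map

namespace BialgebraData

variable {I A : Type*} [AddCommGroup A] [Module ℂ A] {R : BialgebraData I A}

theorem IsInv.cop_cop {Q : A ⊗[ℂ] A →ₗ[ℂ] A ⊗[ℂ] A} (hQ : R.IsInv Q) : R.cop.cop.IsInv Q :=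
  ⟨hQ.QT, hQ.TQ, hQ.FQ, hQ.QE⟩

theorem IsPreAntipode.cop_cop {S : A →ₗ[ℂ] A} (hS : R.IsPreAntipode S) :
    R.cop.cop.IsPreAntipode S :=
  ⟨hS.map_m, hS.map_lu, hS.map_ll, hS.map_ru, hS.map_rl, hS.left, hS.right⟩

/-- The multiplier `S(q)` belongs to `A`. -/
theorem IsInv.exists_antimul_eq {Q : A ⊗[ℂ] A →ₗ[ℂ] A ⊗[ℂ] A} (hQ : R.IsInv Q) (q : A) :
    ∃ x, ∀ d, R.m x d = R.antimul Q (q ⊗ₜ d) := by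
  refine R.plu.span (fun q => ∃ x, ∀ d, R.m x d = R.antimul Q (q ⊗ₜ d)) ⟨0, by simp⟩ ?_ ?_ q
  · rintro a b ⟨x, hx⟩ ⟨y, hy⟩
    exact ⟨x + y, fun d => by
      rw [map_add, LinearMap.add_apply, hx, hy, TensorProduct.add_tmul, map_add]⟩
  · intro r q
    obtain ⟨p, hp⟩ := R.ε_rl_ne r
    -- The witness is `ε(p)⁻¹S(p₁q)p₂` with `p` in `A_r`, which makes sense because `p₁q ⊗ p₂` lies
    -- in `A ⊗ A`. Multiplied by `d` it becomes `S(q)1_r d = S(1^r q)d`.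
    refine ⟨(R.ε (R.rl r p))⁻¹ •
      R.antimul Q (TensorProduct.comm ℂ A A (R.U1 (R.rl r p ⊗ₜ q))), fun d => ?_⟩
    have h1 := hQ.antimul_lu r (q ⊗ₜ d)
    rw [TensorProduct.map_tmul, TensorProduct.map_tmul, LinearMap.id_apply, LinearMap.id_apply]
      at h1
    rw [map_smul, LinearMap.smul_apply, ← hQ.antimul_rm, map_comm', ← R.T1_U1,
      hQ.antimul_rm_T1, hQ.antimul_T1, fstSlice_F1_rl, TensorProduct.tmul_smul, map_smul,
      inv_smul_smul₀ hp, h1]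

/-- Linearity and all algebraic properties of `S` are checked after multiplication by an arbitrary
`d`, where they are the properties of `antimul`. `antimul_compat` makes the inverse of `T2` describe
the same `S`, and this gives the right antipode identity. -/
theorem IsInv.exists_isPreAntipode {Q Q' : A ⊗[ℂ] A →ₗ[ℂ] A ⊗[ℂ] A} (hQ : R.IsInv Q)
    (hQ' : R.opcop.IsInv Q') : ∃ S, R.IsPreAntipode S := by
  choose f hf using hQ.exists_antimul_eq
  have hcancel : ∀ a b, (∀ d, R.m a d = R.m b d) → a = b := by
    intro a b h
    rw [← sub_eq_zero]
    apply R.nondegL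
    intro d
    rw [map_sub, LinearMap.sub_apply, h, sub_self]
  have hcancel' : ∀ a b, (∀ d, R.m d a = R.m d b) → a = b := by
    intro a b h
    rw [← sub_eq_zero]
    apply R.nondegR
    intro d
    rw [map_sub, h, sub_self]
  let S : A →ₗ[ℂ] A :=
    { toFun := f
      map_add' := fun a b => hcancel _ _ fun d => by
        rw [map_add, LinearMap.add_apply, hf, hf, hf, TensorProduct.add_tmul, map_add]
      map_smul' := fun c a => hcancel _ _ fun d => by
        rw [map_smul, LinearMap.smul_apply, hf, hf, ← TensorProduct.smul_tmul', map_smul]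
        rfl }
  have hS : ∀ a d, R.m (S a) d = R.antimul Q (a ⊗ₜ d) := hf
  have hS' : ∀ a c, R.m c (S a) = R.opcop.antimul Q' (a ⊗ₜ c) := by
    intro a c
    apply hcancel
    intro b
    rw [R.assoc, hS, hQ.antimul_compat hQ']
  have hl : ∀ z, R.lmu S z = R.antimul Q z := by
    intro z
    induction z using TensorProduct.induction_on with
    | zero => simp
    | add x y hx hy => simp only [map_add, hx, hy]
    | tmul a b => exact hS a b
  have hr : ∀ z, R.rmu S z = R.opcop.antimul Q' (TensorProduct.comm ℂ A A z) := by
    intro z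
    induction z using TensorProduct.induction_on with
    | zero => simp
    | add x y hx hy => simp only [map_add, hx, hy]
    | tmul a b => exact hS' b a
  refine ⟨S, ?_, ?_, ?_, ?_, ?_, ?_, ?_⟩
  · intro a b
    apply hcancel
    intro d
    rw [R.assoc, hS, hS, hS, hQ.antimul_m]
  · intro r a
    apply hcancel
    intro d
    have h := hQ.antimul_lu r (a ⊗ₜ d)
    rw [TensorProduct.map_tmul, TensorProduct.map_tmul] at h
    rw [R.rl_m, hS, hS]
    exact h
  · intro r a
    apply hcancel
    intro d
    have h := hQ.antimul_ll r (a ⊗ₜ d)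
    rw [TensorProduct.map_tmul, TensorProduct.map_tmul] at h
    rw [R.ru_m, hS, hS]
    exact h
  · intro r a
    apply hcancel
    intro d
    have h := hQ.antimul_ru r (a ⊗ₜ d)
    rw [TensorProduct.map_tmul] at h
    rw [R.ll_m, hS, hS]
    exact h
  · intro r a
    apply hcancel
    intro d
    have h := hQ.antimul_rl r (a ⊗ₜ d)
    rw [TensorProduct.map_tmul] at h
    rw [R.lu_m, hS, hS]
    exact h
  · intro z
    rw [hl, hQ.antimul_T1]
  · intro z
    have h := hQ'.antimul_T1 (TensorProduct.comm ℂ A A z)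
    rw [opcop_F1] at h
    change R.opcop.antimul Q' (TensorProduct.comm ℂ A A (R.T2 (TensorProduct.comm ℂ A A
      (TensorProduct.comm ℂ A A z)))) = fstSlice R.ε _ at h
    rw [comm_comm', fstSlice_comm] at h
    rw [hr, h]

/-- Evaluating `S(a₁b)a₂ = S(ε(a)1^s b)` on a preimage of `a ⊗ b` under the coopposite canonical map
turns it into `S(b)a = S(S'(a)b) = S(b)S(S'(a))`. It then remains to cancel `S(b)`. -/
theorem IsPreAntipode.leftInverse {S S' Q : _} (hS : R.IsPreAntipode S)
    (hS' : R.cop.IsPreAntipode S') (hQ : R.cop.IsInv Q) (a : A) : S (S' a) = a := by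
  have h1 : ∀ w, R.lmu S (TensorProduct.comm ℂ A A (R.cop.E1 w)) =
      R.lmu S (TensorProduct.comm ℂ A A w) := by
    refine R.pll.ext_snd (f := R.lmu S ∘ₗ flipMap A ∘ₗ R.cop.E1) (g := R.lmu S ∘ₗ flipMap A)
      (fun r b a => ?_)
    have h2 : R.cop.E1 (a ⊗ₜ R.ll r b) = R.lu r a ⊗ₜ R.ll r b :=
      R.plu.diag_tmul_snd R.pll r a b
    simp only [LinearMap.comp_apply, h2, LinearEquiv.coe_coe, TensorProduct.comm_tmul, lmu_tmul]
    rw [← R.ru_m, ← hS.map_ll, R.pll.idem]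
  have h2 : ∀ b, R.m (S b) a = R.m (S b) (S (S' a)) := by
    intro b
    have h3 := hS.lmu_U1 (Q (a ⊗ₜ b))
    have h4 : R.U1 (Q (a ⊗ₜ b)) = R.cop.E1 (a ⊗ₜ b) := hQ.TQ _
    have h5 : fstSlice R.ε (R.cop.F1 (Q (a ⊗ₜ b))) =
        R.cop.lmu S' (R.cop.T1 (Q (a ⊗ₜ b))) := (hS'.left _).symm
    rw [h4, h1, h5, hQ.TQ, hS'.lmu_E1, lmu_tmul, TensorProduct.comm_tmul, lmu_tmul] at h3
    rw [h3]
    exact hS.map_m _ _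
  rw [eq_comm, ← sub_eq_zero]
  apply R.nondegR
  intro c
  -- The products `xS(y)` include, by the right antipode identity, all nonzero multiples `ε(b)c1^r`.
  -- This makes `S(b)` cancellable without knowing that `S` is onto.
  have h3 : ∀ z, R.m (R.rmu S z) (a - S (S' a)) = 0 := by
    intro z
    induction z using TensorProduct.induction_on with
    | zero => simp
    | add x y hx hy => simp only [map_add, LinearMap.add_apply, hx, hy, add_zero]
    | tmul x y => rw [rmu_tmul, R.assoc, map_sub (R.m (S y)), h2, sub_self, map_zero]
  refine R.pru.ext_apply (f := R.rm (a - S (S' a))) (g := 0) (fun r c => ?_) c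
  obtain ⟨b, hb⟩ := R.ε_ll_ne r
  rw [← R.ε_lu] at hb
  have h4 := h3 (R.T2 (R.ru r c ⊗ₜ R.lu r b))
  rw [hS.right, F2, R.pru.diag_tmul, sndSlice_tmul, R.plu.idem, map_smul,
    LinearMap.smul_apply] at h4
  exact (smul_eq_zero.1 h4).resolve_left hb

/-- The coopposite of the coopposite is the original, so `leftInverse` applies in both orders and
shows that `S` and `S'` are mutually inverse. -/
theorem exists_isAntipode {Q₁ Q₂ Q₃ Q₄ : A ⊗[ℂ] A →ₗ[ℂ] A ⊗[ℂ] A} (h₁ : R.IsInv Q₁)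
    (h₂ : R.opcop.IsInv Q₂) (h₃ : R.cop.IsInv Q₃) (h₄ : R.cop.opcop.IsInv Q₄) :
    ∃ S, R.IsAntipode S := by
  obtain ⟨S, hS⟩ := h₁.exists_isPreAntipode h₂
  obtain ⟨S', hS'⟩ := h₃.exists_isPreAntipode h₄
  exact ⟨S, hS, fun a b h => by
    rw [← hS'.leftInverse hS.cop_cop h₁.cop_cop a, h, hS'.leftInverse hS.cop_cop h₁.cop_cop b],
    fun a => ⟨S' a, hS.leftInverse hS' h₃ a⟩⟩

/-- Existence of an antipode is equivalent to invertibility of the canonical maps. -/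
theorem exists_isAntipode_iff : (∃ S, R.IsAntipode S) ↔ (∃ Q, R.IsInv Q) ∧
    (∃ Q, R.opcop.IsInv Q) ∧ (∃ Q, R.cop.IsInv Q) ∧ ∃ Q, R.cop.opcop.IsInv Q := by
  constructor
  · rintro ⟨S, hS⟩
    let e := LinearEquiv.ofBijective S hS.bijective
    have h := hS.cop (T := e.symm.toLinearMap) (fun a => e.symm_apply_apply a)
      (fun a => e.apply_symm_apply a)
    exact ⟨hS.exists_isInv, hS.opcop.exists_isInv, h.exists_isInv, h.opcop.exists_isInv⟩
  · rintro ⟨⟨Q₁, h₁⟩, ⟨Q₂, h₂⟩, ⟨Q₃, h₃⟩, ⟨Q₄, h₄⟩⟩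
    exact exists_isAntipode h₁ h₂ h₃ h₄

/-- For any antipode, `S(a)b` is the `ε`-slice of `F1(Q(a ⊗ b))`, which does not involve `S`. -/
theorem IsAntipode.unique {S S' : A →ₗ[ℂ] A} (hS : R.IsAntipode S) (hS' : R.IsAntipode S') :
    S = S' := by
  obtain ⟨Q, hQ⟩ := hS.exists_isInv
  ext a
  rw [← sub_eq_zero]
  apply R.nondegL
  intro b
  rw [map_sub, LinearMap.sub_apply, sub_eq_zero, ← lmu_tmul, ← lmu_tmul, ← hS.lmu_E1,
    ← hS'.lmu_E1, ← hQ.TQ, hS.left, hS'.left]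

end BialgebraData

end AntipodeExists

/-! ### Non-degenerate algebras and their multipliers -/

section Nondegenerate

local infix:70 " ⊠ " => TensorProduct.map

/-- Non-degeneracy of an algebra. -/
structure IsNondeg (A : Type*) [NonUnitalRing A] : Prop where
  left : ∀ a : A, (∀ b, a * b = 0) → a = 0
  right : ∀ a : A, (∀ b, b * a = 0) → a = 0

theorem IsNondeg.eq_of_mul_right {A : Type*} [NonUnitalRing A] (hA : IsNondeg A) {a b : A}
    (h : ∀ c, a * c = b * c) : a = b := by
  rw [← sub_eq_zero]
  exact hA.left _ fun c => by rw [sub_mul, h, sub_self]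

theorem IsNondeg.eq_of_mul_left {A : Type*} [NonUnitalRing A] (hA : IsNondeg A) {a b : A}
    (h : ∀ c, c * a = c * b) : a = b := by
  rw [← sub_eq_zero]
  exact hA.right _ fun c => by rw [mul_sub, h, sub_self]

variable {A B : Type*} [NonUnitalRing A] [Module ℂ A] [IsScalarTower ℂ A A] [SMulCommClass ℂ A A]
  [NonUnitalRing B] [Module ℂ B] [IsScalarTower ℂ B B] [SMulCommClass ℂ B B]

/-- Tensoring with the scalars makes the locally finite sum `∑ P s` available as a `diag`. It is the
identity, and it vanishes on `a`. -/
theorem Partition.eq_zero {I V : Type*} [AddCommGroup V] [Module ℂ V] {P : I → V →ₗ[ℂ] V}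
    (hP : Partition P) {a : V} (h : ∀ s, P s a = 0) : a = 0 := by
  have h1 : hP.diag (fun _ => (LinearMap.id : ℂ →ₗ[ℂ] ℂ)) (a ⊗ₜ 1) = a ⊗ₜ 1 :=
    hP.ext_fst (f := hP.diag (fun _ => (LinearMap.id : ℂ →ₗ[ℂ] ℂ))) (g := LinearMap.id)
      (fun s a b => by rw [hP.diag_tmul]; rfl) _
  have h2 : hP.diag (fun _ => (LinearMap.id : ℂ →ₗ[ℂ] ℂ)) (a ⊗ₜ 1) = 0 := by
    change ∑ᶠ s, (P s ⊠ LinearMap.id) (a ⊗ₜ (1 : ℂ)) = 0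
    simp [h]
  have h3 := congrArg (TensorProduct.rid ℂ V) (h1.symm.trans h2)
  simpa using h3

theorem tmul_mul_eq_map (a : A) (b : B) (z : A ⊗[ℂ] B) :
    (a ⊗ₜ[ℂ] b) * z = (LinearMap.mulLeft ℂ a ⊠ LinearMap.mulLeft ℂ b) z := by
  induction z using TensorProduct.induction_on with
  | zero => simp
  | add x y hx hy => simp only [map_add, mul_add, hx, hy]
  | tmul c d => simp

theorem mul_tmul_eq_map (a : A) (b : B) (z : A ⊗[ℂ] B) :
    z * (a ⊗ₜ[ℂ] b) = (LinearMap.mulRight ℂ a ⊠ LinearMap.mulRight ℂ b) z := by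
  induction z using TensorProduct.induction_on with
  | zero => simp
  | add x y hx hy => simp only [map_add, add_mul, hx, hy]
  | tmul c d => simp

theorem IsNondeg.tensor (hA : IsNondeg A) (hB : IsNondeg B) : IsNondeg (A ⊗[ℂ] B) where
  left z h := by
    refine eq_of_fst (fun c : A => LinearMap.mulRight ℂ c) (fun x hx => hA.left x hx) fun c => ?_
    refine eq_of_snd (fun c : B => LinearMap.mulRight ℂ c) (fun x hx => hB.left x hx) fun d => ?_
    rw [← map_eq_snd_fst, ← mul_tmul_eq_map, h, map_zero, map_zero]
  right z h := by
    refine eq_of_fst (fun c : A => LinearMap.mulLeft ℂ c) (fun x hx => hA.right x hx) fun c => ?_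
    refine eq_of_snd (fun c : B => LinearMap.mulLeft ℂ c) (fun x hx => hB.right x hx) fun d => ?_
    rw [← map_eq_snd_fst, ← tmul_mul_eq_map, h, map_zero, map_zero]

/-! ### Multipliers of non-degenerate algebras as module maps. -/

namespace Multiplier

theorem mul_left_eq (m : Multiplier A) (a b : A) : a * m.left b = m.right a * b := m.2 a b

theorem left_mul (hA : IsNondeg A) (m : Multiplier A) (a b : A) :
    m.left (a * b) = m.left a * b := by
  apply hA.eq_of_mul_left
  intro c
  rw [mul_left_eq, ← mul_assoc, ← mul_assoc, mul_left_eq]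

theorem right_mul (hA : IsNondeg A) (m : Multiplier A) (a b : A) :
    m.right (a * b) = a * m.right b := by
  apply hA.eq_of_mul_right
  intro c
  rw [← mul_left_eq, mul_assoc, mul_assoc, mul_left_eq]

theorem ext_left (hA : IsNondeg A) {m n : Multiplier A} (h : ∀ a, m.left a = n.left a) :
    m = n := by
  apply Subtype.ext
  refine Prod.ext (LinearMap.ext h) (MulOpposite.unop_injective (LinearMap.ext fun a => ?_))
  change m.right a = n.right a
  apply hA.eq_of_mul_right
  intro c
  rw [← mul_left_eq, ← mul_left_eq, h]

theorem incl_injective (hA : IsNondeg A) : Function.Injective (Multiplier.incl A) := by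
  intro a b h
  apply hA.eq_of_mul_right
  intro c
  exact LinearMap.congr_fun (congrArg Multiplier.left h) c

@[simp] theorem mul_left (m n : Multiplier A) (a : A) : (m * n).left a = m.left (n.left a) := rfl
@[simp] theorem mul_right (m n : Multiplier A) (a : A) :
    (m * n).right a = n.right (m.right a) := rfl
@[simp] theorem incl_left (a b : A) : (Multiplier.incl A a).left b = a * b := rfl
@[simp] theorem incl_right (a b : A) : (Multiplier.incl A a).right b = b * a := rfl
theorem tmul_left (m : Multiplier A) (n : Multiplier B) (z : A ⊗[ℂ] B) :
    (Multiplier.tmul A B m n).left z = (m.left ⊠ n.left) z := rfl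
theorem tmul_right (m : Multiplier A) (n : Multiplier B) (z : A ⊗[ℂ] B) :
    (Multiplier.tmul A B m n).right z = (m.right ⊠ n.right) z := rfl
theorem tmul_one_left (m : Multiplier A) (z : A ⊗[ℂ] B) :
    (Multiplier.tmul A B m 1).left z = (m.left ⊠ LinearMap.id) z := rfl
theorem one_tmul_left (n : Multiplier B) (z : A ⊗[ℂ] B) :
    (Multiplier.tmul A B 1 n).left z = (LinearMap.id ⊠ n.left) z := rfl
theorem tmul_one_right (m : Multiplier A) (z : A ⊗[ℂ] B) :
    (Multiplier.tmul A B m 1).right z = (m.right ⊠ LinearMap.id) z := rfl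
theorem one_tmul_right (n : Multiplier B) (z : A ⊗[ℂ] B) :
    (Multiplier.tmul A B 1 n).right z = (LinearMap.id ⊠ n.right) z := rfl
theorem flip_left (m : Multiplier (A ⊗[ℂ] A)) (z : A ⊗[ℂ] A) :
    (Multiplier.flip A m).left z = TensorProduct.comm ℂ A A (m.left (TensorProduct.comm ℂ A A z)) :=
  rfl
theorem flip_right (m : Multiplier (A ⊗[ℂ] A)) (z : A ⊗[ℂ] A) :
    (Multiplier.flip A m).right z =
      TensorProduct.comm ℂ A A (m.right (TensorProduct.comm ℂ A A z)) :=
  rfl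

/-- `m ↦ m.left` as a linear map. -/
def leftHom : Multiplier A →ₗ[ℂ] A →ₗ[ℂ] A where
  toFun m := m.left
  map_add' _ _ := rfl
  map_smul' _ _ := rfl

/-- `m ↦ m.right` as a linear map. -/
def rightHom : Multiplier A →ₗ[ℂ] A →ₗ[ℂ] A where
  toFun m := m.right
  map_add' _ _ := rfl
  map_smul' _ _ := rfl

/-- A linear map with values in the image of `A` lifts to `A`. -/
theorem exists_lift (hA : IsNondeg A) {V : Type*} [AddCommGroup V] [Module ℂ V]
    (f : V →ₗ[ℂ] Multiplier A) (hf : ∀ v, f v ∈ LinearMap.range (Multiplier.incl A)) :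
    ∃ T : V →ₗ[ℂ] A, ∀ v, Multiplier.incl A (T v) = f v := by
  let e := LinearEquiv.ofInjective (Multiplier.incl A) (incl_injective hA)
  refine ⟨e.symm.toLinearMap ∘ₗ f.codRestrict _ hf, fun v => ?_⟩
  exact congrArg Subtype.val (e.apply_symm_apply ⟨f v, hf v⟩)

end Multiplier

end Nondegenerate

/-! ### Gradings and projections -/

section Gradings

local infix:70 " ⊠ " => TensorProduct.map

namespace PartialAlgebra

variable {J A : Type*} [NonUnitalRing A] [Module ℂ A] (G : PartialAlgebra J A)

theorem hom_ext {X : Type*} [AddCommMonoid X] [Module ℂ X] {f g : A →ₗ[ℂ] X}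
    (h : ∀ j k, ∀ a ∈ G.grade j k, f a = g a) (a : A) : f a = g a := by
  induction a using G.induction with
  | zero => simp
  | add x y hx hy => simp only [map_add, hx, hy]
  | hom j k a ha => exact h j k a ha

theorem hom_ext_tensor {X : Type*} [AddCommMonoid X] [Module ℂ X] {f g : A ⊗[ℂ] A →ₗ[ℂ] X}
    (h : ∀ j k j' k', ∀ a ∈ G.grade j k, ∀ b ∈ G.grade j' k', f (a ⊗ₜ b) = g (a ⊗ₜ b))
    (z : A ⊗[ℂ] A) : f z = g z := by
  induction z using TensorProduct.induction_on with
  | zero => simp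
  | add x y hx hy => simp only [map_add, hx, hy]
  | tmul a b =>
    refine G.hom_ext (f := f ∘ₗ (TensorProduct.mk ℂ A A).flip b)
      (g := g ∘ₗ (TensorProduct.mk ℂ A A).flip b) (fun j k a ha => ?_) a
    exact G.hom_ext (f := f ∘ₗ TensorProduct.mk ℂ A A a) (g := g ∘ₗ TensorProduct.mk ℂ A A a)
      (fun j' k' b hb => h j k j' k' a ha b hb) b

theorem proj_comm (P Q : Set (J × J)) (a : A) :
    G.proj P (G.proj Q a) = G.proj Q (G.proj P a) := by
  classical
  refine G.hom_ext (f := G.proj P ∘ₗ G.proj Q) (g := G.proj Q ∘ₗ G.proj P) (fun j k a ha => ?_) a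
  simp only [LinearMap.comp_apply, G.proj_of_mem _ ha]
  split_ifs <;> simp [G.proj_of_mem _ ha, *]

theorem proj_idem (P : Set (J × J)) (a : A) : G.proj P (G.proj P a) = G.proj P a := by
  classical
  refine G.hom_ext (f := G.proj P ∘ₗ G.proj P) (g := G.proj P) (fun j k a ha => ?_) a
  simp only [LinearMap.comp_apply, G.proj_of_mem _ ha]
  split_ifs <;> simp [G.proj_of_mem _ ha, *]

theorem partition_proj {K : Type*} (f : J × J → K) :
    Partition (fun r => G.proj {p | f p = r}) where
  idem r a := G.proj_idem _ a
  orth r s h a := by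
    classical
    refine G.hom_ext (f := G.proj {p | f p = r} ∘ₗ G.proj {p | f p = s}) (g := 0)
      (fun j k a ha => ?_) a
    simp only [LinearMap.comp_apply, G.proj_of_mem _ ha, Set.mem_ofPred_eq]
    split_ifs with h1
    · rw [G.proj_of_mem _ ha, if_neg]
      · rfl
      · intro h2
        exact h (h2.symm.trans h1)
    · simp
  span p h0 hadd hP a := by
    classical
    refine G.induction h0 hadd (fun j k a ha => ?_) a
    have h1 := hP (f (j, k)) a
    rwa [G.proj_of_mem _ ha, Set.mem_ofPred_eq, if_pos rfl] at h1

theorem proj_mem_colPart (s : J) (a : A) : G.proj {p | p.2 = s} a ∈ colPart G.grade s := by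
  classical
  induction a using G.induction with
  | zero => simp
  | add x y hx hy => rw [map_add]; exact Submodule.add_mem _ hx hy
  | hom j k a ha =>
    rw [G.proj_of_mem _ ha]
    split_ifs with h
    · have h' : k = s := h
      subst h'
      exact Submodule.mem_iSup_of_mem j ha
    · exact Submodule.zero_mem _

theorem proj_mem_rowPart (r : J) (a : A) : G.proj {p | p.1 = r} a ∈ rowPart G.grade r := by
  classical
  induction a using G.induction with
  | zero => simp
  | add x y hx hy => rw [map_add]; exact Submodule.add_mem _ hx hy
  | hom j k a ha =>
    rw [G.proj_of_mem _ ha]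
    split_ifs with h
    · have h' : j = r := h
      subst h'
      exact Submodule.mem_iSup_of_mem k ha
    · exact Submodule.zero_mem _

-- In a product of two elements of the row algebra at `p`, the left factor contributes only through
-- its component in `(p, p)`. Idempotence therefore lets every homogeneous element be written with
-- diagonal left factors.
variable {G} in
theorem Idempotent.mem_span_row (hG : G.Idempotent) {p q : J} {u : A} (hu : u ∈ G.grade p q) :
    u ∈ Submodule.span ℂ {x | ∃ a ∈ G.grade p p, ∃ b : A, x = a * b} := by
  have h1 : u ∈ mulSpan (rowPart G.grade p) (rowPart G.grade p) := by
    rw [hG.2 p]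
    exact Submodule.mem_iSup_of_mem q hu
  refine Submodule.span_le.2 ?_ h1
  rintro x ⟨a, ha, b, hb, rfl⟩
  refine Submodule.iSup_induction _ (motive := fun a => a * b ∈ Submodule.span ℂ
    {x | ∃ a ∈ G.grade p p, ∃ b : A, x = a * b}) ha ?_ (by simp)
    (fun x y hx hy => by rw [add_mul]; exact Submodule.add_mem _ hx hy)
  intro k a ha
  by_cases hk : k = p
  · subst hk
    exact Submodule.subset_span ⟨a, ha, b, rfl⟩
  · have h0 : a * b = 0 := by
      refine Submodule.iSup_induction _ (motive := fun b => a * b = 0) hb ?_ (mul_zero _)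
        (fun x y hx hy => by rw [mul_add, hx, hy, add_zero])
      intro l b hb
      exact G.mul_eq_zero hk a ha b hb
    rw [h0]
    exact Submodule.zero_mem _

variable {G} in
theorem Idempotent.mem_span_col (hG : G.Idempotent) {p q : J} {u : A} (hu : u ∈ G.grade p q) :
    u ∈ Submodule.span ℂ {x | ∃ a : A, ∃ b ∈ G.grade q q, x = a * b} := by
  have h1 : u ∈ mulSpan (colPart G.grade q) (colPart G.grade q) := by
    rw [hG.1 q]
    exact Submodule.mem_iSup_of_mem p hu
  refine Submodule.span_le.2 ?_ h1
  rintro x ⟨a, ha, b, hb, rfl⟩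
  refine Submodule.iSup_induction _ (motive := fun b => a * b ∈ Submodule.span ℂ
    {x | ∃ a : A, ∃ b ∈ G.grade q q, x = a * b}) hb ?_ (by simp)
    (fun x y hx hy => by rw [mul_add]; exact Submodule.add_mem _ hx hy)
  intro k b hb
  by_cases hk : q = k
  · subst hk
    exact Submodule.subset_span ⟨a, b, hb, rfl⟩
  · have h0 : a * b = 0 := by
      refine Submodule.iSup_induction _ (motive := fun a => a * b = 0) ha ?_ (zero_mul _)
        (fun x y hx hy => by rw [add_mul, hx, hy, add_zero])
      intro l a ha
      exact G.mul_eq_zero hk a ha b hb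
    rw [h0]
    exact Submodule.zero_mem _

variable [IsScalarTower ℂ A A] [SMulCommClass ℂ A A]

/-- Multiplying by base units cuts the vanishing condition down to each column or row, where the
graded hypothesis applies. -/
theorem Nondegenerate.isNondeg {G : PartialAlgebra J A} (hG : G.Nondegenerate) : IsNondeg A where
  left a h := by
    refine (G.partition_proj fun p => p.2).eq_zero fun s => ?_
    refine hG.1 s _ (G.proj_mem_colPart s a) fun b _ => ?_
    exact ((G.unit {s}).mul_left_eq a b).symm.trans (h _)
  right a h := by
    refine (G.partition_proj fun p => p.1).eq_zero fun s => ?_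
    refine hG.2 s _ (G.proj_mem_rowPart s a) fun b _ => ?_
    exact ((G.unit {s}).mul_left_eq b a).trans (h _)

end PartialAlgebra

end Gradings

/-! ### Vanishing properties of the comultiplication -/

section Vanishing

local infix:70 " ⊠ " => TensorProduct.map

namespace PartialAlgebra

variable {I A : Type*} [NonUnitalRing A] [Module ℂ A] [IsScalarTower ℂ A A] [SMulCommClass ℂ A A]
  (G : PartialAlgebra (I × I) A)

open scoped Classical in
theorem unitUp_left_of_mem {j k : I × I} {a : A} (ha : a ∈ G.grade j k) (r : I) :
    (G.unitUp r).left a = if j.1 = r then a else 0 := G.proj_of_mem _ ha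

open scoped Classical in
theorem unitLow_left_of_mem {j k : I × I} {a : A} (ha : a ∈ G.grade j k) (r : I) :
    (G.unitLow r).left a = if j.2 = r then a else 0 := G.proj_of_mem _ ha

open scoped Classical in
theorem unitUp_right_of_mem {j k : I × I} {a : A} (ha : a ∈ G.grade j k) (r : I) :
    (G.unitUp r).right a = if k.1 = r then a else 0 := G.proj_of_mem _ ha

open scoped Classical in
theorem unitLow_right_of_mem {j k : I × I} {a : A} (ha : a ∈ G.grade j k) (r : I) :
    (G.unitLow r).right a = if k.2 = r then a else 0 := G.proj_of_mem _ ha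

theorem partition_unitUp_left : Partition fun r => (G.unitUp r).left :=
  G.partition_proj fun p => p.1.1

theorem partition_unitLow_left : Partition fun r => (G.unitLow r).left :=
  G.partition_proj fun p => p.1.2

theorem partition_unitUp_right : Partition fun r => (G.unitUp r).right :=
  G.partition_proj fun p => p.2.1

theorem partition_unitLow_right : Partition fun r => (G.unitLow r).right :=
  G.partition_proj fun p => p.2.2

open scoped Classical in
theorem E_left_tmul {j k j' k' : I × I} {a b : A} (ha : a ∈ G.grade j k) (hb : b ∈ G.grade j' k') :
    G.E.left (a ⊗ₜ b) = if j.2 = j'.1 then a ⊗ₜ b else 0 :=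
  (G.tensor G).proj_of_mem (r := (j, j')) (s := (k, k')) _ (tmul_mem_tensorSub ha hb)

open scoped Classical in
theorem E_right_tmul {j k j' k' : I × I} {a b : A} (ha : a ∈ G.grade j k)
    (hb : b ∈ G.grade j' k') : G.E.right (a ⊗ₜ b) = if k.2 = k'.1 then a ⊗ₜ b else 0 :=
  (G.tensor G).proj_of_mem (r := (j, j')) (s := (k, k')) _ (tmul_mem_tensorSub ha hb)

theorem E₃_left_tmul_eq_zero {j k j' k' j'' k'' : I × I} {a b c : A} (ha : a ∈ G.grade j k)
    (hb : b ∈ G.grade j' k') (hc : c ∈ G.grade j'' k'') (h : ¬ (j.2 = j'.1 ∧ j'.2 = j''.1)) :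
    G.E₃.left (a ⊗ₜ b ⊗ₜ c) = 0 :=
  (((G.tensor G).tensor G).proj_of_mem (r := ((j, j'), j'')) (s := ((k, k'), k'')) _
    (tmul_mem_tensorSub (tmul_mem_tensorSub ha hb) hc)).trans (if_neg h)

theorem E₃_right_tmul_eq_zero {j k j' k' j'' k'' : I × I} {a b c : A} (ha : a ∈ G.grade j k)
    (hb : b ∈ G.grade j' k') (hc : c ∈ G.grade j'' k'') (h : ¬ (k.2 = k'.1 ∧ k'.2 = k''.1)) :
    G.E₃.right (a ⊗ₜ b ⊗ₜ c) = 0 :=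
  (((G.tensor G).tensor G).proj_of_mem (r := ((j, j'), j'')) (s := ((k, k'), k'')) _
    (tmul_mem_tensorSub (tmul_mem_tensorSub ha hb) hc)).trans (if_neg h)

theorem E_left_idem (z : A ⊗[ℂ] A) : G.E.left (G.E.left z) = G.E.left z :=
  (G.tensor G).proj_idem _ z

theorem E_right_idem (z : A ⊗[ℂ] A) : G.E.right (G.E.right z) = G.E.right z :=
  (G.tensor G).proj_idem _ z

theorem unitLow_E_left (r : I) (z : A ⊗[ℂ] A) :
    ((G.unitLow r).left ⊠ LinearMap.id) (G.E.left z) =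
      (LinearMap.id ⊠ (G.unitUp r).left) (G.E.left z) := by
  classical
  refine G.hom_ext_tensor (f := ((G.unitLow r).left ⊠ LinearMap.id) ∘ₗ G.E.left)
    (g := (LinearMap.id ⊠ (G.unitUp r).left) ∘ₗ G.E.left) (fun j k j' k' a ha b hb => ?_) z
  simp only [LinearMap.comp_apply, G.E_left_tmul ha hb]
  split_ifs with h
  · simp only [TensorProduct.map_tmul, G.unitLow_left_of_mem ha, G.unitUp_left_of_mem hb, h]
    split_ifs <;> simp
  · simp

theorem E_unitLow_left (r : I) (z : A ⊗[ℂ] A) :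
    G.E.left (((G.unitLow r).left ⊠ LinearMap.id) z) =
      G.E.left ((LinearMap.id ⊠ (G.unitUp r).left) z) := by
  classical
  refine G.hom_ext_tensor (f := G.E.left ∘ₗ ((G.unitLow r).left ⊠ LinearMap.id))
    (g := G.E.left ∘ₗ (LinearMap.id ⊠ (G.unitUp r).left)) (fun j k j' k' a ha b hb => ?_) z
  simp only [LinearMap.comp_apply, TensorProduct.map_tmul, G.unitLow_left_of_mem ha,
    G.unitUp_left_of_mem hb, LinearMap.id_apply]
  by_cases h1 : j.2 = r <;> by_cases h2 : j'.1 = r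
  · simp [h1, h2]
  · rw [if_pos h1, if_neg h2, G.E_left_tmul ha hb, if_neg (fun h => h2 (h.symm.trans h1))]
    simp
  · rw [if_neg h1, if_pos h2, G.E_left_tmul ha hb, if_neg (fun h => h1 (h.trans h2))]
    simp
  · simp [h1, h2]

end PartialAlgebra

theorem tmul_mem_of_mem_span {V : Type*} [AddCommGroup V] [Module ℂ V] {S T : Set V} {u v : V} 
    (hu : u ∈ Submodule.span ℂ S) (hv : v ∈ Submodule.span ℂ T) {W : Submodule ℂ (V ⊗[ℂ] V)}
    (hW : ∀ x ∈ S, ∀ y ∈ T, x ⊗ₜ y ∈ W) : u ⊗ₜ v ∈ W := by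
  induction hu using Submodule.span_induction with
  | zero => simp
  | add x y _ _ hx hy => rw [TensorProduct.add_tmul]; exact Submodule.add_mem _ hx hy
  | smul c x _ hx => rw [← TensorProduct.smul_tmul']; exact Submodule.smul_mem _ _ hx
  | mem x hx =>
    induction hv using Submodule.span_induction with
    | zero => simp
    | add x y _ _ hx hy => rw [TensorProduct.tmul_add]; exact Submodule.add_mem _ hx hy
    | smul c x _ hx => rw [TensorProduct.tmul_smul]; exact Submodule.smul_mem _ _ hx
    | mem y hy => exact hW x hx y hy

namespace RegularPartialMultiplierBialgebra

variable {I A : Type*} [NonUnitalRing A] [Module ℂ A] [IsScalarTower ℂ A A] [SMulCommClass ℂ A A]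
  (H : RegularPartialMultiplierBialgebra I A)

theorem isNondeg (H : RegularPartialMultiplierBialgebra I A) : IsNondeg A :=
  PartialAlgebra.Nondegenerate.isNondeg H.nondegenerate

theorem isNondeg_tensor (H : RegularPartialMultiplierBialgebra I A) : IsNondeg (A ⊗[ℂ] A) :=
  IsNondeg.tensor H.isNondeg H.isNondeg

theorem isNondeg_tensor₃ (H : RegularPartialMultiplierBialgebra I A) :
    IsNondeg ((A ⊗[ℂ] A) ⊗[ℂ] A) :=
  IsNondeg.tensor H.isNondeg_tensor H.isNondeg

theorem Δ_left_mul (a b : A) (z : A ⊗[ℂ] A) :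
    (H.Δ (a * b)).left z = (H.Δ a).left ((H.Δ b).left z) := by
  rw [map_mul, Multiplier.mul_left]

theorem Δ_right_mul (a b : A) (z : A ⊗[ℂ] A) :
    (H.Δ (a * b)).right z = (H.Δ b).right ((H.Δ a).right z) := by
  rw [map_mul, Multiplier.mul_right]

theorem E_Δ_E_left (a : A) (z : A ⊗[ℂ] A) :
    H.G.E.left ((H.Δ a).left (H.G.E.left z)) = (H.Δ a).left z :=
  LinearMap.congr_fun (congrArg Multiplier.left (H.comul.corner a)) z

theorem E_Δ_E_right (a : A) (z : A ⊗[ℂ] A) :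
    H.G.E.right ((H.Δ a).right (H.G.E.right z)) = (H.Δ a).right z :=
  LinearMap.congr_fun (congrArg Multiplier.right (H.comul.corner a)) z

theorem E_Δ_left (a : A) (z : A ⊗[ℂ] A) : H.G.E.left ((H.Δ a).left z) = (H.Δ a).left z := by
  rw [← H.E_Δ_E_left a z, H.G.E_left_idem]

theorem Δ_E_left (a : A) (z : A ⊗[ℂ] A) : (H.Δ a).left (H.G.E.left z) = (H.Δ a).left z := by
  rw [← H.E_Δ_E_left a (H.G.E.left z), H.G.E_left_idem, H.E_Δ_E_left]

theorem Δ_E_right (a : A) (z : A ⊗[ℂ] A) : (H.Δ a).right (H.G.E.right z) = (H.Δ a).right z := by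
  rw [← H.E_Δ_E_right a (H.G.E.right z), H.G.E_right_idem, H.E_Δ_E_right]

theorem mul_rowPart_eq_zero {j k l : I × I} (h : k ≠ l) {a b : A} (ha : a ∈ H.G.grade j k)
    (hb : b ∈ rowPart H.G.grade l) : a * b = 0 :=
  Submodule.iSup_induction _ (motive := fun b => a * b = 0) hb
    (fun m b hb => H.G.mul_eq_zero h a ha b hb) (mul_zero _)
    (fun x y hx hy => by rw [mul_add, hx, hy, add_zero])

theorem colPart_mul_eq_zero {j k l : I × I} (h : k ≠ j) {a b : A} (ha : a ∈ H.G.grade j l)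
    (hb : b ∈ colPart H.G.grade k) : b * a = 0 :=
  Submodule.iSup_induction _ (motive := fun b => b * a = 0) hb
    (fun m b hb => H.G.mul_eq_zero h b hb a ha) (zero_mul _)
    (fun x y hx hy => by rw [add_mul, hx, hy, add_zero])

theorem tmul_mem_tensorIGrade {p₁ q₁ p₂ q₂ : I × I} (h : p₁.2 = p₂.1) (h' : q₁.2 = q₂.1)
    {x y : A} (hx : x ∈ H.G.grade p₁ q₁) (hy : y ∈ H.G.grade p₂ q₂) :
    x ⊗ₜ[ℂ] y ∈ H.G.tensorIGrade (p₁.1, p₂.2) (q₁.1, q₂.2) := by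
  obtain ⟨r, t⟩ := p₁
  obtain ⟨t', v⟩ := p₂
  obtain ⟨s, u⟩ := q₁
  obtain ⟨u', w⟩ := q₂
  obtain rfl : t = t' := h
  obtain rfl : u = u' := h'
  exact Submodule.mem_iSup_of_mem t (Submodule.mem_iSup_of_mem u (tmul_mem_tensorSub hx hy))

theorem mem_tensorI {j k : I × I} {z : A ⊗[ℂ] A} (hz : z ∈ H.G.tensorIGrade j k) :
    z ∈ H.G.tensorI :=
  Submodule.mem_iSup_of_mem j (Submodule.mem_iSup_of_mem k hz)

/-- Elements of `E (A ⊗ A)` are sums of products `z w` with `z` in the diagonal components of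
`A ⊗^I A`. -/
theorem tmul_ext_left {p₁ q₁ p₂ q₂ : I × I} (h : p₁.2 = p₂.1) {u v : A}
    (hu : u ∈ H.G.grade p₁ q₁) (hv : v ∈ H.G.grade p₂ q₂) {X : Type*} [AddCommMonoid X]
    [Module ℂ X] {f g : A ⊗[ℂ] A →ₗ[ℂ] X}
    (hfg : ∀ z ∈ H.G.tensorIGrade (p₁.1, p₂.2) (p₁.1, p₂.2), ∀ w, f (z * w) = g (z * w)) :
    f (u ⊗ₜ v) = g (u ⊗ₜ v) := by
  refine tmul_mem_of_mem_span (W := LinearMap.eqLocus f g)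
    (PartialAlgebra.Idempotent.mem_span_row H.idempotent hu)
    (PartialAlgebra.Idempotent.mem_span_row H.idempotent hv) ?_
  rintro _ ⟨a, ha, b, rfl⟩ _ ⟨c, hc, d, rfl⟩
  rw [← Algebra.TensorProduct.tmul_mul_tmul]
  exact hfg _ (H.tmul_mem_tensorIGrade h h ha hc) _

theorem tmul_ext_right {p₁ q₁ p₂ q₂ : I × I} (h : q₁.2 = q₂.1) {u v : A}
    (hu : u ∈ H.G.grade p₁ q₁) (hv : v ∈ H.G.grade p₂ q₂) {X : Type*} [AddCommMonoid X]
    [Module ℂ X] {f g : A ⊗[ℂ] A →ₗ[ℂ] X}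
    (hfg : ∀ z ∈ H.G.tensorIGrade (q₁.1, q₂.2) (q₁.1, q₂.2), ∀ w, f (w * z) = g (w * z)) :
    f (u ⊗ₜ v) = g (u ⊗ₜ v) := by
  refine tmul_mem_of_mem_span (W := LinearMap.eqLocus f g)
    (PartialAlgebra.Idempotent.mem_span_col H.idempotent hu)
    (PartialAlgebra.Idempotent.mem_span_col H.idempotent hv) ?_
  rintro _ ⟨a, b, hb, rfl⟩ _ ⟨c, d, hd, rfl⟩
  rw [← Algebra.TensorProduct.tmul_mul_tmul]
  exact hfg _ (H.tmul_mem_tensorIGrade h h hb hd) _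

theorem mem_span_Δ_left {l : I × I} {z : A ⊗[ℂ] A} (hz : z ∈ H.G.tensorIGrade l l) :
    z ∈ Submodule.span ℂ {x | ∃ a ∈ rowPart H.G.grade l, ∃ w, x = (H.Δ a).left w} := by
  have h1 : z ∈ rowPart H.G.tensorIGrade l := Submodule.mem_iSup_of_mem l hz
  rw [← H.comul.morphism_left l] at h1
  refine Submodule.span_mono ?_ h1
  rintro x ⟨a, ha, w, -, rfl⟩
  exact ⟨a, ha, w, rfl⟩

theorem mem_span_Δ_right {l : I × I} {z : A ⊗[ℂ] A} (hz : z ∈ H.G.tensorIGrade l l) :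
    z ∈ Submodule.span ℂ {x | ∃ a ∈ colPart H.G.grade l, ∃ w, x = (H.Δ a).right w} := by
  have h1 : z ∈ colPart H.G.tensorIGrade l := Submodule.mem_iSup_of_mem l hz
  rw [← H.comul.morphism_right l] at h1
  refine Submodule.span_mono ?_ h1
  rintro x ⟨w, -, a, ha, rfl⟩
  exact ⟨a, ha, w, rfl⟩

/-- If the middle indices differ, `E` kills `u ⊗ v`. Otherwise `u ⊗ v` is a combination of products
`zw` with `z` in a diagonal component of `A ⊗^I A`. By the morphism axiom `z` is a combination of
`Δ(b)w'` with `b` in the matching row, and `ab = 0` when the outer indices do not fit. -/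
theorem Δ_left_eq_zero {j k p₁ q₁ p₂ q₂ : I × I} {a u v : A} (ha : a ∈ H.G.grade j k)
    (hu : u ∈ H.G.grade p₁ q₁) (hv : v ∈ H.G.grade p₂ q₂)
    (h : ¬ (p₁.1 = k.1 ∧ p₂.2 = k.2 ∧ p₁.2 = p₂.1)) : (H.Δ a).left (u ⊗ₜ v) = 0 := by
  classical
  by_cases hE : p₁.2 = p₂.1
  · refine H.tmul_ext_left hE hu hv (g := 0) fun z hz w => ?_
    have h0 : (H.Δ a).left z = 0 := by
      refine Submodule.span_le (p := LinearMap.ker (H.Δ a).left).2 ?_ (H.mem_span_Δ_left hz)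
      rintro _ ⟨b, hb, w, rfl⟩
      rw [SetLike.mem_coe, LinearMap.mem_ker, ← H.Δ_left_mul, H.mul_rowPart_eq_zero _ ha hb]
      · rw [map_zero]; rfl
      · rintro rfl
        exact h ⟨rfl, rfl, hE⟩
    rw [Multiplier.left_mul H.isNondeg_tensor, h0, zero_mul, LinearMap.zero_apply]
  · rw [← H.Δ_E_left, H.G.E_left_tmul hu hv, if_neg hE, map_zero]

theorem Δ_right_eq_zero {j k p₁ q₁ p₂ q₂ : I × I} {a u v : A} (ha : a ∈ H.G.grade j k)
    (hu : u ∈ H.G.grade p₁ q₁) (hv : v ∈ H.G.grade p₂ q₂)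
    (h : ¬ (q₁.1 = j.1 ∧ q₂.2 = j.2 ∧ q₁.2 = q₂.1)) : (H.Δ a).right (u ⊗ₜ v) = 0 := by
  classical
  by_cases hE : q₁.2 = q₂.1
  · refine H.tmul_ext_right hE hu hv (g := 0) fun z hz w => ?_
    have h0 : (H.Δ a).right z = 0 := by
      refine Submodule.span_le (p := LinearMap.ker (H.Δ a).right).2 ?_ (H.mem_span_Δ_right hz)
      rintro _ ⟨b, hb, w, rfl⟩
      rw [SetLike.mem_coe, LinearMap.mem_ker, ← H.Δ_right_mul, H.colPart_mul_eq_zero _ ha hb]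
      · rw [map_zero]; rfl
      · rintro rfl
        exact h ⟨rfl, rfl, hE⟩
    rw [Multiplier.right_mul H.isNondeg_tensor, h0, mul_zero, LinearMap.zero_apply]
  · rw [← H.Δ_E_right, H.G.E_right_tmul hu hv, if_neg hE, map_zero]

end RegularPartialMultiplierBialgebra

end Vanishing

/-! ### Canonical maps and counit -/

section CanonicalMaps

local infix:70 " ⊠ " => TensorProduct.map

namespace PartialAlgebra

variable {I A : Type*} [NonUnitalRing A] [Module ℂ A] (G : PartialAlgebra (I × I) A)

theorem grade_le_range_proj {P : Set ((I × I) × (I × I))} {j k : I × I} (h : (j, k) ∈ P) :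
    G.grade j k ≤ LinearMap.range (G.proj P) := fun a ha =>
  ⟨a, by rw [G.proj_of_mem _ ha, if_pos h]⟩

theorem range_proj_le {P : Set ((I × I) × (I × I))} {W : Submodule ℂ A}
    (h : ∀ j k, (j, k) ∈ P → G.grade j k ≤ W) : LinearMap.range (G.proj P) ≤ W := by
  classical
  rintro _ ⟨a, rfl⟩
  induction a using G.induction with
  | zero => simp
  | add x y hx hy => rw [map_add]; exact W.add_mem hx hy
  | hom j k a ha =>
    rw [G.proj_of_mem _ ha]
    split_ifs with hP
    · exact h j k hP ha
    · exact W.zero_mem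

variable [IsScalarTower ℂ A A] [SMulCommClass ℂ A A]

theorem upLeft_eq_range (r : I) : G.upLeft r = LinearMap.range (G.unitUp r).left := by
  refine le_antisymm (iSup₂_le fun t k => G.grade_le_range_proj rfl) (G.range_proj_le ?_)
  rintro ⟨r', t⟩ k rfl
  exact le_iSup₂_of_le t k le_rfl

theorem lowLeft_eq_range (r : I) : G.lowLeft r = LinearMap.range (G.unitLow r).left := by
  refine le_antisymm (iSup₂_le fun t k => G.grade_le_range_proj rfl) (G.range_proj_le ?_)
  rintro ⟨t, r'⟩ k rfl
  exact le_iSup₂_of_le t k le_rfl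

theorem upRight_eq_range (r : I) : G.upRight r = LinearMap.range (G.unitUp r).right := by
  refine le_antisymm (iSup₂_le fun j u => G.grade_le_range_proj rfl) (G.range_proj_le ?_)
  rintro j ⟨r', u⟩ rfl
  exact le_iSup₂_of_le j u le_rfl

theorem lowRight_eq_range (r : I) : G.lowRight r = LinearMap.range (G.unitLow r).right := by
  refine le_antisymm (iSup₂_le fun j u => G.grade_le_range_proj rfl) (G.range_proj_le ?_)
  rintro j ⟨u, r'⟩ rfl
  exact le_iSup₂_of_le j u le_rfl

end PartialAlgebra

/-! ### Behaviour of `Δ` with respect to units, canonical maps with values in `A ⊗ A`, and the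
counit. -/

namespace RegularPartialMultiplierBialgebra

variable {I A : Type*} [NonUnitalRing A] [Module ℂ A] [IsScalarTower ℂ A A] [SMulCommClass ℂ A A]
  (H : RegularPartialMultiplierBialgebra I A)

/-- `a ↦ (z ↦ Δ(a) z)`. -/
def ΔL : A →ₗ[ℂ] A ⊗[ℂ] A →ₗ[ℂ] A ⊗[ℂ] A := Multiplier.leftHom ∘ₗ (H.Δ : A →ₗ[ℂ] _)

/-- `a ↦ (z ↦ z Δ(a))`. -/
def ΔR : A →ₗ[ℂ] A ⊗[ℂ] A →ₗ[ℂ] A ⊗[ℂ] A := Multiplier.rightHom ∘ₗ (H.Δ : A →ₗ[ℂ] _)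

theorem ΔL_apply (a : A) (z : A ⊗[ℂ] A) : H.ΔL a z = (H.Δ a).left z := rfl

theorem ΔR_apply (a : A) (z : A ⊗[ℂ] A) : H.ΔR a z = (H.Δ a).right z := rfl

theorem ext_grade {X : Type*} [AddCommGroup X] [Module ℂ X]
    {f g : A →ₗ[ℂ] A ⊗[ℂ] A →ₗ[ℂ] X}
    (h : ∀ j k, ∀ a ∈ H.G.grade j k, ∀ p₁ q₁, ∀ u ∈ H.G.grade p₁ q₁, ∀ p₂ q₂,
      ∀ v ∈ H.G.grade p₂ q₂, f a (u ⊗ₜ v) = g a (u ⊗ₜ v)) (a : A) (z : A ⊗[ℂ] A) :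
    f a z = g a z := by
  induction a using H.G.induction with
  | zero => simp
  | add x y hx hy => simp only [map_add, LinearMap.add_apply, hx, hy]
  | hom j k a ha =>
    exact H.G.hom_ext_tensor (fun p₁ q₁ p₂ q₂ u hu v hv => h j k a ha p₁ q₁ u hu p₂ q₂ v hv) z

theorem ΔL_unitUp_right (r : I) (a : A) (z : A ⊗[ℂ] A) :
    H.ΔL ((H.G.unitUp r).right a) z = H.ΔL a (((H.G.unitUp r).left ⊠ LinearMap.id) z) := by
  classical
  refine H.ext_grade (f := H.ΔL ∘ₗ (H.G.unitUp r).right)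
    (g := H.ΔL.compl₂ ((H.G.unitUp r).left ⊠ LinearMap.id))
    (fun j k a ha p₁ q₁ u hu p₂ q₂ v hv => ?_) a z
  simp only [LinearMap.comp_apply, LinearMap.compl₂_apply, TensorProduct.map_tmul,
    H.G.unitUp_right_of_mem ha, H.G.unitUp_left_of_mem hu, LinearMap.id_apply]
  by_cases h1 : k.1 = r <;> by_cases h2 : p₁.1 = r
  · rw [if_pos h1, if_pos h2]
  · rw [if_pos h1, if_neg h2, ΔL_apply,
      H.Δ_left_eq_zero ha hu hv (by rintro ⟨h, -⟩; exact h2 (h.trans h1))]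
    simp
  · rw [if_neg h1, if_pos h2, ΔL_apply, ΔL_apply,
      H.Δ_left_eq_zero ha hu hv (by rintro ⟨h, -⟩; exact h1 (h.symm.trans h2)), map_zero]
    rfl
  · simp [h1, h2]

theorem ΔL_unitLow_right (r : I) (a : A) (z : A ⊗[ℂ] A) :
    H.ΔL ((H.G.unitLow r).right a) z = H.ΔL a ((LinearMap.id ⊠ (H.G.unitLow r).left) z) := by
  classical
  refine H.ext_grade (f := H.ΔL ∘ₗ (H.G.unitLow r).right)
    (g := H.ΔL.compl₂ (LinearMap.id ⊠ (H.G.unitLow r).left))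
    (fun j k a ha p₁ q₁ u hu p₂ q₂ v hv => ?_) a z
  simp only [LinearMap.comp_apply, LinearMap.compl₂_apply, TensorProduct.map_tmul,
    H.G.unitLow_right_of_mem ha, H.G.unitLow_left_of_mem hv, LinearMap.id_apply]
  by_cases h1 : k.2 = r <;> by_cases h2 : p₂.2 = r
  · rw [if_pos h1, if_pos h2]
  · rw [if_pos h1, if_neg h2, ΔL_apply,
      H.Δ_left_eq_zero ha hu hv (by rintro ⟨-, h, -⟩; exact h2 (h.trans h1))]
    simp
  · rw [if_neg h1, if_pos h2, ΔL_apply, ΔL_apply,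
      H.Δ_left_eq_zero ha hu hv (by rintro ⟨-, h, -⟩; exact h1 (h.symm.trans h2)), map_zero]
    rfl
  · simp [h1, h2]

theorem ΔR_unitUp_left (r : I) (a : A) (z : A ⊗[ℂ] A) :
    H.ΔR ((H.G.unitUp r).left a) z = H.ΔR a (((H.G.unitUp r).right ⊠ LinearMap.id) z) := by
  classical
  refine H.ext_grade (f := H.ΔR ∘ₗ (H.G.unitUp r).left)
    (g := H.ΔR.compl₂ ((H.G.unitUp r).right ⊠ LinearMap.id))
    (fun j k a ha p₁ q₁ u hu p₂ q₂ v hv => ?_) a z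
  simp only [LinearMap.comp_apply, LinearMap.compl₂_apply, TensorProduct.map_tmul,
    H.G.unitUp_left_of_mem ha, H.G.unitUp_right_of_mem hu, LinearMap.id_apply]
  by_cases h1 : j.1 = r <;> by_cases h2 : q₁.1 = r
  · rw [if_pos h1, if_pos h2]
  · rw [if_pos h1, if_neg h2, ΔR_apply,
      H.Δ_right_eq_zero ha hu hv (by rintro ⟨h, -⟩; exact h2 (h.trans h1))]
    simp
  · rw [if_neg h1, if_pos h2, ΔR_apply, ΔR_apply,
      H.Δ_right_eq_zero ha hu hv (by rintro ⟨h, -⟩; exact h1 (h.symm.trans h2)), map_zero]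
    rfl
  · simp [h1, h2]

theorem ΔR_unitLow_left (r : I) (a : A) (z : A ⊗[ℂ] A) :
    H.ΔR ((H.G.unitLow r).left a) z = H.ΔR a ((LinearMap.id ⊠ (H.G.unitLow r).right) z) := by
  classical
  refine H.ext_grade (f := H.ΔR ∘ₗ (H.G.unitLow r).left)
    (g := H.ΔR.compl₂ (LinearMap.id ⊠ (H.G.unitLow r).right))
    (fun j k a ha p₁ q₁ u hu p₂ q₂ v hv => ?_) a z
  simp only [LinearMap.comp_apply, LinearMap.compl₂_apply, TensorProduct.map_tmul,
    H.G.unitLow_left_of_mem ha, H.G.unitLow_right_of_mem hv, LinearMap.id_apply]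
  by_cases h1 : j.2 = r <;> by_cases h2 : q₂.2 = r
  · rw [if_pos h1, if_pos h2]
  · rw [if_pos h1, if_neg h2, ΔR_apply,
      H.Δ_right_eq_zero ha hu hv (by rintro ⟨-, h, -⟩; exact h2 (h.trans h1))]
    simp
  · rw [if_neg h1, if_pos h2, ΔR_apply, ΔR_apply,
      H.Δ_right_eq_zero ha hu hv (by rintro ⟨-, h, -⟩; exact h1 (h.symm.trans h2)), map_zero]
    rfl
  · simp [h1, h2]

/-- Units on the left of `a` are controlled by the right action of `Δ(a)`; pairing with an arbitrary
`w` carries the rule over to the left action. -/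
theorem ΔL_unitUp_left (r : I) (a : A) (z : A ⊗[ℂ] A) :
    H.ΔL ((H.G.unitUp r).left a) z = ((H.G.unitUp r).left ⊠ LinearMap.id) (H.ΔL a z) := by
  apply H.isNondeg_tensor.eq_of_mul_left
  intro w
  rw [ΔL_apply, Multiplier.mul_left_eq, ← ΔR_apply, ΔR_unitUp_left, ← Multiplier.tmul_one_left,
    ← Multiplier.tmul_one_right, Multiplier.mul_left_eq, ΔL_apply,
    Multiplier.mul_left_eq, ΔR_apply]

theorem ΔL_unitLow_left (r : I) (a : A) (z : A ⊗[ℂ] A) :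
    H.ΔL ((H.G.unitLow r).left a) z = (LinearMap.id ⊠ (H.G.unitLow r).left) (H.ΔL a z) := by
  apply H.isNondeg_tensor.eq_of_mul_left
  intro w
  rw [ΔL_apply, Multiplier.mul_left_eq, ← ΔR_apply, ΔR_unitLow_left, ← Multiplier.one_tmul_left,
    ← Multiplier.one_tmul_right, Multiplier.mul_left_eq, ΔL_apply,
    Multiplier.mul_left_eq, ΔR_apply]

theorem unitLow_ΔL (r : I) (a : A) (z : A ⊗[ℂ] A) :
    ((H.G.unitLow r).left ⊠ LinearMap.id) (H.ΔL a z) =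
      (LinearMap.id ⊠ (H.G.unitUp r).left) (H.ΔL a z) := by
  rw [ΔL_apply, ← H.E_Δ_left, H.G.unitLow_E_left]

theorem ΔL_unitLow (r : I) (a : A) (z : A ⊗[ℂ] A) :
    H.ΔL a (((H.G.unitLow r).left ⊠ LinearMap.id) z) =
      H.ΔL a ((LinearMap.id ⊠ (H.G.unitUp r).left) z) := by
  rw [ΔL_apply, ← H.Δ_E_left, H.G.E_unitLow_left, H.Δ_E_left, ΔL_apply]

theorem incl_left_eq {B : Type*} [NonUnitalRing B] [Module ℂ B] [IsScalarTower ℂ B B]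
    [SMulCommClass ℂ B B] {z : B} {m : Multiplier B} (h : Multiplier.incl B z = m) (w : B) :
    z * w = m.left w := by
  rw [← h, Multiplier.incl_left]

theorem incl_right_eq {B : Type*} [NonUnitalRing B] [Module ℂ B] [IsScalarTower ℂ B B]
    [SMulCommClass ℂ B B] {z : B} {m : Multiplier B} (h : Multiplier.incl B z = m) (w : B) :
    w * z = m.right w := by
  rw [← h, Multiplier.incl_right]

theorem range_induction {f : A ⊗[ℂ] A →ₗ[ℂ] Multiplier (A ⊗[ℂ] A)}
    {W : Submodule ℂ (Multiplier (A ⊗[ℂ] A))} (h : ∀ a b, f (a ⊗ₜ b) ∈ W) (z : A ⊗[ℂ] A) :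
    f z ∈ W := by
  induction z using TensorProduct.induction_on with
  | zero => simp
  | add x y hx hy => rw [map_add]; exact W.add_mem hx hy
  | tmul a b => exact h a b

theorem flip_mul (m n : Multiplier (A ⊗[ℂ] A)) :
    Multiplier.flip A (m * n) = Multiplier.flip A m * Multiplier.flip A n := by
  apply Subtype.ext
  refine Prod.ext (LinearMap.ext fun z => ?_)
    (MulOpposite.unop_injective (LinearMap.ext fun z => ?_))
  · change (Multiplier.flip A (m * n)).left z =
      (Multiplier.flip A m * Multiplier.flip A n).left z
    simp [Multiplier.flip_left]
  · change (Multiplier.flip A (m * n)).right z =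
      (Multiplier.flip A m * Multiplier.flip A n).right z
    simp [Multiplier.flip_right]

theorem flip_tmul (m n : Multiplier A) :
    Multiplier.flip A (Multiplier.tmul A A m n) = Multiplier.tmul A A n m := by
  apply Subtype.ext
  refine Prod.ext (LinearMap.ext fun z => ?_)
    (MulOpposite.unop_injective (LinearMap.ext fun z => ?_))
  · change (Multiplier.flip A (Multiplier.tmul A A m n)).left z = (Multiplier.tmul A A n m).left z
    simp only [Multiplier.flip_left, Multiplier.tmul_left]
    rw [← TensorProduct.map_comm]
    simp
  · change (Multiplier.flip A (Multiplier.tmul A A m n)).right z = (Multiplier.tmul A A n m).right z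
    simp only [Multiplier.flip_right, Multiplier.tmul_right]
    rw [← TensorProduct.map_comm]
    simp

theorem flip_incl (z : A ⊗[ℂ] A) :
    Multiplier.flip A (Multiplier.incl _ z) = Multiplier.incl _ (TensorProduct.comm ℂ A A z) := by
  have key : ∀ x y : A ⊗[ℂ] A, TensorProduct.comm ℂ A A (x * TensorProduct.comm ℂ A A y) =
      TensorProduct.comm ℂ A A x * y := by
    intro x y
    induction x using TensorProduct.induction_on with
    | zero => simp
    | add x₁ x₂ h₁ h₂ => simp only [add_mul, map_add, h₁, h₂]
    | tmul a b =>
      induction y using TensorProduct.induction_on with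
      | zero => simp
      | add y₁ y₂ h₁ h₂ => simp only [mul_add, map_add, h₁, h₂]
      | tmul c d => simp
  have key' : ∀ x y : A ⊗[ℂ] A, TensorProduct.comm ℂ A A (TensorProduct.comm ℂ A A y * x) =
      y * TensorProduct.comm ℂ A A x := by
    intro x y
    induction x using TensorProduct.induction_on with
    | zero => simp
    | add x₁ x₂ h₁ h₂ => simp only [mul_add, map_add, h₁, h₂]
    | tmul a b =>
      induction y using TensorProduct.induction_on with
      | zero => simp
      | add y₁ y₂ h₁ h₂ => simp only [add_mul, map_add, h₁, h₂]
      | tmul c d => simp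
  apply Subtype.ext
  refine Prod.ext (LinearMap.ext fun w => ?_)
    (MulOpposite.unop_injective (LinearMap.ext fun w => ?_))
  · exact key z w
  · exact key' z w

theorem mulSnd_tmul (D : A →ₗ[ℂ] Multiplier (A ⊗[ℂ] A)) (a b : A) :
    mulSnd D (a ⊗ₜ b) = D a * Multiplier.tmul A A 1 (Multiplier.incl A b) := rfl

theorem fstMul_tmul (D : A →ₗ[ℂ] Multiplier (A ⊗[ℂ] A)) (a b : A) :
    fstMul D (a ⊗ₜ b) = Multiplier.tmul A A (Multiplier.incl A a) 1 * D b := rfl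

theorem exists_T1 : ∃ T : A ⊗[ℂ] A →ₗ[ℂ] A ⊗[ℂ] A,
    ∀ z, Multiplier.incl _ (T z) = mulSnd (H.Δ : A →ₗ[ℂ] _) z :=
  Multiplier.exists_lift H.isNondeg_tensor _
    (range_induction fun a b => (H.comul.restricted a).2.1 b)

theorem exists_T2 : ∃ T : A ⊗[ℂ] A →ₗ[ℂ] A ⊗[ℂ] A,
    ∀ z, Multiplier.incl _ (T z) = fstMul (H.Δ : A →ₗ[ℂ] _) z :=
  Multiplier.exists_lift H.isNondeg_tensor _
    (range_induction fun a b => (H.comul.restricted b).2.2.1 a)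

theorem exists_U1 : ∃ T : A ⊗[ℂ] A →ₗ[ℂ] A ⊗[ℂ] A,
    ∀ z, Multiplier.incl _ (T z) = mulSnd H.comulOp z :=
  Multiplier.exists_lift H.isNondeg_tensor _
    (range_induction fun a b => by
      obtain ⟨z, hz⟩ := (H.comul.restricted a).1 b
      refine ⟨TensorProduct.comm ℂ A A z, ?_⟩
      rw [← flip_incl, hz, flip_mul, flip_tmul]
      rfl)

theorem exists_U2 : ∃ T : A ⊗[ℂ] A →ₗ[ℂ] A ⊗[ℂ] A,
    ∀ z, Multiplier.incl _ (T z) = fstMul H.comulOp z :=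
  Multiplier.exists_lift H.isNondeg_tensor _
    (range_induction fun a b => by
      obtain ⟨z, hz⟩ := (H.comul.restricted b).2.2.2 a
      refine ⟨TensorProduct.comm ℂ A A z, ?_⟩
      rw [← flip_incl, hz, flip_mul, flip_tmul]
      rfl)

/-- The map `a ⊗ b ↦ Δ(a)(1 ⊗ b)`, with values in `A ⊗ A`. -/
def T1 : A ⊗[ℂ] A →ₗ[ℂ] A ⊗[ℂ] A := H.exists_T1.choose

/-- The map `a ⊗ b ↦ (a ⊗ 1)Δ(b)`, with values in `A ⊗ A`. -/
def T2 : A ⊗[ℂ] A →ₗ[ℂ] A ⊗[ℂ] A := H.exists_T2.choose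

/-- The map `a ⊗ b ↦ Δ^op(a)(1 ⊗ b)`, with values in `A ⊗ A`. -/
def U1 : A ⊗[ℂ] A →ₗ[ℂ] A ⊗[ℂ] A := H.exists_U1.choose

/-- The map `a ⊗ b ↦ (a ⊗ 1)Δ^op(b)`, with values in `A ⊗ A`. -/
def U2 : A ⊗[ℂ] A →ₗ[ℂ] A ⊗[ℂ] A := H.exists_U2.choose

theorem incl_T1 (z : A ⊗[ℂ] A) : Multiplier.incl _ (H.T1 z) = mulSnd (H.Δ : A →ₗ[ℂ] _) z :=
  H.exists_T1.choose_spec z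

theorem incl_T2 (z : A ⊗[ℂ] A) : Multiplier.incl _ (H.T2 z) = fstMul (H.Δ : A →ₗ[ℂ] _) z :=
  H.exists_T2.choose_spec z

theorem incl_U1 (z : A ⊗[ℂ] A) : Multiplier.incl _ (H.U1 z) = mulSnd H.comulOp z :=
  H.exists_U1.choose_spec z

theorem incl_U2 (z : A ⊗[ℂ] A) : Multiplier.incl _ (H.U2 z) = fstMul H.comulOp z :=
  H.exists_U2.choose_spec z

theorem incl_comm_U1 (a b : A) : Multiplier.incl _ (TensorProduct.comm ℂ A A (H.U1 (a ⊗ₜ b))) =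
    H.Δ a * Multiplier.tmul A A (Multiplier.incl A b) 1 := by
  rw [← flip_incl, incl_U1, mulSnd_tmul, flip_mul, flip_tmul]
  apply Multiplier.ext_left H.isNondeg_tensor
  intro z
  simp [comulOp, Multiplier.flip_left]

theorem incl_comm_U2 (a b : A) : Multiplier.incl _ (TensorProduct.comm ℂ A A (H.U2 (a ⊗ₜ b))) =
    Multiplier.tmul A A 1 (Multiplier.incl A a) * H.Δ b := by
  rw [← flip_incl, incl_U2, fstMul_tmul, flip_mul, flip_tmul]
  apply Multiplier.ext_left H.isNondeg_tensor
  intro z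
  simp [comulOp, Multiplier.flip_left]

theorem T1_spec (a b c : A) :
    (LinearMap.mulRight ℂ c ⊠ LinearMap.id) (H.T1 (a ⊗ₜ b)) = H.ΔL a (c ⊗ₜ b) := by
  apply H.isNondeg_tensor.eq_of_mul_right
  intro w
  refine ((Multiplier.tmul A A (Multiplier.incl A c) 1).mul_left_eq _ w).symm.trans ?_
  rw [incl_left_eq (H.incl_T1 _), mulSnd_tmul, Multiplier.mul_left, ΔL_apply,
    ← Multiplier.left_mul H.isNondeg_tensor, Multiplier.one_tmul_left, Multiplier.tmul_one_left,
    ← map_eq_snd_fst, tmul_mul_eq_map]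
  rfl

theorem comm_U1_spec (a b c : A) :
    (LinearMap.id ⊠ LinearMap.mulRight ℂ c) (TensorProduct.comm ℂ A A (H.U1 (a ⊗ₜ b))) =
      H.ΔL a (b ⊗ₜ c) := by
  apply H.isNondeg_tensor.eq_of_mul_right
  intro w
  refine ((Multiplier.tmul A A 1 (Multiplier.incl A c)).mul_left_eq _ w).symm.trans ?_
  rw [incl_left_eq (H.incl_comm_U1 _ _), Multiplier.mul_left, ΔL_apply,
    ← Multiplier.left_mul H.isNondeg_tensor, Multiplier.one_tmul_left, Multiplier.tmul_one_left,
    ← map_eq_fst_snd, tmul_mul_eq_map]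
  rfl

theorem T2_spec (a b c : A) :
    (LinearMap.id ⊠ LinearMap.mulLeft ℂ c) (H.T2 (b ⊗ₜ a)) = H.ΔR a (b ⊗ₜ c) := by
  apply H.isNondeg_tensor.eq_of_mul_left
  intro w
  refine ((Multiplier.tmul A A 1 (Multiplier.incl A c)).mul_left_eq w _).trans ?_
  rw [incl_right_eq (H.incl_T2 _), fstMul_tmul, Multiplier.mul_right, ΔR_apply,
    ← Multiplier.right_mul H.isNondeg_tensor, Multiplier.one_tmul_right, Multiplier.tmul_one_right,
    ← map_eq_fst_snd, mul_tmul_eq_map]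
  rfl

theorem comm_U2_spec (a b c : A) :
    (LinearMap.mulLeft ℂ c ⊠ LinearMap.id) (TensorProduct.comm ℂ A A (H.U2 (b ⊗ₜ a))) =
      H.ΔR a (c ⊗ₜ b) := by
  apply H.isNondeg_tensor.eq_of_mul_left
  intro w
  refine ((Multiplier.tmul A A (Multiplier.incl A c) 1).mul_left_eq w _).trans ?_
  rw [incl_right_eq (H.incl_comm_U2 _ _), Multiplier.mul_right, ΔR_apply,
    ← Multiplier.right_mul H.isNondeg_tensor, Multiplier.one_tmul_right, Multiplier.tmul_one_right,
    ← map_eq_snd_fst, mul_tmul_eq_map]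
  rfl

theorem U1_spec (a b c : A) : (LinearMap.mulRight ℂ c ⊠ LinearMap.id) (H.U1 (a ⊗ₜ b)) =
    TensorProduct.comm ℂ A A (H.ΔL a (b ⊗ₜ c)) := by
  rw [← H.comm_U1_spec, ← TensorProduct.map_comm]
  simp

theorem U2_spec (a b c : A) : (LinearMap.id ⊠ LinearMap.mulLeft ℂ c) (H.U2 (b ⊗ₜ a)) =
    TensorProduct.comm ℂ A A (H.ΔR a (c ⊗ₜ b)) := by
  rw [← H.comm_U2_spec, ← TensorProduct.map_comm]
  simp

theorem counit_T1 (a b : A) : fstSlice H.ε (H.T1 (a ⊗ₜ b)) = a * b :=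
  ((H.counit_fst a b _).1 (H.incl_T1 _)).symm

theorem counit_T2 (a b : A) : sndSlice H.ε (H.T2 (a ⊗ₜ b)) = a * b :=
  ((H.counit_snd b a _).2 (H.incl_T2 _)).symm

theorem counit_U1 (a b : A) : fstSlice H.ε (H.U1 (a ⊗ₜ b)) = a * b := by
  rw [← sndSlice_comm]
  exact ((H.counit_snd a b _).1 (H.incl_comm_U1 _ _)).symm

theorem counit_U2 (a b : A) : sndSlice H.ε (H.U2 (a ⊗ₜ b)) = a * b := by
  rw [← fstSlice_comm]
  exact ((H.counit_fst b a _).2 (H.incl_comm_U2 _ _)).symm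

theorem counit_of_ne {j k : I × I} {a : A} (ha : a ∈ H.G.grade j k) (h : j.1 ≠ j.2 ∨ k.1 ≠ k.2) :
    H.ε a = 0 :=
  H.counit_eq_zero j.1 k.1 j.2 k.2 h a ha

theorem counit_unit_left (r : I) (a : A) :
    H.ε ((H.G.unitUp r).left a) = H.ε ((H.G.unitLow r).left a) := by
  classical
  refine H.G.hom_ext (f := H.ε ∘ₗ (H.G.unitUp r).left) (g := H.ε ∘ₗ (H.G.unitLow r).left)
    (fun j k a ha => ?_) a
  simp only [LinearMap.comp_apply, H.G.unitUp_left_of_mem ha, H.G.unitLow_left_of_mem ha]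
  by_cases h : j.1 = j.2
  · rw [h]
  · simp [apply_ite H.ε, H.counit_of_ne ha (Or.inl h)]

theorem counit_unit_right (r : I) (a : A) :
    H.ε ((H.G.unitUp r).right a) = H.ε ((H.G.unitLow r).right a) := by
  classical
  refine H.G.hom_ext (f := H.ε ∘ₗ (H.G.unitUp r).right) (g := H.ε ∘ₗ (H.G.unitLow r).right)
    (fun j k a ha => ?_) a
  simp only [LinearMap.comp_apply, H.G.unitUp_right_of_mem ha, H.G.unitLow_right_of_mem ha]
  by_cases h : k.1 = k.2
  · rw [h]
  · simp [apply_ite H.ε, H.counit_of_ne ha (Or.inr h)]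

/-- If `k` and `j'` share one coordinate but differ, they cannot both be diagonal pairs. Then `ε`
vanishes on one factor, and `ab = 0`. -/
theorem counit_mul_of_mem {j k j' k' : I × I} {a b : A} (ha : a ∈ H.G.grade j k)
    (hb : b ∈ H.G.grade j' k') (h : k.1 = j'.1 ∨ k.2 = j'.2) : H.ε (a * b) = H.ε a * H.ε b := by
  by_cases hk : k = j'
  · subst hk
    exact H.counit_mul k.1 k.2 a (Submodule.mem_iSup_of_mem j ha) b
      (Submodule.mem_iSup_of_mem k' hb)
  · rw [H.G.mul_eq_zero hk a ha b hb, map_zero]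
    by_cases h1 : k.1 = k.2
    · rw [H.counit_of_ne hb (Or.inl fun h2 => hk (Prod.ext ?_ ?_)), mul_zero]
      · rcases h with h | h
        · exact h
        · rw [h1, h, h2]
      · rcases h with h | h
        · rw [← h1, h, h2]
        · exact h
    · rw [H.counit_of_ne ha (Or.inr h1), zero_mul]

-- Upper and lower units are treated at once: `i` selects the coordinate of the index that the unit
-- `m r` tests.
open scoped Classical in
theorem counit_mul_unit {m : I → Multiplier A} {i : I × I → I}
    (hi : ∀ j j' : I × I, i j = i j' → j.1 = j'.1 ∨ j.2 = j'.2)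
    (hL : ∀ r, ∀ j k, ∀ a ∈ H.G.grade j k, (m r).left a = if i j = r then a else 0)
    (hR : ∀ r, ∀ j k, ∀ a ∈ H.G.grade j k, (m r).right a = if i k = r then a else 0)
    (r : I) (a b : A) :
    H.ε (a * (m r).left b) = H.ε ((m r).right a) * H.ε ((m r).left b) := by
  induction a using H.G.induction with
  | zero => simp
  | add x y hx hy => simp only [map_add, add_mul, hx, hy]
  | hom j k a ha =>
    induction b using H.G.induction with
    | zero => simp
    | add x y hx hy => simp only [map_add, mul_add, hx, hy]
    | hom j' k' b hb =>
      rw [hL r j' k' b hb, hR r j k a ha]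
      by_cases h2 : i j' = r
      · rw [if_pos h2]
        by_cases h1 : i k = r
        · rw [if_pos h1, H.counit_mul_of_mem ha hb (hi _ _ (h1.trans h2.symm))]
        · rw [if_neg h1, H.G.mul_eq_zero _ a ha b hb]
          · simp
          · rintro rfl
            exact h1 h2
      · simp [h2]

theorem counit_mul_unitLow (r : I) (a b : A) : H.ε (a * (H.G.unitLow r).left b) =
    H.ε ((H.G.unitLow r).right a) * H.ε ((H.G.unitLow r).left b) :=
  H.counit_mul_unit (i := Prod.snd) (fun _ _ h => Or.inr h)
    (fun r _ _ _ ha => H.G.unitLow_left_of_mem ha r)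
    (fun r _ _ _ ha => H.G.unitLow_right_of_mem ha r) r a b

theorem counit_mul_unitUp (r : I) (a b : A) : H.ε (a * (H.G.unitUp r).left b) =
    H.ε ((H.G.unitUp r).right a) * H.ε ((H.G.unitUp r).left b) :=
  H.counit_mul_unit (i := Prod.fst) (fun _ _ h => Or.inl h)
    (fun r _ _ _ ha => H.G.unitUp_left_of_mem ha r)
    (fun r _ _ _ ha => H.G.unitUp_right_of_mem ha r) r a b

end RegularPartialMultiplierBialgebra

end CanonicalMaps

/-! ### Coassociativity -/

section Coassociativity

local infix:70 " ⊠ " => TensorProduct.map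

namespace Multiplier

variable {A B : Type*} [NonUnitalRing A] [Module ℂ A] [IsScalarTower ℂ A A] [SMulCommClass ℂ A A]
  [NonUnitalRing B] [Module ℂ B] [IsScalarTower ℂ B B] [SMulCommClass ℂ B B]

theorem ext_right (hA : IsNondeg A) {m n : Multiplier A} (h : ∀ a, m.right a = n.right a) :
    m = n := by
  apply ext_left hA
  intro a
  apply hA.eq_of_mul_left
  intro c
  rw [mul_left_eq, mul_left_eq, h]

theorem incl_mul (a b : A) : incl A (a * b) = incl A a * incl A b := by
  apply Subtype.ext
  refine Prod.ext (LinearMap.ext fun z => ?_)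
    (MulOpposite.unop_injective (LinearMap.ext fun z => ?_))
  · exact mul_assoc a b z
  · exact (mul_assoc z a b).symm

theorem tmul_mul (m m' : Multiplier A) (n n' : Multiplier B) :
    tmul A B (m * m') (n * n') = tmul A B m n * tmul A B m' n' := by
  apply Subtype.ext
  refine Prod.ext (TensorProduct.map_comp _ _ _ _) ?_
  exact congrArg MulOpposite.op (TensorProduct.map_comp _ _ _ _)

theorem assocSymm_mul (m n : Multiplier (A ⊗[ℂ] (A ⊗[ℂ] A))) :
    assocSymm A (m * n) = assocSymm A m * assocSymm A n := by
  apply Subtype.ext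
  refine Prod.ext (LinearMap.ext fun z => ?_)
    (MulOpposite.unop_injective (LinearMap.ext fun z => ?_))
  · change (TensorProduct.assoc ℂ A A A).symm (m.left (n.left (TensorProduct.assoc ℂ A A A z))) =
      (TensorProduct.assoc ℂ A A A).symm (m.left (TensorProduct.assoc ℂ A A A
        ((TensorProduct.assoc ℂ A A A).symm (n.left (TensorProduct.assoc ℂ A A A z)))))
    rw [LinearEquiv.apply_symm_apply]
  · change (TensorProduct.assoc ℂ A A A).symm (n.right (m.right (TensorProduct.assoc ℂ A A A z))) =
      (TensorProduct.assoc ℂ A A A).symm (n.right (TensorProduct.assoc ℂ A A A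
        ((TensorProduct.assoc ℂ A A A).symm (m.right (TensorProduct.assoc ℂ A A A z)))))
    rw [LinearEquiv.apply_symm_apply]

theorem assocSymm_right (m : Multiplier (A ⊗[ℂ] (A ⊗[ℂ] A))) (z : (A ⊗[ℂ] A) ⊗[ℂ] A) :
    (assocSymm A m).right z =
      (TensorProduct.assoc ℂ A A A).symm (m.right (TensorProduct.assoc ℂ A A A z)) := rfl

theorem incl_tmul (a : A) (b : B) : incl (A ⊗[ℂ] B) (a ⊗ₜ b) = tmul A B (incl A a) (incl B b) := by
  apply Subtype.ext
  refine Prod.ext (LinearMap.ext fun z => ?_)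
    (MulOpposite.unop_injective (LinearMap.ext fun z => ?_))
  · exact tmul_mul_eq_map a b z
  · exact mul_tmul_eq_map a b z

theorem tmul_one_one : tmul A B 1 1 = 1 := by
  apply Subtype.ext
  refine Prod.ext (TensorProduct.map_id) ?_
  exact congrArg MulOpposite.op (TensorProduct.map_id)

theorem assocSymm_tmul (m n k : Multiplier A) :
    assocSymm A (tmul A (A ⊗[ℂ] A) m (tmul A A n k)) = tmul (A ⊗[ℂ] A) A (tmul A A m n) k := by
  have key : ∀ (f g h : A →ₗ[ℂ] A) (z : (A ⊗[ℂ] A) ⊗[ℂ] A), (TensorProduct.assoc ℂ A A A).symm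
      ((f ⊠ (g ⊠ h)) (TensorProduct.assoc ℂ A A A z)) = ((f ⊠ g) ⊠ h) z := by
    intro f g h z
    rw [← assoc_map_map, LinearEquiv.symm_apply_apply]
  apply Subtype.ext
  refine Prod.ext (LinearMap.ext fun z => ?_)
    (MulOpposite.unop_injective (LinearMap.ext fun z => ?_))
  · exact key _ _ _ z
  · exact key _ _ _ z

theorem assocSymm_incl (z : A ⊗[ℂ] (A ⊗[ℂ] A)) :
    assocSymm A (incl _ z) = incl _ ((TensorProduct.assoc ℂ A A A).symm z) := by
  induction z using TensorProduct.induction_on with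
  | zero => simp
  | add x y hx hy => simp only [map_add, hx, hy]
  | tmul a z =>
    induction z using TensorProduct.induction_on with
    | zero => simp
    | add x y hx hy => simp only [TensorProduct.tmul_add, map_add, hx, hy]
    | tmul b c => simp only [incl_tmul, assocSymm_tmul, TensorProduct.assoc_symm_tmul]

end Multiplier

namespace PartialAlgebra

variable {I A : Type*} [NonUnitalRing A] [Module ℂ A] (G : PartialAlgebra (I × I) A)

theorem hom_ext_tensor₃ {X : Type*} [AddCommGroup X] [Module ℂ X]
    {f g : (A ⊗[ℂ] A) ⊗[ℂ] A →ₗ[ℂ] X}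
    (h : ∀ j k, ∀ a ∈ G.grade j k, ∀ j' k', ∀ b ∈ G.grade j' k', ∀ j'' k'',
      ∀ c ∈ G.grade j'' k'', f (a ⊗ₜ b ⊗ₜ c) = g (a ⊗ₜ b ⊗ₜ c))
    (z : (A ⊗[ℂ] A) ⊗[ℂ] A) : f z = g z := by
  induction z using TensorProduct.induction_on with
  | zero => simp
  | add x y hx hy => simp only [map_add, hx, hy]
  | tmul z c =>
    refine G.hom_ext_tensor (f := fixSnd f c) (g := fixSnd g c)
      (fun j k j' k' a ha b hb => ?_) z
    exact G.hom_ext (f := fixFst f (a ⊗ₜ b)) (g := fixFst g (a ⊗ₜ b))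
      (fun j'' k'' c hc => h j k a ha j' k' b hb j'' k'' c hc) c

variable {G} in
theorem Idempotent.hom_ext_mul (hG : G.Idempotent) {X : Type*} [AddCommGroup X] [Module ℂ X]
    {f g : A →ₗ[ℂ] X} (h : ∀ a b, f (a * b) = g (a * b)) (a : A) : f a = g a := by
  refine G.hom_ext (fun j k a ha => ?_) a
  refine Submodule.span_le (p := LinearMap.eqLocus f g).2 ?_
    (PartialAlgebra.Idempotent.mem_span_row hG ha)
  rintro _ ⟨a, -, b, rfl⟩
  exact h a b

variable [IsScalarTower ℂ A A] [SMulCommClass ℂ A A]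

theorem E₃_E_left (z : (A ⊗[ℂ] A) ⊗[ℂ] A) :
    G.E₃.left ((G.E.left ⊠ LinearMap.id) z) = G.E₃.left z := by
  classical
  refine G.hom_ext_tensor₃ (f := G.E₃.left ∘ₗ (G.E.left ⊠ LinearMap.id)) (g := G.E₃.left)
    (fun j k a ha j' k' b hb j'' k'' c hc => ?_) z
  rw [LinearMap.comp_apply, TensorProduct.map_tmul, G.E_left_tmul ha hb]
  split_ifs with h
  · rfl
  · rw [G.E₃_left_tmul_eq_zero ha hb hc (fun h' => h h'.1)]
    simp

theorem E₃_E_right (z : A ⊗[ℂ] (A ⊗[ℂ] A)) :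
    G.E₃.right ((TensorProduct.assoc ℂ A A A).symm ((LinearMap.id ⊠ G.E.right) z)) =
      G.E₃.right ((TensorProduct.assoc ℂ A A A).symm z) := by
  classical
  obtain ⟨z, rfl⟩ := (TensorProduct.assoc ℂ A A A).surjective z
  rw [LinearEquiv.symm_apply_apply]
  refine G.hom_ext_tensor₃ (f := G.E₃.right ∘ₗ (TensorProduct.assoc ℂ A A A).symm.toLinearMap ∘ₗ
    (LinearMap.id ⊠ G.E.right) ∘ₗ (TensorProduct.assoc ℂ A A A).toLinearMap) (g := G.E₃.right)
    (fun j k a ha j' k' b hb j'' k'' c hc => ?_) z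
  simp only [LinearMap.comp_apply, LinearEquiv.coe_coe, TensorProduct.assoc_tmul,
    TensorProduct.map_tmul, G.E_right_tmul hb hc]
  split_ifs with h
  · rfl
  · rw [G.E₃_right_tmul_eq_zero ha hb hc (fun h' => h h'.2)]
    simp

theorem E₃_unitLow_left (r : I) (x : A ⊗[ℂ] A) (y : A) :
    G.E₃.left ((LinearMap.id ⊠ (G.unitLow r).left) x ⊗ₜ y) =
      G.E₃.left (x ⊗ₜ (G.unitUp r).left y) := by
  classical
  refine G.hom_ext_tensor₃ (f := G.E₃.left ∘ₗ ((LinearMap.id ⊠ (G.unitLow r).left) ⊠ LinearMap.id))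
    (g := G.E₃.left ∘ₗ (LinearMap.id ⊠ (G.unitUp r).left))
    (fun j k a ha j' k' b hb j'' k'' c hc => ?_) (x ⊗ₜ y)
  simp only [LinearMap.comp_apply, TensorProduct.map_tmul, G.unitLow_left_of_mem hb,
    G.unitUp_left_of_mem hc, LinearMap.id_apply]
  by_cases h1 : j'.2 = r <;> by_cases h2 : j''.1 = r
  · simp [h1, h2]
  · rw [if_pos h1, if_neg h2,
      G.E₃_left_tmul_eq_zero ha hb hc (fun h => h2 (h.2.symm.trans h1))]
    simp
  · rw [if_neg h1, if_pos h2,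
      G.E₃_left_tmul_eq_zero ha hb hc (fun h => h1 (h.2.trans h2))]
    simp
  · simp [h1, h2]

theorem E₃_unitLow_right (r : I) (x : A) (y : A ⊗[ℂ] A) :
    G.E₃.right ((TensorProduct.assoc ℂ A A A).symm ((G.unitLow r).right x ⊗ₜ y)) =
      G.E₃.right ((TensorProduct.assoc ℂ A A A).symm
        (x ⊗ₜ ((G.unitUp r).right ⊠ LinearMap.id) y)) := by
  classical
  obtain ⟨z, hz⟩ := (TensorProduct.assoc ℂ A A A).surjective (x ⊗ₜ y)
  have key := G.hom_ext_tensor₃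
    (f := G.E₃.right ∘ₗ (TensorProduct.assoc ℂ A A A).symm.toLinearMap ∘ₗ
      ((G.unitLow r).right ⊠ LinearMap.id) ∘ₗ (TensorProduct.assoc ℂ A A A).toLinearMap)
    (g := G.E₃.right ∘ₗ (TensorProduct.assoc ℂ A A A).symm.toLinearMap ∘ₗ
      (LinearMap.id ⊠ ((G.unitUp r).right ⊠ LinearMap.id)) ∘ₗ
        (TensorProduct.assoc ℂ A A A).toLinearMap)
    (fun j k a ha j' k' b hb j'' k'' c hc => ?_) z
  · simpa only [LinearMap.comp_apply, LinearEquiv.coe_coe, hz, TensorProduct.map_tmul,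
      LinearMap.id_apply] using key
  simp only [LinearMap.comp_apply, LinearEquiv.coe_coe, TensorProduct.assoc_tmul,
    TensorProduct.map_tmul, G.unitLow_right_of_mem ha, G.unitUp_right_of_mem hb,
    LinearMap.id_apply]
  by_cases h1 : k.2 = r <;> by_cases h2 : k'.1 = r
  · simp [h1, h2]
  · rw [if_pos h1, if_neg h2, TensorProduct.assoc_symm_tmul,
      G.E₃_right_tmul_eq_zero ha hb hc (fun h => h2 (h.1.symm.trans h1))]
    simp
  · rw [if_neg h1, if_pos h2, TensorProduct.assoc_symm_tmul, TensorProduct.assoc_symm_tmul,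
      G.E₃_right_tmul_eq_zero ha hb hc (fun h => h1 (h.1.trans h2))]
    simp
  · simp [h1, h2]

end PartialAlgebra

/-! ### Multiplicativity of `Δ ⊗ id` and `id ⊗ Δ`. -/

section ComulId

variable {A : Type*} [NonUnitalRing A] [Module ℂ A] [IsScalarTower ℂ A A] [SMulCommClass ℂ A A]
  (Δ : A →ₙₐ[ℂ] Multiplier (A ⊗[ℂ] A))

theorem comulId_tmul (a b : A) :
    comulId Δ (a ⊗ₜ b) = Multiplier.tmul (A ⊗[ℂ] A) A (Δ a) (Multiplier.incl A b) := rfl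

theorem idComul_tmul (a b : A) : idComul Δ (a ⊗ₜ b) =
    Multiplier.assocSymm A (Multiplier.tmul A (A ⊗[ℂ] A) (Multiplier.incl A a) (Δ b)) := rfl

theorem comulId_mul (x y : A ⊗[ℂ] A) : comulId Δ (x * y) = comulId Δ x * comulId Δ y := by
  induction x using TensorProduct.induction_on with
  | zero => simp
  | add x₁ x₂ h₁ h₂ => simp only [add_mul, map_add, h₁, h₂]
  | tmul a b =>
    induction y using TensorProduct.induction_on with
    | zero => simp
    | add y₁ y₂ h₁ h₂ => simp only [mul_add, map_add, h₁, h₂]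
    | tmul c d =>
      rw [Algebra.TensorProduct.tmul_mul_tmul, comulId_tmul, comulId_tmul, comulId_tmul, map_mul Δ,
        Multiplier.incl_mul, Multiplier.tmul_mul]

theorem idComul_mul (x y : A ⊗[ℂ] A) : idComul Δ (x * y) = idComul Δ x * idComul Δ y := by
  induction x using TensorProduct.induction_on with
  | zero => simp
  | add x₁ x₂ h₁ h₂ => simp only [add_mul, map_add, h₁, h₂]
  | tmul a b =>
    induction y using TensorProduct.induction_on with
    | zero => simp
    | add y₁ y₂ h₁ h₂ => simp only [mul_add, map_add, h₁, h₂]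
    | tmul c d =>
      rw [Algebra.TensorProduct.tmul_mul_tmul, idComul_tmul, idComul_tmul, idComul_tmul, map_mul Δ,
        Multiplier.incl_mul, Multiplier.tmul_mul, Multiplier.assocSymm_mul]

end ComulId

namespace RegularPartialMultiplierBialgebra

variable {I A : Type*} [NonUnitalRing A] [Module ℂ A] [IsScalarTower ℂ A A] [SMulCommClass ℂ A A]
  (H : RegularPartialMultiplierBialgebra I A)

theorem ΔR_unitUp_right (r : I) (a : A) (z : A ⊗[ℂ] A) :
    H.ΔR ((H.G.unitUp r).right a) z = ((H.G.unitUp r).right ⊠ LinearMap.id) (H.ΔR a z) := by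
  apply H.isNondeg_tensor.eq_of_mul_right
  intro w
  rw [ΔR_apply, ← Multiplier.mul_left_eq, ← ΔL_apply, ΔL_unitUp_right, ← Multiplier.tmul_one_left,
    ← Multiplier.tmul_one_right, ← Multiplier.mul_left_eq, ΔL_apply,
    Multiplier.mul_left_eq, ΔR_apply]

theorem Δ_mul_E (a : A) : H.Δ a * H.G.E = H.Δ a :=
  Multiplier.ext_left H.isNondeg_tensor fun z => H.Δ_E_left a z

theorem E_mul_Δ (a : A) : H.G.E * H.Δ a = H.Δ a :=
  Multiplier.ext_left H.isNondeg_tensor fun z => H.E_Δ_left a z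

/-- The extension property is given only on `A ⊗^I A`, but it holds on all of `A ⊗ A`. For
homogeneous `u ⊗ v` with matching left indices, factor off a diagonal component. Otherwise both
sides vanish: writing `u = 1_t u`, the projection `E₃` moves `1_t` from the second leg to `1^t` on
the third, where it kills `v`. -/
theorem mul_comulId {n : Multiplier ((A ⊗[ℂ] A) ⊗[ℂ] A)} {a : A}
    (hn : ExtensionMapsTo H.G (comulId H.Δ) (H.Δ a) n) (z : A ⊗[ℂ] A) :
    n * comulId H.Δ z = comulId H.Δ ((H.Δ a).left z) := by
  classical
  refine H.G.hom_ext_tensor (f := LinearMap.mulLeft ℂ n ∘ₗ comulId H.Δ)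
    (g := comulId H.Δ ∘ₗ (H.Δ a).left) (fun j k j' k' u hu v hv => ?_) z
  by_cases h : j.2 = j'.1
  · refine H.tmul_ext_left h hu hv fun z hz w => ?_
    simp only [LinearMap.comp_apply, LinearMap.mulLeft_apply]
    rw [comulId_mul, ← mul_assoc, (hn.2 z (H.mem_tensorI hz)).1, ← comulId_mul,
      Multiplier.left_mul H.isNondeg_tensor]
  · have h0 : H.G.E₃ * comulId H.Δ (u ⊗ₜ v) = 0 := by
      apply Multiplier.ext_left H.isNondeg_tensor₃
      intro z
      induction z using TensorProduct.induction_on with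
      | zero => simp
      | add x y hx hy => simp only [map_add, hx, hy]
      | tmul x y =>
        have hu' : u = (H.G.unitLow j.2).left u := by rw [H.G.unitLow_left_of_mem hu, if_pos rfl]
        have hv' : (H.G.unitUp j.2).left v = 0 := by
          rw [H.G.unitUp_left_of_mem hv, if_neg (Ne.symm h)]
        rw [Multiplier.mul_left, comulId_tmul, Multiplier.tmul_left, TensorProduct.map_tmul, hu',
          ← ΔL_apply, H.ΔL_unitLow_left, H.G.E₃_unitLow_left, Multiplier.incl_left,
          Multiplier.left_mul H.isNondeg, hv', zero_mul, TensorProduct.tmul_zero, map_zero]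
        rfl
    have h1 : (H.Δ a).left (u ⊗ₜ v) = 0 := by
      rw [← H.Δ_E_left, H.G.E_left_tmul hu hv, if_neg h, map_zero]
    simp only [LinearMap.comp_apply, LinearMap.mulLeft_apply]
    rw [h1, map_zero, ← hn.1, mul_assoc, h0, mul_zero]

theorem idComul_mul' {n : Multiplier ((A ⊗[ℂ] A) ⊗[ℂ] A)} {a : A}
    (hn : ExtensionMapsTo H.G (idComul H.Δ) (H.Δ a) n) (z : A ⊗[ℂ] A) :
    idComul H.Δ z * n = idComul H.Δ ((H.Δ a).right z) := by
  classical
  refine H.G.hom_ext_tensor (f := LinearMap.mulRight ℂ n ∘ₗ idComul H.Δ)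
    (g := idComul H.Δ ∘ₗ (H.Δ a).right) (fun j k j' k' u hu v hv => ?_) z
  by_cases h : k.2 = k'.1
  · refine H.tmul_ext_right h hu hv fun z hz w => ?_
    simp only [LinearMap.comp_apply, LinearMap.mulRight_apply]
    rw [idComul_mul, mul_assoc, (hn.2 z (H.mem_tensorI hz)).2, ← idComul_mul,
      Multiplier.right_mul H.isNondeg_tensor]
  · have h0 : idComul H.Δ (u ⊗ₜ v) * H.G.E₃ = 0 := by
      apply Multiplier.ext_right H.isNondeg_tensor₃
      intro z
      obtain ⟨z, rfl⟩ := (TensorProduct.assoc ℂ A A A).symm.surjective z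
      induction z using TensorProduct.induction_on with
      | zero => simp
      | add x y hx hy => simp only [map_add, hx, hy]
      | tmul x y =>
        have hv' : v = (H.G.unitUp k'.1).right v := by rw [H.G.unitUp_right_of_mem hv, if_pos rfl]
        have hu' : (H.G.unitLow k'.1).right u = 0 := by
          rw [H.G.unitLow_right_of_mem hu, if_neg h]
        rw [Multiplier.mul_right, idComul_tmul, Multiplier.assocSymm_right,
          LinearEquiv.apply_symm_apply, Multiplier.tmul_right, TensorProduct.map_tmul, hv',
          ← ΔR_apply, H.ΔR_unitUp_right, ← H.G.E₃_unitLow_right, Multiplier.incl_right,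
          Multiplier.right_mul H.isNondeg, hu', mul_zero, TensorProduct.zero_tmul, map_zero,
          map_zero]
        rfl
    have h1 : (H.Δ a).right (u ⊗ₜ v) = 0 := by
      rw [← H.Δ_E_right, H.G.E_right_tmul hu hv, if_neg h, map_zero]
    simp only [LinearMap.comp_apply, LinearMap.mulRight_apply]
    rw [h1, map_zero, ← hn.1, ← mul_assoc, ← mul_assoc, h0, zero_mul, zero_mul]

/-- Multipliers that agree on `(Δ ⊗ id)(A ⊗ A)` agree on `E ⊗ 1`. -/
theorem mul_E_one_eq {m m' : Multiplier ((A ⊗[ℂ] A) ⊗[ℂ] A)}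
    (hm : ∀ z, m * comulId H.Δ z = m' * comulId H.Δ z) :
    m * Multiplier.tmul (A ⊗[ℂ] A) A H.G.E 1 = m' * Multiplier.tmul (A ⊗[ℂ] A) A H.G.E 1 := by
  classical
  apply Multiplier.ext_left H.isNondeg_tensor₃
  refine H.G.hom_ext_tensor₃ (fun j k u hu j' k' v hv j'' k'' y hy => ?_)
  rw [Multiplier.mul_left, Multiplier.mul_left, Multiplier.tmul_one_left, TensorProduct.map_tmul,
    H.G.E_left_tmul hu hv]
  split_ifs with h
  · refine H.tmul_ext_left h hu hv (f := fixSnd m.left y) (g := fixSnd m'.left y) fun z hz w => ?_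
    refine PartialAlgebra.Idempotent.hom_ext_mul H.idempotent (f := fixFst m.left (z * w))
      (g := fixFst m'.left (z * w)) (fun y e => ?_) y
    refine Submodule.span_le (p := LinearMap.eqLocus
      (fixSnd m.left (y * e) ∘ₗ LinearMap.mulRight ℂ w)
      (fixSnd m'.left (y * e) ∘ₗ LinearMap.mulRight ℂ w)).2 ?_ (H.mem_span_Δ_left hz)
    rintro _ ⟨b, -, w1, rfl⟩
    have h1 := LinearMap.congr_fun (congrArg Multiplier.left (hm (b ⊗ₜ y))) ((w1 * w) ⊗ₜ e)
    rw [comulId_tmul] at h1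
    change m.left (((H.Δ b).left w1 * w) ⊗ₜ (y * e)) = m'.left (((H.Δ b).left w1 * w) ⊗ₜ (y * e))
    rw [← Multiplier.left_mul H.isNondeg_tensor]
    exact h1
  · rw [TensorProduct.zero_tmul, map_zero, map_zero]

/-- Multipliers that agree on `(id ⊗ Δ)(A ⊗ A)` agree on `1 ⊗ E`. -/
theorem one_E_mul_eq {m m' : Multiplier ((A ⊗[ℂ] A) ⊗[ℂ] A)}
    (hm : ∀ z, idComul H.Δ z * m = idComul H.Δ z * m') :
    Multiplier.assocSymm A (Multiplier.tmul A (A ⊗[ℂ] A) 1 H.G.E) * m =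
      Multiplier.assocSymm A (Multiplier.tmul A (A ⊗[ℂ] A) 1 H.G.E) * m' := by
  classical
  apply Multiplier.ext_right H.isNondeg_tensor₃
  refine H.G.hom_ext_tensor₃ (fun j'' k'' y hy j k u hu j' k' v hv => ?_)
  rw [Multiplier.mul_right, Multiplier.mul_right, Multiplier.assocSymm_right,
    TensorProduct.assoc_tmul, Multiplier.one_tmul_right, TensorProduct.map_tmul,
    H.G.E_right_tmul hu hv]
  split_ifs with h
  · let f := m.right ∘ₗ (TensorProduct.assoc ℂ A A A).symm.toLinearMap
    let g := m'.right ∘ₗ (TensorProduct.assoc ℂ A A A).symm.toLinearMap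
    refine H.tmul_ext_right h hu hv (f := fixFst f y) (g := fixFst g y) fun z hz w => ?_
    refine PartialAlgebra.Idempotent.hom_ext_mul H.idempotent (f := fixSnd f (w * z))
      (g := fixSnd g (w * z)) (fun e y => ?_) y
    refine Submodule.span_le (p := LinearMap.eqLocus (fixFst f (e * y) ∘ₗ LinearMap.mulLeft ℂ w)
      (fixFst g (e * y) ∘ₗ LinearMap.mulLeft ℂ w)).2 ?_ (H.mem_span_Δ_right hz)
    rintro _ ⟨b, -, w1, rfl⟩
    have h1 := LinearMap.congr_fun (congrArg Multiplier.right (hm (y ⊗ₜ b)))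
      ((TensorProduct.assoc ℂ A A A).symm (e ⊗ₜ (w * w1)))
    rw [Multiplier.mul_right, Multiplier.mul_right, idComul_tmul, Multiplier.assocSymm_right,
      LinearEquiv.apply_symm_apply] at h1
    change f ((e * y) ⊗ₜ (w * (H.Δ b).right w1)) = g ((e * y) ⊗ₜ (w * (H.Δ b).right w1))
    rw [← Multiplier.right_mul H.isNondeg_tensor]
    exact h1
  · simp only [TensorProduct.tmul_zero, map_zero]

/-- This reads `n(1 ⊗ 1 ⊗ c) = (Δ ⊗ id)(Δ(a)(1 ⊗ c))`. The two sides agree after multiplication by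
every `(Δ ⊗ id)(z)`, hence on `E ⊗ 1`, and both absorb `E ⊗ 1` from the right. -/
theorem mul_incl_eq_comulId {n : Multiplier ((A ⊗[ℂ] A) ⊗[ℂ] A)} {a : A}
    (hn : ExtensionMapsTo H.G (comulId H.Δ) (H.Δ a) n) (c : A) :
    n * Multiplier.tmul (A ⊗[ℂ] A) A 1 (Multiplier.incl A c) = comulId H.Δ (H.T1 (a ⊗ₜ c)) := by
  have hE : ∀ z, comulId H.Δ z * Multiplier.tmul (A ⊗[ℂ] A) A H.G.E 1 = comulId H.Δ z := by
    intro z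
    induction z using TensorProduct.induction_on with
    | zero => simp
    | add x y hx hy => simp only [map_add, add_mul, hx, hy]
    | tmul x y => rw [comulId_tmul, ← Multiplier.tmul_mul, H.Δ_mul_E, mul_one]
  have hnE : n * Multiplier.tmul (A ⊗[ℂ] A) A H.G.E 1 = n := by
    rw [← hn.1, mul_assoc]
    congr 1
    exact Multiplier.ext_left H.isNondeg_tensor₃ fun z => H.G.E₃_E_left z
  have hP : ∀ z, Multiplier.tmul (A ⊗[ℂ] A) A 1 (Multiplier.incl A c) * comulId H.Δ z =
      comulId H.Δ ((LinearMap.id ⊠ LinearMap.mulLeft ℂ c) z) := by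
    intro z
    induction z using TensorProduct.induction_on with
    | zero => simp
    | add x y hx hy => simp only [map_add, mul_add, hx, hy]
    | tmul x y =>
      rw [comulId_tmul, ← Multiplier.tmul_mul, one_mul, ← Multiplier.incl_mul]
      rfl
  have h0 := H.mul_E_one_eq (m := n * Multiplier.tmul (A ⊗[ℂ] A) A 1 (Multiplier.incl A c))
    (m' := comulId H.Δ (H.T1 (a ⊗ₜ c))) fun z => by
      rw [mul_assoc, hP, H.mul_comulId hn, ← comulId_mul, incl_left_eq (H.incl_T1 _)]
      rfl
  rw [hE, mul_assoc, ← Multiplier.tmul_mul, one_mul, mul_one] at h0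
  rw [← h0]
  conv_lhs => rw [← hnE, mul_assoc, ← Multiplier.tmul_mul, one_mul, mul_one]

theorem incl_mul_eq_idComul {n : Multiplier ((A ⊗[ℂ] A) ⊗[ℂ] A)} {a : A}
    (hn : ExtensionMapsTo H.G (idComul H.Δ) (H.Δ a) n) (p : A) :
    Multiplier.assocSymm A (Multiplier.tmul A (A ⊗[ℂ] A) (Multiplier.incl A p) 1) * n =
      idComul H.Δ (H.T2 (p ⊗ₜ a)) := by
  have hE : ∀ z, Multiplier.assocSymm A (Multiplier.tmul A (A ⊗[ℂ] A) 1 H.G.E) * idComul H.Δ z =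
      idComul H.Δ z := by
    intro z
    induction z using TensorProduct.induction_on with
    | zero => simp
    | add x y hx hy => simp only [map_add, mul_add, hx, hy]
    | tmul x y =>
      rw [idComul_tmul, ← Multiplier.assocSymm_mul, ← Multiplier.tmul_mul, H.E_mul_Δ, one_mul]
  have hnE : Multiplier.assocSymm A (Multiplier.tmul A (A ⊗[ℂ] A) 1 H.G.E) * n = n := by
    rw [← hn.1, ← mul_assoc, ← mul_assoc]
    congr 2
    refine Multiplier.ext_right H.isNondeg_tensor₃ fun z => ?_
    have h1 := H.G.E₃_E_right (TensorProduct.assoc ℂ A A A z)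
    rwa [LinearEquiv.symm_apply_apply] at h1
  have hP : ∀ z, idComul H.Δ z *
      Multiplier.assocSymm A (Multiplier.tmul A (A ⊗[ℂ] A) (Multiplier.incl A p) 1) =
      idComul H.Δ ((LinearMap.mulRight ℂ p ⊠ LinearMap.id) z) := by
    intro z
    induction z using TensorProduct.induction_on with
    | zero => simp
    | add x y hx hy => simp only [map_add, add_mul, hx, hy]
    | tmul x y =>
      rw [idComul_tmul, ← Multiplier.assocSymm_mul, ← Multiplier.tmul_mul, mul_one,
        ← Multiplier.incl_mul]
      rfl
  have h0 := H.one_E_mul_eq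
    (m := Multiplier.assocSymm A (Multiplier.tmul A (A ⊗[ℂ] A) (Multiplier.incl A p) 1) * n)
    (m' := idComul H.Δ (H.T2 (p ⊗ₜ a))) fun z => by
      rw [← mul_assoc, hP, H.idComul_mul' hn, ← idComul_mul, incl_right_eq (H.incl_T2 _)]
      rfl
  rw [hE, ← mul_assoc, ← Multiplier.assocSymm_mul, ← Multiplier.tmul_mul, one_mul,
    mul_one] at h0
  rw [← h0]
  conv_lhs => rw [← hnE, ← mul_assoc, ← Multiplier.assocSymm_mul, ← Multiplier.tmul_mul, one_mul,
    mul_one]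

theorem incl_T2_map (p : A) (x : A ⊗[ℂ] A) :
    Multiplier.incl _ ((fixFst H.T2 p ⊠ LinearMap.id) x) =
      Multiplier.assocSymm A (Multiplier.tmul A (A ⊗[ℂ] A) (Multiplier.incl A p) 1) *
        comulId H.Δ x := by
  induction x using TensorProduct.induction_on with
  | zero => simp
  | add x y hx hy => simp only [map_add, mul_add, hx, hy]
  | tmul x y =>
    rw [← Multiplier.tmul_one_one, Multiplier.assocSymm_tmul, comulId_tmul,
      ← Multiplier.tmul_mul, one_mul, TensorProduct.map_tmul, Multiplier.incl_tmul,
      fixFst_apply, H.incl_T2]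
    rfl

theorem incl_map_T1 (c : A) (x : A ⊗[ℂ] A) :
    Multiplier.incl _ ((TensorProduct.assoc ℂ A A A).symm ((LinearMap.id ⊠ fixSnd H.T1 c) x)) =
      idComul H.Δ x * Multiplier.tmul (A ⊗[ℂ] A) A 1 (Multiplier.incl A c) := by
  induction x using TensorProduct.induction_on with
  | zero => simp
  | add x y hx hy => simp only [map_add, add_mul, hx, hy]
  | tmul x y =>
    rw [← Multiplier.tmul_one_one, ← Multiplier.assocSymm_tmul, idComul_tmul,
      ← Multiplier.assocSymm_mul, ← Multiplier.tmul_mul, mul_one, TensorProduct.map_tmul,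
      ← Multiplier.assocSymm_incl, Multiplier.incl_tmul, fixSnd_apply, H.incl_T1]
    rfl

/-- Both sides are `(p ⊗ 1 ⊗ 1)n(1 ⊗ 1 ⊗ c)`, where `n` is the common value of the two extensions at
`Δ(a)`. -/
theorem coassoc (a p c : A) :
    TensorProduct.assoc ℂ A A A ((fixFst H.T2 p ⊠ LinearMap.id) (fixSnd H.T1 c a)) =
      (LinearMap.id ⊠ fixSnd H.T1 c) (fixFst H.T2 p a) := by
  obtain ⟨n, hn, hn'⟩ := H.comul.coassoc a
  rw [← LinearEquiv.eq_symm_apply]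
  apply Multiplier.incl_injective H.isNondeg_tensor₃
  rw [incl_T2_map, incl_map_T1, fixSnd_apply, fixFst_apply, ← H.mul_incl_eq_comulId hn,
    ← H.incl_mul_eq_idComul hn', mul_assoc]

end RegularPartialMultiplierBialgebra

end Coassociativity

/-! ### Reduction to the elementwise data -/

section Main

local infix:70 " ⊠ " => TensorProduct.map

theorem mulTensor_mul {A : Type*} [NonUnitalRing A] [Module ℂ A] [IsScalarTower ℂ A A]
    [SMulCommClass ℂ A A] (z w : A ⊗[ℂ] A) : mulTensor (LinearMap.mul ℂ A) z w = z * w := by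
  induction z using TensorProduct.induction_on with
  | zero => simp
  | add x y hx hy => simp only [map_add, LinearMap.add_apply, add_mul, hx, hy]
  | tmul a b => exact (tmul_mul_eq_map a b w).symm

/-- This identifies the ranges of `F1`, `E1` and their analogues with the domains and targets in the
definition of a Hopf algebra. -/
theorem Partition.range_diag {I A B : Type*} [NonUnitalRing A] [Module ℂ A] [NonUnitalRing B]
    [Module ℂ B] {P : I → A →ₗ[ℂ] A} (hP : Partition P) (Q : I → B →ₗ[ℂ] B) :
    LinearMap.range (hP.diag Q) =
      ⨆ s, tensorSub (LinearMap.range (P s)) (LinearMap.range (Q s)) := by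
  apply le_antisymm
  · rintro _ ⟨z, rfl⟩
    induction z using TensorProduct.induction_on with
    | zero => simp
    | add x y hx hy => rw [map_add]; exact Submodule.add_mem _ hx hy
    | tmul a b =>
      refine hP.span (fun a => hP.diag Q (a ⊗ₜ b) ∈
        ⨆ s, tensorSub (LinearMap.range (P s)) (LinearMap.range (Q s))) (by simp)
        (fun x y hx hy => ?_) (fun s a => ?_) a
      · rw [TensorProduct.add_tmul, map_add]
        exact Submodule.add_mem _ hx hy
      · rw [hP.diag_tmul]
        exact Submodule.mem_iSup_of_mem s (tmul_mem_tensorSub ⟨a, rfl⟩ ⟨b, rfl⟩)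
  · refine iSup_le fun s z hz => ?_
    refine tensorSub_induction (motive := fun z => z ∈ LinearMap.range (hP.diag Q))
      (Submodule.zero_mem _) (fun x y hx hy => Submodule.add_mem _ hx hy) ?_ hz
    rintro _ ⟨a, rfl⟩ _ ⟨b, rfl⟩
    exact ⟨P s a ⊗ₜ b, hP.diag_tmul s a b⟩

namespace BialgebraData

variable {I A : Type*} [AddCommGroup A] [Module ℂ A] (R : BialgebraData I A)

theorem T2_F2 (z : A ⊗[ℂ] A) : R.T2 (R.F2 z) = R.T2 z := by
  have h := R.opcop.T1_F1 (TensorProduct.comm ℂ A A z)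
  rw [opcop_F1] at h
  change TensorProduct.comm ℂ A A (R.T2 (TensorProduct.comm ℂ A A (TensorProduct.comm ℂ A A _))) =
    TensorProduct.comm ℂ A A (R.T2 (TensorProduct.comm ℂ A A (TensorProduct.comm ℂ A A z))) at h
  rw [comm_comm', comm_comm'] at h
  exact (TensorProduct.comm ℂ A A).injective h

theorem exists_isInv_iff : (∃ Q, R.IsInv Q) ↔
    ∃ K : A ⊗[ℂ] A →ₗ[ℂ] A ⊗[ℂ] A, (∀ z, K (R.T1 z) = R.F1 z) ∧ ∀ z, R.T1 (K z) = R.E1 z :=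
  ⟨fun ⟨Q, hQ⟩ => ⟨Q, hQ.QT, hQ.TQ⟩, fun ⟨_, h1, h2⟩ => ⟨_, IsInv.of_weak h1 h2⟩⟩

theorem exists_opcop_isInv_iff : (∃ Q, R.opcop.IsInv Q) ↔
    ∃ K : A ⊗[ℂ] A →ₗ[ℂ] A ⊗[ℂ] A, (∀ z, K (R.T2 z) = R.F2 z) ∧ ∀ z, R.T2 (K z) = R.E2 z := by
  have hT : ∀ z, R.opcop.T1 (TensorProduct.comm ℂ A A z) = TensorProduct.comm ℂ A A (R.T2 z) :=
    fun z => congrArg (fun z => TensorProduct.comm ℂ A A (R.T2 z)) (comm_comm' z)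
  rw [exists_isInv_iff]
  constructor
  · rintro ⟨K, h1, h2⟩
    refine ⟨flipConj A K, fun z => ?_, fun z => ?_⟩
    · rw [flipConj_apply, ← hT, h1, opcop_F1, comm_comm']
    · apply (TensorProduct.comm ℂ A A).injective
      rw [flipConj_apply, ← hT, comm_comm', h2, opcop_E1]
  · rintro ⟨K, h1, h2⟩
    refine ⟨flipConj A K, fun z => ?_, fun z => ?_⟩
    · obtain ⟨z, rfl⟩ := (TensorProduct.comm ℂ A A).surjective z
      rw [flipConj_apply, hT, comm_comm', h1, opcop_F1]
    · obtain ⟨z, rfl⟩ := (TensorProduct.comm ℂ A A).surjective z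
      rw [flipConj_apply, hT, comm_comm', h2, opcop_E1]

end BialgebraData

namespace RegularPartialMultiplierBialgebra

variable {I A : Type*} [NonUnitalRing A] [Module ℂ A] [IsScalarTower ℂ A A] [SMulCommClass ℂ A A]
  (H : RegularPartialMultiplierBialgebra I A)

/-- As `T` factors through `P` and has values in the range of `Q`, an inverse between the two ranges
extends to all of `A ⊗ A` by precomposing with `Q`. Conversely `K` provides injectivity on the range
of `P` and preimages for the range of `Q`. -/
theorem bijFromTo_range_iff (H : RegularPartialMultiplierBialgebra I A)
    {f : A ⊗[ℂ] A →ₗ[ℂ] Multiplier (A ⊗[ℂ] A)} {T P Q : A ⊗[ℂ] A →ₗ[ℂ] A ⊗[ℂ] A}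
    (hf : ∀ z, Multiplier.incl _ (T z) = f z)
    (hT : ∀ z, T (P z) = T z) (hQ : ∀ z, Q (T z) = T z) :
    BijFromTo f (LinearMap.range P) (LinearMap.range Q) ↔
      ∃ K : A ⊗[ℂ] A →ₗ[ℂ] A ⊗[ℂ] A, (∀ z, K (T z) = P z) ∧ ∀ z, T (K z) = Q z := by
  have hinj := Multiplier.incl_injective H.isNondeg_tensor
  constructor
  · intro h
    let e₀ : LinearMap.range P →ₗ[ℂ] LinearMap.range Q :=
      T.restrict fun z _ => ⟨T z, hQ z⟩
    have he : Function.Bijective e₀ := by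
      constructor
      · rintro ⟨x, hx⟩ ⟨y, hy⟩ hxy
        refine Subtype.ext (h.injOn hx hy ?_)
        rw [← hf, ← hf]
        exact congrArg _ (congrArg Subtype.val hxy)
      · rintro ⟨x, hx⟩
        obtain ⟨y, hy, hxy⟩ := h.surjOn ⟨x, hx, rfl⟩
        rw [← hf] at hxy
        exact ⟨⟨y, hy⟩, Subtype.ext (hinj hxy)⟩
    let e := LinearEquiv.ofBijective e₀ he
    refine ⟨(LinearMap.range P).subtype ∘ₗ e.symm.toLinearMap ∘ₗ Q.rangeRestrict,
      fun z => ?_, fun z => ?_⟩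
    · have h1 : Q.rangeRestrict (T z) = e ⟨P z, z, rfl⟩ :=
        Subtype.ext ((hQ z).trans (hT z).symm)
      simp only [LinearMap.comp_apply, LinearEquiv.coe_coe, h1, e.symm_apply_apply]
      rfl
    · exact congrArg Subtype.val (e.apply_symm_apply (Q.rangeRestrict z))
  · rintro ⟨K, h1, h2⟩
    refine ⟨?_, ?_, ?_⟩
    · rintro z -
      exact ⟨T z, ⟨T z, hQ z⟩, hf z⟩
    · rintro _ ⟨x, rfl⟩ _ ⟨y, rfl⟩ hxy
      rw [← hf, ← hf] at hxy
      have h3 : T (P x) = T (P y) := hinj hxy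
      rw [hT, hT] at h3
      rw [← h1, ← h1, h3]
    · rintro _ ⟨_, ⟨y, rfl⟩, rfl⟩
      exact ⟨P (K y), ⟨K y, rfl⟩, by rw [← hf, hT, h2]⟩

/-- The elementwise data of a regular partial multiplier bialgebra. -/
def toData : BialgebraData I A where
  m := LinearMap.mul ℂ A
  lu r := (H.G.unitUp r).left
  ll r := (H.G.unitLow r).left
  ru r := (H.G.unitUp r).right
  rl r := (H.G.unitLow r).right
  ε := H.ε
  DL := H.ΔL
  DR := H.ΔR
  T1 := H.T1
  T2 := H.T2
  U1 := H.U1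
  U2 := H.U2
  assoc a b c := mul_assoc a b c
  nondegL := H.isNondeg.left
  nondegR := H.isNondeg.right
  lu_m r a b := ((H.G.unitUp r).left_mul H.isNondeg a b).symm
  ll_m r a b := ((H.G.unitLow r).left_mul H.isNondeg a b).symm
  m_ru r a b := ((H.G.unitUp r).right_mul H.isNondeg a b).symm
  m_rl r a b := ((H.G.unitLow r).right_mul H.isNondeg a b).symm
  ru_m r a b := ((H.G.unitUp r).mul_left_eq a b).symm
  rl_m r a b := ((H.G.unitLow r).mul_left_eq a b).symm
  plu := H.G.partition_unitUp_left
  pll := H.G.partition_unitLow_left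
  pru := H.G.partition_unitUp_right
  prl := H.G.partition_unitLow_right
  lu_ll _ _ a := H.G.proj_comm _ _ a
  ru_rl _ _ a := H.G.proj_comm _ _ a
  lu_ru _ _ a := H.G.proj_comm _ _ a
  lu_rl _ _ a := H.G.proj_comm _ _ a
  ll_ru _ _ a := H.G.proj_comm _ _ a
  ll_rl _ _ a := H.G.proj_comm _ _ a
  ε_lu := H.counit_unit_left
  ε_ru := H.counit_unit_right
  ε_m_ll := H.counit_mul_unitLow
  ε_m_lu := H.counit_mul_unitUp
  ε_rl_ne r := by
    obtain ⟨a, ha, h⟩ := (H.counit_ne_zero r).1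
    rw [H.G.lowRight_eq_range] at ha
    obtain ⟨a, rfl⟩ := ha
    exact ⟨a, h⟩
  ε_ll_ne r := by
    obtain ⟨a, ha, h⟩ := (H.counit_ne_zero r).2
    rw [H.G.lowLeft_eq_range] at ha
    obtain ⟨a, rfl⟩ := ha
    exact ⟨a, h⟩
  DR_DL a z w := by
    rw [mulTensor_mul, mulTensor_mul, ΔR_apply, ΔL_apply, Multiplier.mul_left_eq]
  DL_m := H.Δ_left_mul
  DL_E a r z := H.ΔL_unitLow r a z
  E_DL a r z := H.unitLow_ΔL r a z
  DL_lu := H.ΔL_unitUp_left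
  DL_ll := H.ΔL_unitLow_left
  DL_ru := H.ΔL_unitUp_right
  DL_rl := H.ΔL_unitLow_right
  T1_spec := H.T1_spec
  U1_spec := H.U1_spec
  T2_spec := H.T2_spec
  U2_spec := H.U2_spec
  ε_T1 := H.counit_T1
  ε_U1 := H.counit_U1
  ε_T2 := H.counit_T2
  ε_U2 := H.counit_U2
  coassoc := H.coassoc

theorem isHopf_iff : H.IsRegularPartialMultiplierHopfAlgebra ↔ ∃ S, H.toData.IsAntipode S := by
  have h1 := H.bijFromTo_range_iff H.incl_T1 H.toData.T1_F1 H.toData.E1_T1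
  have h2 := H.bijFromTo_range_iff H.incl_T2 H.toData.T2_F2 H.toData.E2_T2
  have h3 := H.bijFromTo_range_iff H.incl_U1 H.toData.cop.T1_F1
    H.toData.cop.E1_T1
  have h4 := H.bijFromTo_range_iff H.incl_U2 H.toData.cop.T2_F2
    H.toData.cop.E2_T2
  have r1 : LinearMap.range H.toData.F1 = _ :=
    H.G.partition_unitLow_right.range_diag fun r => (H.G.unitLow r).left
  have r2 : LinearMap.range H.toData.E1 = _ :=
    H.G.partition_unitLow_left.range_diag fun r => (H.G.unitUp r).left
  have r3 : LinearMap.range H.toData.F2 = _ :=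
    H.G.partition_unitUp_right.range_diag fun r => (H.G.unitUp r).left
  have r4 : LinearMap.range H.toData.E2 = _ :=
    H.G.partition_unitLow_right.range_diag fun r => (H.G.unitUp r).right
  have r5 : LinearMap.range H.toData.cop.F1 = _ :=
    H.G.partition_unitUp_right.range_diag fun r => (H.G.unitUp r).left
  have r6 : LinearMap.range H.toData.cop.E1 = _ :=
    H.G.partition_unitUp_left.range_diag fun r => (H.G.unitLow r).left
  have r7 : LinearMap.range H.toData.cop.F2 = _ :=
    H.G.partition_unitLow_right.range_diag fun r => (H.G.unitLow r).left
  have r8 : LinearMap.range H.toData.cop.E2 = _ :=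
    H.G.partition_unitUp_right.range_diag fun r => (H.G.unitLow r).right
  simp only [r1, r2] at h1
  simp only [r3, r4] at h2
  simp only [r5, r6] at h3
  simp only [r7, r8] at h4
  rw [BialgebraData.exists_isAntipode_iff, BialgebraData.exists_isInv_iff,
    BialgebraData.exists_opcop_isInv_iff, BialgebraData.exists_isInv_iff,
    BialgebraData.exists_opcop_isInv_iff]
  refine Iff.trans ?_ (and_congr h1 (and_congr h2 (and_congr h3 h4)))
  simp only [← PartialAlgebra.upLeft_eq_range, ← PartialAlgebra.lowLeft_eq_range,
    ← PartialAlgebra.upRight_eq_range, ← PartialAlgebra.lowRight_eq_range]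
  exact ⟨fun h => ⟨h.can_r, h.can_l, h.can_r_c, h.can_l_c⟩,
    fun ⟨h, h', h'', h'''⟩ => ⟨h, h', h'', h'''⟩⟩

theorem mul'_map_left (S : A →ₗ[ℂ] A) (z : A ⊗[ℂ] A) :
    LinearMap.mul' ℂ A ((S ⊠ LinearMap.id) z) = H.toData.lmu S z := by
  induction z using TensorProduct.induction_on with
  | zero => simp
  | add x y hx hy => simp only [map_add, hx, hy]
  | tmul a b => rfl

theorem mul'_map_right (S : A →ₗ[ℂ] A) (z : A ⊗[ℂ] A) :
    LinearMap.mul' ℂ A ((LinearMap.id ⊠ S) z) = H.toData.rmu S z := by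
  induction z using TensorProduct.induction_on with
  | zero => simp
  | add x y hx hy => simp only [map_add, hx, hy]
  | tmul a b => rfl

theorem sndSlice_F2 (r : I) (a b : A) :
    sndSlice H.ε (H.toData.F2 (b ⊗ₜ (H.G.unitUp r).left a)) =
      H.ε ((H.G.unitUp r).left a) • (H.G.unitUp r).right b := by
  have h : H.toData.F2 (b ⊗ₜ (H.G.unitUp r).left a) = _ :=
    H.G.partition_unitUp_right.diag_tmul_snd H.G.partition_unitUp_left r b a
  rw [h, sndSlice_tmul]

/-- The antipode identities on `A_s` and `^rA` are the linear identities for `T1` and `T2` tested on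
the pieces `a1_s` and `1^r a`, which span `A`. -/
theorem isAntipode_iff (S : A →ₗ[ℂ] A) : H.IsAntipode S ↔ H.toData.IsAntipode S := by
  have hinj := Multiplier.incl_injective H.isNondeg_tensor
  constructor
  · intro h
    refine ⟨⟨h.map_mul, fun r a => (h.map_unitUp r a).2, fun r a => (h.map_unitLow r a).2,
      fun r a => (h.map_unitUp r a).1, fun r a => (h.map_unitLow r a).1, fun z => ?_, fun z => ?_⟩,
      h.bijective⟩
    · refine H.G.partition_unitLow_right.ext_fst (f := H.toData.lmu S ∘ₗ H.toData.T1)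
        (g := fstSlice H.ε ∘ₗ H.toData.F1) (fun s a b => ?_) z
      refine Eq.trans ?_ (H.toData.fstSlice_F1_rl s a b).symm
      rw [LinearMap.comp_apply, ← H.mul'_map_left]
      exact h.left_antipode s _ (by rw [H.G.lowRight_eq_range]; exact ⟨a, rfl⟩) b _ (H.incl_T1 _)
    · refine H.G.partition_unitUp_left.ext_snd (f := H.toData.rmu S ∘ₗ H.toData.T2)
        (g := sndSlice H.ε ∘ₗ H.toData.F2) (fun r a b => ?_) z
      refine Eq.trans ?_ (H.sndSlice_F2 r a b).symm
      rw [LinearMap.comp_apply, ← H.mul'_map_right]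
      exact h.right_antipode r _ (by rw [H.G.upLeft_eq_range]; exact ⟨a, rfl⟩) b _ (H.incl_T2 _)
  · intro h
    refine ⟨h.bijective, h.map_m, fun r a => ⟨h.map_rl r a, h.map_ll r a⟩,
      fun r a => ⟨h.map_ru r a, h.map_lu r a⟩, fun s a ha b z hz => ?_, fun r a ha b z hz => ?_⟩
    · rw [H.G.lowRight_eq_range] at ha
      obtain ⟨a, rfl⟩ := ha
      have h1 : z = H.toData.T1 ((H.G.unitLow s).right a ⊗ₜ b) :=
        hinj (hz.trans (H.incl_T1 ((H.G.unitLow s).right a ⊗ₜ b)).symm)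
      rw [H.mul'_map_left, h1, h.left]
      exact H.toData.fstSlice_F1_rl s a b
    · rw [H.G.upLeft_eq_range] at ha
      obtain ⟨a, rfl⟩ := ha
      have h1 : z = H.toData.T2 (b ⊗ₜ (H.G.unitUp r).left a) :=
        hinj (hz.trans (H.incl_T2 (b ⊗ₜ (H.G.unitUp r).left a)).symm)
      rw [H.mul'_map_right, h1, h.right]
      exact H.sndSlice_F2 r a b

end RegularPartialMultiplierBialgebra

end Main

end PartialHopf

end

theorem mainTheorem8 {I A : Type*} [NonUnitalRing A] [Module ℂ A] [IsScalarTower ℂ A A]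
    [SMulCommClass ℂ A A] (H : PartialHopf.RegularPartialMultiplierBialgebra I A) :
    (H.IsRegularPartialMultiplierHopfAlgebra ↔ ∃ S : A →ₗ[ℂ] A, H.IsAntipode S) ∧
    (∀ S S' : A →ₗ[ℂ] A, H.IsAntipode S → H.IsAntipode S' → S = S') ∧
    (∀ S : A →ₗ[ℂ] A, H.IsAntipode S →
      H.IsAntiComultiplicative S ∧ ∀ a, H.ε (S a) = H.ε a) := by
  refine ⟨?_, fun S S' hS hS' => ?_, fun S hS => ⟨fun a z => ?_, fun a => ?_⟩⟩
  · simp only [H.isHopf_iff, H.isAntipode_iff]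
  · exact ((H.isAntipode_iff S).1 hS).unique ((H.isAntipode_iff S').1 hS')
  · exact ⟨((H.isAntipode_iff S).1 hS).flipS_DR a z, ((H.isAntipode_iff S).1 hS).flipS_DL a z⟩
  · exact ((H.isAntipode_iff S).1 hS).ε_map a
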